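/- For $N\ge 1$ let $\Sigma_N=\{-1,1\}^N$ and consider the mixed $p$-spin Hamiltonian $$H_N(\sigma)=\sum_{p\ge 2}\frac{\beta_p}{N^{(p-1)/2}}\sum_{1\le i_1,\dots,i_p\le N} g_{i_1\dots i_p}\,\sigma_{i_1}\cdots\sigma_{i_p}+\sum_{i=1}^N\eta_i\sigma_i ,\qquad \sigma\in\Sigma_N,$$ where $\beta_p\ge 0$, the fields $\eta_i\in\mathbb R$ are arbitrary, the $g_{i_1\dots i_p}$ are i.i.d. standard Gaussian random variables over all $p$ and all $p$-tuples of pairwise distinct indices, and $g_{i_1\dots i_p}=0$ if two indices coincide. Let $\langle\cdot\rangle$ and $\langle\cdot\,;\cdot\rangle$ be the expectation and the covariance with respect to the Gibbs measure $\mu_N(\sigma)=e^{H_N(\sigma)}/\sum_{\tau\in\Sigma_N}e^{H_N(\tau)}$. Put $(\partial_j f)(\sigma)=\tfrac12\big(f(\sigma)-f(\hat\sigma_j)\big)$, where $\hat\sigma_j$ is $\sigma$ with the $j$-th spin flipped, let $B_j(\sigma)=\sigma_j(\partial_jH_N)(\sigma)$ be the cavity fields, and define $$D(f)=\sum_{j=1}^N\big\langle\cosh^{-2}(B_j)\,(\partial_jf)^2\big\rangle,\qquad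 a_{H_N}=\sup_{\substack{f:\Sigma_N\to\mathbb R\\ f\ne \mathrm{const.}}}\frac{\langle f;f\rangle}{D(f)} .$$ Then for every $\varepsilon>0$ there is $\beta_0=\beta_0(\varepsilon)>0$ such that, whenever $\beta:=\sum_{p\ge2}\sqrt{p^3\log p}\,\beta_p$ converges and $\beta<\beta_0$, there exist constants $c,C>0$, independent of $N$ and of the external fields, with $$\mathbb P\big(a_{H_N}>1+\varepsilon\big)\le C\,e^{-cN}\qquad\text{for all } N\ge 1 \text{ and all } \eta\in\mathbb R^N .$$ -/

import Mathlib

open MeasureTheory ProbabilityTheory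
open scoped ENNReal

noncomputable section

namespace MixedPSpin

/-- Spin configurations `Σ_N = {-1, 1}^N`; a spin is a unit of `ℤ`, i.e. `1` or `-1`. -/
abbrev Config (N : ℕ) : Type := Fin N → ℤˣ

/-- The real number `σ_i ∈ {-1, 1}`. -/
def spin {N : ℕ} (σ : Config N) (i : Fin N) : ℝ := ((σ i : ℤ) : ℝ)

/-- The configuration `σ̂_i`, in which the `i`-th spin is flipped. -/
def flip {N : ℕ} (i : Fin N) (σ : Config N) : Config N := Function.update σ i (-σ i)

/-- The discrete derivative `(∂_i f)(σ) = (f(σ) - f(σ̂_i)) / 2`. -/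
def pderiv {N : ℕ} (i : Fin N) (f : Config N → ℝ) (σ : Config N) : ℝ :=
  (f σ - f (flip i σ)) / 2

/-- The partition function of the energy `H`. -/
def partitionFunction {N : ℕ} (H : Config N → ℝ) : ℝ := ∑ σ, Real.exp (H σ)

/-- The Gibbs measure `μ(σ) = e^{H(σ)} / Z`. -/
def gibbs {N : ℕ} (H : Config N → ℝ) (σ : Config N) : ℝ :=
  Real.exp (H σ) / partitionFunction H

/-- The Gibbs expectation `⟨f⟩`. -/
def mean {N : ℕ} (H f : Config N → ℝ) : ℝ := ∑ σ, gibbs H σ * f σ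

/-- The Gibbs covariance `⟨f ; g⟩ = ⟨f g⟩ - ⟨f⟩⟨g⟩`. -/
def cov {N : ℕ} (H f g : Config N → ℝ) : ℝ :=
  mean H (fun σ => f σ * g σ) - mean H f * mean H g

/-- The cavity field `B_j(σ) = σ_j (∂_j H)(σ)`. -/
def cavityField {N : ℕ} (H : Config N → ℝ) (j : Fin N) (σ : Config N) : ℝ :=
  spin σ j * pderiv j H σ

/-- The weighted Dirichlet form `D(f) = ∑_j ⟨cosh⁻²(B_j) (∂_j f)²⟩`. -/
def dirichlet {N : ℕ} (H f : Config N → ℝ) : ℝ :=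
  ∑ j, mean H (fun σ => (Real.cosh (cavityField H j σ) ^ 2)⁻¹ * pderiv j f σ ^ 2)

/-- The inverse spectral gap `a_H`: the supremum of `⟨f ; f⟩ / D(f)` over all non-constant
`f : Σ_N → ℝ`, as an extended nonnegative number. -/
def inverseGap {N : ℕ} (H : Config N → ℝ) : ℝ≥0∞ :=
  ⨆ (f : Config N → ℝ) (_ : ¬ ∃ c : ℝ, ∀ σ, f σ = c),
    ENNReal.ofReal (cov H f f) / ENNReal.ofReal (dirichlet H f)

/-- The mixed `p`-spin Hamiltonian on `N` spins with temperature coefficients `b p` (`p ≥ 2`),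
couplings `g p (i_1, …, i_p)` and external fields `η`. If `g` vanishes on tuples with a repeated
entry then all terms with `p > N` are zero, so that the series over `p` is a finite sum. -/
def hamiltonian (b : ℕ → ℝ) (g : (p : ℕ) → (Fin p → ℕ) → ℝ) {N : ℕ} (η : Fin N → ℝ)
    (σ : Config N) : ℝ :=
  (∑' p : {p : ℕ // 2 ≤ p}, b p / (N : ℝ) ^ (((p : ℝ) - 1) / 2) *
    ∑ i : Fin (p : ℕ) → Fin N, g p (fun k => (i k : ℕ)) * ∏ k, spin σ (i k)) +
  ∑ j, η j * spin σ j

/-- The couplings `g_{i_1 … i_p}` are independent standard Gaussian random variables, jointly over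
all `p` and all `p`-tuples of distinct indices, and vanish if two indices coincide. -/
structure IsGaussianCoupling {Ω : Type*} [MeasurableSpace Ω] (P : Measure Ω)
    (g : (p : ℕ) → (Fin p → ℕ) → Ω → ℝ) : Prop where
  hasLaw : ∀ (p : ℕ) (i : Fin p → ℕ), Function.Injective i →
    HasLaw (g p i) (gaussianReal 0 1) P
  indep : iIndepFun
    (fun t : {t : (p : ℕ) × (Fin p → ℕ) // Function.Injective t.2} => g t.1.1 t.1.2) P
  eq_zero : ∀ (p : ℕ) (i : Fin p → ℕ), ¬ Function.Injective i → ∀ ω, g p i ω = 0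

end MixedPSpin

end

/-! Notation: B_k is the cavity field, m_k = tanh B_k, v_k = cosh⁻² B_k and J_ij = `grad i (grad j
H)`. The operator L f = Σ_k (σ_k − m_k) `grad k f` is symmetric and positive in L²(μ) with quadratic
form D, so a spectral gap l follows from ⟨(Lf)²⟩ ≥ l D(f) (`blockGap_of_generator`). Expanding the
square and integrating by parts in two spins gives an integrated Bochner inequality (`bochner`):
⟨(Lf)²⟩ is at least (1 − O(r²)) D(f) + Γ/4 − ⟨Σ J_ij x_i x_j⟩, where x_k = v_k `grad k f`, Γ
collects the squared second derivatives of f, and r bounds the rows of J. The external fields do not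
enter J, which gives uniformity in them. It remains to bound the Hessian form from above.

For the degree q polynomial p_q with coupling b_q, the Hessian has norm of order q^{3/2} on vectors
orthogonal to σ, but in the direction σ Euler's identity gives an eigenvalue of order q²|E| with E =
p_q/N (`PolyBound.quad_le`). By Cauchy–Schwarz the radial part of x costs q²|E| (Σ_k v_k/N) Σ_k v_k
(`grad k f`)². To reach q^{3/2}, the product |E| Σ_k v_k/N must act as a form of size q^{-1/2}: the
energy has to be small wherever many spins are not frozen.

This is proved by induction on the size of the set A of active spins. Put d = √q and cut A into at
most 5d blocks of at most N/(2d) spins. On each block the gap is already known, at all temperatures.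
Remove degree q from the Hamiltonian. Then p_q is independent of the rest, with covariance N R^q up
to the tuples with repeated indices, R being the overlap. So ⟨E²⟩ is of order 1/N + max ⟨R^q⟩; if
the block is disordered, R stays away from 1 and R^q is small. Hence disorder times ⟨|E|⟩ is of
order d⁻² (`RegularOn.disorder_sq_mul_le`). Switching degree q back on changes both factors little,
their derivatives being covariances controlled by the block gap. This gives ⟨|E| Σ_{k∈block} v_k/N⟩
= O(d⁻²) on each block (`RegularOn.condMean_abs_mul_disorder_le`). The block gap turns this average
into a form bound, whose derivative terms are absorbed by Γ/4. Summing the blocks gives O(1/d), and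
the gap constant depends only on κ = Σ q^{3/2} b_q, so the induction loses nothing
(`RegularSystem.blockGap`).

Degrees with q³ > N² satisfy |p_q| ≤ KN ≤ K q^{3/2}; their sum is bounded and is treated by
Holley–Stroock perturbation. The probabilistic inputs (`polyBound_fail_le`,
`secondMomentBound_fail_le`) are tail bounds for Gaussian quadratic forms combined with union bounds
over exponentially many events. -/

noncomputable section

namespace MixedPSpin

variable {N : ℕ}

/-! ### Spins, flips and discrete gradients -/

theorem spin_mul_self (σ : Config N) (i : Fin N) : spin σ i * spin σ i = 1 := by
  unfold spin
  rcases Int.units_eq_one_or (σ i) with h | h <;> simp [h]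

theorem spin_sq (σ : Config N) (i : Fin N) : spin σ i ^ 2 = 1 := by
  rw [sq, spin_mul_self]

theorem abs_spin (σ : Config N) (i : Fin N) : |spin σ i| = 1 := by
  unfold spin
  rcases Int.units_eq_one_or (σ i) with h | h <;> simp [h]

theorem spin_eq_or (σ : Config N) (i : Fin N) : spin σ i = 1 ∨ spin σ i = -1 := by
  unfold spin
  rcases Int.units_eq_one_or (σ i) with h | h <;> simp [h]

theorem flip_flip (i : Fin N) (σ : Config N) : flip i (flip i σ) = σ := by
  simp [flip]

theorem flip_comm {i j : Fin N} (h : i ≠ j) (σ : Config N) :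
    flip i (flip j σ) = flip j (flip i σ) := by
  unfold flip
  rw [Function.update_of_ne h, Function.update_of_ne h.symm, Function.update_comm h]

theorem spin_flip_self (σ : Config N) (i : Fin N) : spin (flip i σ) i = -spin σ i := by
  simp [spin, flip]

theorem spin_flip_ne {i j : Fin N} (h : j ≠ i) (σ : Config N) :
    spin (flip i σ) j = spin σ j := by
  simp [spin, flip, Function.update_of_ne h]

/-- The discrete gradient `σ_i ∂_i f`. -/
def grad (i : Fin N) (f : Config N → ℝ) (σ : Config N) : ℝ :=
  spin σ i * ((f σ - f (flip i σ)) / 2)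

/-- As a function of the single spin σ_i, f is affine with slope `grad i f`. -/
theorem apply_flip (i : Fin N) (f : Config N → ℝ) (σ : Config N) :
    f (flip i σ) = f σ - 2 * spin σ i * grad i f σ := by
  have h := spin_mul_self σ i
  unfold grad
  linear_combination (f σ - f (flip i σ)) * h

theorem grad_flip_self (i : Fin N) (f : Config N → ℝ) (σ : Config N) :
    grad i f (flip i σ) = grad i f σ := by
  unfold grad; rw [flip_flip, spin_flip_self]; ring

theorem grad_comm (i j : Fin N) (f : Config N → ℝ) : grad i (grad j f) = grad j (grad i f) := by
  by_cases h : i = j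
  · rw [h]
  · funext σ
    simp only [grad, spin_flip_ne h, spin_flip_ne (Ne.symm h), flip_comm h]
    ring

theorem grad_eq_zero {i : Fin N} {f : Config N → ℝ} (h : ∀ σ, f (flip i σ) = f σ) (σ : Config N) :
    grad i f σ = 0 := by
  simp [grad, h]

theorem grad_grad_self (i : Fin N) (f : Config N → ℝ) (σ : Config N) : grad i (grad i f) σ = 0 :=
  grad_eq_zero (grad_flip_self i f) σ

theorem grad_mul (i : Fin N) (f g : Config N → ℝ) (σ : Config N) :
    grad i (fun σ => f σ * g σ) σ = f (flip i σ) * grad i g σ + g σ * grad i f σ := by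
  unfold grad; ring

theorem grad_mul_of_invariant {i : Fin N} {f g : Config N → ℝ} (h : ∀ σ, g (flip i σ) = g σ)
    (σ : Config N) : grad i (fun σ => f σ * g σ) σ = grad i f σ * g σ := by
  simp only [grad, h]; ring

theorem grad_add (i : Fin N) (f g : Config N → ℝ) (σ : Config N) :
    grad i (fun σ => f σ + g σ) σ = grad i f σ + grad i g σ := by
  unfold grad; ring

theorem grad_sub (i : Fin N) (f g : Config N → ℝ) (σ : Config N) :
    grad i (fun σ => f σ - g σ) σ = grad i f σ - grad i g σ := by
  unfold grad; ring

theorem grad_const_mul (i : Fin N) (c : ℝ) (f : Config N → ℝ) (σ : Config N) :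
    grad i (fun σ => c * f σ) σ = c * grad i f σ := by
  unfold grad; ring

theorem grad_sum {ι : Type*} (s : Finset ι) (i : Fin N) (f : ι → Config N → ℝ) (σ : Config N) :
    grad i (fun σ => ∑ a ∈ s, f a σ) σ = ∑ a ∈ s, grad i (f a) σ := by
  simp only [grad, ← Finset.sum_sub_distrib, Finset.sum_div, Finset.mul_sum]

theorem grad_spin_self (i : Fin N) (σ : Config N) : grad i (fun σ => spin σ i) σ = 1 := by
  have := spin_mul_self σ i
  simp only [grad, spin_flip_self]; linarith

theorem grad_spin_ne {i j : Fin N} (h : j ≠ i) (σ : Config N) :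
    grad i (fun σ => spin σ j) σ = 0 :=
  grad_eq_zero (fun σ => spin_flip_ne h σ) σ

theorem abs_grad_abs_le (i : Fin N) (f : Config N → ℝ) (σ : Config N) :
    |grad i (fun σ => |f σ|) σ| ≤ |grad i f σ| := by
  simp only [grad, abs_mul, abs_spin, abs_div]
  have := abs_abs_sub_abs_le (f σ) (f (flip i σ))
  gcongr

/-! ### Freezing the spins outside a block -/

/-- The configurations that agree with `τ` outside `b`. -/
def fiber (b : Finset (Fin N)) (τ : Config N) : Finset (Config N) :=
  Finset.univ.filter fun σ => ∀ i, i ∉ b → σ i = τ i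

theorem mem_fiber {b : Finset (Fin N)} {σ τ : Config N} :
    σ ∈ fiber b τ ↔ ∀ i, i ∉ b → σ i = τ i := by
  simp [fiber]

theorem self_mem_fiber (b : Finset (Fin N)) (τ : Config N) : τ ∈ fiber b τ := by
  simp [fiber]

theorem fiber_nonempty (b : Finset (Fin N)) (τ : Config N) : (fiber b τ).Nonempty :=
  ⟨τ, self_mem_fiber b τ⟩

theorem mem_fiber_comm {b : Finset (Fin N)} {σ τ : Config N} :
    σ ∈ fiber b τ ↔ τ ∈ fiber b σ := by
  simp only [mem_fiber]
  exact ⟨fun h i hi => (h i hi).symm, fun h i hi => (h i hi).symm⟩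

theorem fiber_univ (τ : Config N) : fiber Finset.univ τ = Finset.univ := by
  simp [fiber]

theorem flip_mem_fiber {b : Finset (Fin N)} {k : Fin N} (hk : k ∈ b) {σ τ : Config N} :
    flip k σ ∈ fiber b τ ↔ σ ∈ fiber b τ := by
  simp only [mem_fiber, flip]
  refine forall_congr' fun i => ?_
  by_cases h : i = k
  · subst h; simp [hk]
  · rw [Function.update_of_ne h]

theorem card_fiber_eq (b : Finset (Fin N)) (σ : Config N) :
    (fiber b σ).card = (fiber b (1 : Config N)).card := by
  refine Finset.card_bij' (fun τ _ => τ * σ) (fun τ _ => τ * σ) ?_ ?_ ?_ ?_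
  · intro τ h; rw [mem_fiber] at h ⊢
    intro i hi; simp [h i hi]
  · intro τ h; rw [mem_fiber] at h ⊢
    intro i hi; simp [h i hi]
  · intro τ _; funext i; simp [mul_assoc]
  · intro τ _; funext i; simp [mul_assoc]

/-- Membership in a fiber is symmetric and all fibers have the same size, so every configuration is
counted equally often. Inequalities on fibers can thus be summed to global ones. -/
theorem sum_sum_fiber (b : Finset (Fin N)) (f : Config N → ℝ) :
    ∑ τ, ∑ σ ∈ fiber b τ, f σ = (fiber b (1 : Config N)).card * ∑ σ, f σ := by
  have h : ∀ τ, ∑ σ ∈ fiber b τ, f σ = ∑ σ, if τ ∈ fiber b σ then f σ else 0 := by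
    intro τ
    rw [← Finset.sum_filter]
    refine Finset.sum_congr ?_ fun _ _ => rfl
    ext σ
    simp [mem_fiber_comm (σ := σ)]
  simp only [h]
  rw [Finset.sum_comm, Finset.mul_sum]
  refine Finset.sum_congr rfl fun σ _ => ?_
  rw [← Finset.sum_filter, Finset.sum_const, nsmul_eq_mul, ← card_fiber_eq b σ]
  congr 3
  ext τ
  simp

/-- Sums over a flip-invariant set may be symmetrized. -/
theorem sum_congr_flip {S : Finset (Config N)} {k : Fin N}
    (hS : ∀ σ, flip k σ ∈ S ↔ σ ∈ S) {f g : Config N → ℝ}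
    (h : ∀ σ, f σ + f (flip k σ) = g σ + g (flip k σ)) :
    ∑ σ ∈ S, f σ = ∑ σ ∈ S, g σ := by
  have key : ∀ f : Config N → ℝ, ∑ σ ∈ S, f (flip k σ) = ∑ σ ∈ S, f σ := fun f =>
    Finset.sum_bij' (fun σ _ => flip k σ) (fun σ _ => flip k σ)
      (fun σ h => (hS σ).2 h) (fun σ h => (hS σ).2 h) (fun σ _ => flip_flip k σ)
      (fun σ _ => flip_flip k σ) (fun σ _ => rfl)
  have h1 : ∑ σ ∈ S, (f σ + f (flip k σ)) = ∑ σ ∈ S, (g σ + g (flip k σ)) :=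
    Finset.sum_congr rfl fun σ _ => h σ
  rw [Finset.sum_add_distrib, Finset.sum_add_distrib, key, key] at h1
  linarith

theorem sum_le_flip {S : Finset (Config N)} {k : Fin N}
    (hS : ∀ σ, flip k σ ∈ S ↔ σ ∈ S) {f g : Config N → ℝ}
    (h : ∀ σ, f σ + f (flip k σ) ≤ g σ + g (flip k σ)) :
    ∑ σ ∈ S, f σ ≤ ∑ σ ∈ S, g σ := by
  have key : ∀ f : Config N → ℝ, ∑ σ ∈ S, f (flip k σ) = ∑ σ ∈ S, f σ := fun f =>
    Finset.sum_bij' (fun σ _ => flip k σ) (fun σ _ => flip k σ)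
      (fun σ h => (hS σ).2 h) (fun σ h => (hS σ).2 h) (fun σ _ => flip_flip k σ)
      (fun σ _ => flip_flip k σ) (fun σ _ => rfl)
  have h1 : ∑ σ ∈ S, (f σ + f (flip k σ)) ≤ ∑ σ ∈ S, (g σ + g (flip k σ)) :=
    Finset.sum_le_sum fun σ _ => h σ
  rw [Finset.sum_add_distrib, Finset.sum_add_distrib, key, key] at h1
  linarith

/-! ### One-spin conditional laws and integration by parts -/

/-- The magnetization `tanh B_k` of the `k`-th spin given the others. -/
def mag (H : Config N → ℝ) (k : Fin N) (σ : Config N) : ℝ := Real.tanh (grad k H σ)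

/-- The variance `cosh⁻² B_k` of the `k`-th spin given the others. -/
def spinVar (H : Config N → ℝ) (k : Fin N) (σ : Config N) : ℝ :=
  (Real.cosh (grad k H σ) ^ 2)⁻¹

theorem mag_flip (H : Config N → ℝ) (k : Fin N) (σ : Config N) :
    mag H k (flip k σ) = mag H k σ := by
  simp [mag, grad_flip_self]

theorem spinVar_flip (H : Config N → ℝ) (k : Fin N) (σ : Config N) :
    spinVar H k (flip k σ) = spinVar H k σ := by
  simp [spinVar, grad_flip_self]

theorem spinVar_pos (H : Config N → ℝ) (k : Fin N) (σ : Config N) : 0 < spinVar H k σ := by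
  have := Real.cosh_pos (grad k H σ)
  unfold spinVar; positivity

theorem spinVar_le_one (H : Config N → ℝ) (k : Fin N) (σ : Config N) : spinVar H k σ ≤ 1 := by
  have := Real.one_le_cosh (grad k H σ)
  unfold spinVar
  exact inv_le_one_of_one_le₀ (one_le_pow₀ this)

theorem mag_sq_add_spinVar (H : Config N → ℝ) (k : Fin N) (σ : Config N) :
    mag H k σ ^ 2 + spinVar H k σ = 1 := by
  have h := Real.cosh_pos (grad k H σ)
  have h2 := Real.cosh_sq (grad k H σ)
  unfold mag spinVar
  rw [Real.tanh_eq_sinh_div_cosh]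
  field_simp
  linarith

/-- Gaussian-type integration by parts for a single spin. -/
theorem sum_spin_sub_mag_mul {S : Finset (Config N)} {k : Fin N}
    (hS : ∀ σ, flip k σ ∈ S ↔ σ ∈ S) (H f : Config N → ℝ) :
    ∑ σ ∈ S, Real.exp (H σ) * ((spin σ k - mag H k σ) * f σ) =
      ∑ σ ∈ S, Real.exp (H σ) * (spinVar H k σ * grad k f σ) := by
  refine sum_congr_flip hS fun σ => ?_
  rw [spin_flip_self, mag_flip, spinVar_flip, grad_flip_self, apply_flip k f σ]
  -- The configurations σ and its flip have weights w e^{±σ_k B} with a common w, so the claim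
  -- becomes an identity in cosh B and sinh B.
  have hb : Real.exp (H (flip k σ)) = Real.exp (H σ - spin σ k * grad k H σ) *
      Real.exp (-(spin σ k * grad k H σ)) := by
    rw [← Real.exp_add, apply_flip k H σ]; ring_nf
  have ha : Real.exp (H σ) = Real.exp (H σ - spin σ k * grad k H σ) *
      Real.exp (spin σ k * grad k H σ) := by
    rw [← Real.exp_add]; ring_nf
  rw [hb, ha]
  unfold mag spinVar
  set B := grad k H σ
  set w := Real.exp (H σ - spin σ k * B)
  have hc := Real.cosh_pos B
  have hs := Real.cosh_sq B
  rw [Real.tanh_eq_sinh_div_cosh]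
  rcases spin_eq_or σ k with h | h <;> rw [h] <;>
    simp only [one_mul, neg_one_mul, neg_neg] <;>
    rw [show Real.exp B = Real.cosh B + Real.sinh B from (Real.cosh_add_sinh B).symm,
      show Real.exp (-B) = Real.cosh B - Real.sinh B from (Real.cosh_sub_sinh B).symm] <;>
    field_simp <;> ring_nf <;> simp only [show Real.cosh B ^ 3 = Real.cosh B * Real.cosh B ^ 2 by ring, hs] <;> ring

/-! ### Scalar inequalities for cosh and tanh -/

theorem cosh_add_le (x d : ℝ) : Real.cosh (x + d) ≤ Real.exp |d| * Real.cosh x := by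
  have h1 : Real.exp d ≤ Real.exp |d| := Real.exp_le_exp.2 (le_abs_self d)
  have h2 : Real.exp (-d) ≤ Real.exp |d| := Real.exp_le_exp.2 (neg_le_abs d)
  rw [Real.cosh_eq, Real.cosh_eq, neg_add, Real.exp_add, Real.exp_add]
  nlinarith [Real.exp_pos x, Real.exp_pos (-x)]

theorem exp_le_one_add_of_le {u : ℝ} (h0 : 0 ≤ u) (h1 : u ≤ 1) : Real.exp u ≤ 1 + u + u ^ 2 := by
  have := Real.abs_exp_sub_one_sub_id_le (x := u) (by rw [abs_of_nonneg h0]; exact h1)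
  linarith [(abs_le.1 this).2]

theorem abs_sinh_sub_le {u : ℝ} (h : |u| ≤ 1) : |Real.sinh u - u| ≤ u ^ 2 := by
  have h1 := abs_le.1 (Real.abs_exp_sub_one_sub_id_le h)
  have h2 := abs_le.1 (Real.abs_exp_sub_one_sub_id_le (x := -u) (by rwa [abs_neg]))
  rw [Real.sinh_eq, abs_le]
  constructor <;> nlinarith [h1.1, h1.2, h2.1, h2.2]

section scalar

variable {x h : ℝ} (hh : |h| ≤ 1 / 8)
include hh

/-- Flipping spin i moves the cavity field at j from x to x − 2h with |h| = |J_ij|. All estimates of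
this section are relative to cosh x, because x contains an arbitrary external field. -/
theorem cosh_ratio : Real.cosh (x - 2 * h) ≤ (1 + 5 / 2 * |h|) * Real.cosh x ∧
    Real.cosh x ≤ (1 + 5 / 2 * |h|) * Real.cosh (x - 2 * h) := by
  have e : Real.exp |2 * h| ≤ 1 + 5 / 2 * |h| := by
    have := exp_le_one_add_of_le (abs_nonneg (2 * h)) (by rw [abs_mul, abs_two]; linarith)
    rw [abs_mul, abs_two] at this ⊢
    nlinarith [abs_nonneg h]
  have h1 := cosh_add_le x (-(2 * h))
  have h2 := cosh_add_le (x - 2 * h) (2 * h)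
  rw [abs_neg, ← sub_eq_add_neg] at h1
  rw [sub_add_cancel] at h2
  exact ⟨h1.trans (mul_le_mul_of_nonneg_right e (Real.cosh_pos _).le),
    h2.trans (mul_le_mul_of_nonneg_right e (Real.cosh_pos _).le)⟩

/-- The difference of the two tanh equals sinh(2h) / (cosh x cosh(x − 2h)). Replacing sinh(2h) by 2h
and cosh(x − 2h) by cosh x costs second order in h, with the factor cosh⁻² x preserved. -/
theorem tanh_sub_tanh_le :
    |(Real.tanh x - Real.tanh (x - 2 * h)) / 2 - h * (Real.cosh x ^ 2)⁻¹| ≤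
      8 * h ^ 2 * (Real.cosh x ^ 2)⁻¹ := by
  obtain ⟨r1, r2⟩ := cosh_ratio (x := x) hh
  have c1 := Real.cosh_pos x
  have c2 := Real.cosh_pos (x - 2 * h)
  have hs : Real.tanh x - Real.tanh (x - 2 * h) =
      Real.sinh (2 * h) / (Real.cosh x * Real.cosh (x - 2 * h)) := by
    rw [Real.tanh_eq_sinh_div_cosh, Real.tanh_eq_sinh_div_cosh,
      show Real.sinh (2 * h) = Real.sinh (x - (x - 2 * h)) by ring_nf, Real.sinh_sub x (x - 2 * h)]
    field_simp
  have hu : |2 * h| ≤ 1 := by rw [abs_mul, abs_two]; linarith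
  have sb := abs_sinh_sub_le hu
  have a0 := abs_nonneg h
  rw [hs]
  set s := Real.sinh (2 * h)
  set C := Real.cosh x
  set D := Real.cosh (x - 2 * h)
  have : s / (C * D) / 2 - h * (C ^ 2)⁻¹ = ((s - 2 * h) * C + 2 * h * (C - D)) / (2 * C ^ 2 * D) := by
    field_simp; ring
  rw [this, abs_div, abs_of_pos (show 0 < 2 * C ^ 2 * D by positivity), div_le_iff₀ (by positivity)]
  have e1 : 8 * h ^ 2 * (C ^ 2)⁻¹ * (2 * C ^ 2 * D) = 16 * h ^ 2 * D := by field_simp; ring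
  rw [e1]
  have d1 : |C - D| ≤ 5 / 2 * |h| * (5/4 * D + D/ 4) := by
    rw [abs_le]; constructor <;> nlinarith [mul_nonneg a0 c2.le]
  have d2 : C ≤ 2 * D := by nlinarith
  calc |(s - 2 * h) * C + 2 * h * (C - D)| ≤ |s - 2 * h| * C + 2 * |h| * |C - D| := by
        refine (abs_add_le _ _).trans ?_
        rw [abs_mul, abs_mul, abs_mul, abs_two, abs_of_pos c1]
    _ ≤ (2 * h) ^ 2 * (2 * D) + 2 * |h| * (5 / 2 * |h| * (5/4 * D + D/ 4)) := by gcongr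
    _ ≤ 16 * h ^ 2 * D := by
        nlinarith [sq_abs h, mul_nonneg (sq_nonneg h) c2.le]

theorem inv_cosh_sub_le :
    |((Real.cosh x)⁻¹ - (Real.cosh (x - 2 * h))⁻¹) / 2| ≤ 5 / 4 * |h| * (Real.cosh x)⁻¹ := by
  obtain ⟨r1, r2⟩ := cosh_ratio (x := x) hh
  have c1 := Real.cosh_pos x
  have c2 := Real.cosh_pos (x - 2 * h)
  have a0 := abs_nonneg h
  set C := Real.cosh x
  set D := Real.cosh (x - 2 * h)
  have : (C⁻¹ - D⁻¹) / 2 = (D - C) / (2 * D) * C⁻¹ := by field_simp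
  rw [this, abs_mul, abs_of_pos (inv_pos.2 c1)]
  gcongr
  rw [abs_div, abs_of_pos (show 0 < 2 * D by positivity), div_le_iff₀ (by positivity), abs_le]
  constructor
  · nlinarith
  · nlinarith [mul_nonneg a0 c2.le, mul_nonneg (mul_nonneg a0 a0) c2.le]

theorem inv_cosh_sq_le : (Real.cosh (x - 2 * h) ^ 2)⁻¹ ≤ 2 * (Real.cosh x ^ 2)⁻¹ ∧
    1 / 2 * (Real.cosh x ^ 2)⁻¹ ≤ (Real.cosh (x - 2 * h) ^ 2)⁻¹ := by
  obtain ⟨r1, r2⟩ := cosh_ratio (x := x) hh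
  have c1 := Real.cosh_pos x
  have c2 := Real.cosh_pos (x - 2 * h)
  have a0 := abs_nonneg h
  set C := Real.cosh x
  set D := Real.cosh (x - 2 * h)
  have q1 : D ≤ 21 / 16 * C := by nlinarith
  have q2 : C ≤ 21 / 16 * D := by nlinarith
  rw [← div_eq_mul_inv, ← div_eq_mul_inv, inv_eq_one_div, div_le_div_iff₀ (by positivity) (by positivity),
    div_le_div_iff₀ (by positivity) (by positivity)]
  constructor <;> nlinarith

theorem inv_cosh_sq_sub_le : |((Real.cosh x ^ 2)⁻¹ - (Real.cosh (x - 2 * h) ^ 2)⁻¹) / 2| ≤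
    3 * |h| * (Real.cosh x ^ 2)⁻¹ := by
  have h1 := inv_cosh_sub_le (x := x) hh
  have c1 := inv_pos.2 (Real.cosh_pos x)
  have c2 := inv_pos.2 (Real.cosh_pos (x - 2 * h))
  have a0 := abs_nonneg h
  rw [← inv_pow, ← inv_pow]
  set C := (Real.cosh x)⁻¹
  set D := (Real.cosh (x - 2 * h))⁻¹
  have : (C ^ 2 - D ^ 2) / 2 = (C - D) / 2 * (C + D) := by ring
  rw [this, abs_mul, abs_of_pos (show 0 < C + D by positivity)]
  have h3 := abs_le.1 h1
  have h2 : C + D ≤ 12 / 5 * C := by nlinarith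
  calc |(C - D) / 2| * (C + D) ≤ 5 / 4 * |h| * C * (12 / 5 * C) := by gcongr
    _ = 3 * |h| * C ^ 2 := by ring

end scalar

/-! ### Response of magnetizations and variances to a flip -/

variable (H : Config N → ℝ) {i j : Fin N} {σ : Config N}

theorem grad_apply_flip (i j : Fin N) (σ : Config N) :
    grad j H (flip i σ) = grad j H σ - 2 * (spin σ i * grad i (grad j H) σ) := by
  rw [apply_flip i (grad j H)]; ring

theorem abs_spin_mul (σ : Config N) (i : Fin N) (x : ℝ) : |spin σ i * x| = |x| := by
  rw [abs_mul, abs_spin, one_mul]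

section

variable (hJ : |grad i (grad j H) σ| ≤ 1 / 8)
include hJ

theorem abs_grad_spinVar_le :
    |grad i (spinVar H j) σ| ≤ 3 * |grad i (grad j H) σ| * spinVar H j σ := by
  have := inv_cosh_sq_sub_le (x := grad j H σ) (h := spin σ i * grad i (grad j H) σ)
    (by rwa [abs_spin_mul])
  rw [abs_spin_mul] at this
  rw [grad, abs_spin_mul]
  simpa only [spinVar, grad_apply_flip] using this

theorem spinVar_flip_ge : 1 / 2 * spinVar H j σ ≤ spinVar H j (flip i σ) := by
  have := (inv_cosh_sq_le (x := grad j H σ) (h := spin σ i * grad i (grad j H) σ)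
    (by rwa [abs_spin_mul])).2
  simpa only [spinVar, grad_apply_flip] using this

/-- Since tanh' = cosh⁻², m_j responds to spin i with slope J_ij v_j to first order. This term is
the origin of the Hessian form in the Bochner inequality. -/
theorem abs_grad_mag_sub_le :
    |grad i (mag H j) σ - grad i (grad j H) σ * spinVar H j σ| ≤
      8 * grad i (grad j H) σ ^ 2 * spinVar H j σ := by
  have := tanh_sub_tanh_le (x := grad j H σ) (h := spin σ i * grad i (grad j H) σ)
    (by rwa [abs_spin_mul])
  rw [mul_pow, spin_sq, one_mul] at this
  have e : grad i (mag H j) σ - grad i (grad j H) σ * spinVar H j σ = spin σ i *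
      ((mag H j σ - mag H j (flip i σ)) / 2 - spin σ i * grad i (grad j H) σ * spinVar H j σ) := by
    have := spin_mul_self σ i
    rw [grad]; linear_combination grad i (grad j H) σ * spinVar H j σ * this
  rw [e, abs_spin_mul]
  simpa only [mag, spinVar, grad_apply_flip] using this

/-- The gradient of `f / cosh B_j`, for `f` the gradient of a function. -/
theorem grad_inv_cosh_mul_sq_le (φ : Config N → ℝ) :
    grad i (fun σ => (Real.cosh (grad j H σ))⁻¹ * φ σ) σ ^ 2 ≤
      4 * spinVar H j σ * grad i φ σ ^ 2 +
        4 * grad i (grad j H) σ ^ 2 * spinVar H j σ * φ σ ^ 2 := by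
  rw [grad_mul]
  have hs : |spin σ i * grad i (grad j H) σ| ≤ 1 / 8 := by rwa [abs_spin_mul]
  have h1 := inv_cosh_sub_le (x := grad j H σ) hs
  have h2 := (inv_cosh_sq_le (x := grad j H σ) hs).1
  rw [abs_spin_mul] at h1
  rw [← grad_apply_flip] at h1 h2
  have h3 : grad i (fun σ => (Real.cosh (grad j H σ))⁻¹) σ ^ 2 ≤
      2 * grad i (grad j H) σ ^ 2 * spinVar H j σ := by
    rw [← sq_abs (grad i _ σ), grad, abs_spin_mul]
    calc _ ≤ (5 / 4 * |grad i (grad j H) σ| * (Real.cosh (grad j H σ))⁻¹) ^ 2 := by gcongr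
      _ = 25 / 16 * grad i (grad j H) σ ^ 2 * spinVar H j σ := by
        rw [mul_pow, mul_pow, sq_abs, spinVar, inv_pow]; ring
      _ ≤ _ := by
        have := spinVar_pos H j σ
        gcongr; norm_num
  set u := (Real.cosh (grad j H (flip i σ)))⁻¹
  have hu : u ^ 2 ≤ 2 * spinVar H j σ := by
    simpa only [u, inv_pow, spinVar] using h2
  set w := grad i (fun σ => (Real.cosh (grad j H σ))⁻¹) σ
  calc (u * grad i φ σ + φ σ * w) ^ 2 ≤ 2 * (u ^ 2 * grad i φ σ ^ 2) + 2 * (w ^ 2 * φ σ ^ 2) := by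
        nlinarith [sq_nonneg (u * grad i φ σ - φ σ * w)]
    _ ≤ 2 * (2 * spinVar H j σ * grad i φ σ ^ 2) +
        2 * (2 * grad i (grad j H) σ ^ 2 * spinVar H j σ * φ σ ^ 2) := by gcongr
    _ = _ := by ring

end

/-! ### The integrated Bochner inequality -/

/-- Cauchy–Schwarz estimates for the integrand of the off-diagonal terms. -/
theorem bochner_integrand_le {J vi vj vj' ω κ s a b γ : ℝ} (hJ : |J| ≤ 1 / 8) (hvi : 0 < vi)
    (hvj : 0 < vj) (hv' : 1 / 2 * vj ≤ vj') (hω : |ω| ≤ 3 * |J| * vj)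
    (hκ : |κ - J * vi| ≤ 8 * J ^ 2 * vi) (hs : |s| = 1) :
    1 / 4 * (vi * vj * γ ^ 2) - J * (vi * a) * (vj * b) -
        60 * (J ^ 2 * (vi * vj) * (a ^ 2 + b ^ 2)) ≤
      vi * (γ * (vj' * γ + b * ω)) - κ * vj * a * b + 2 * s * κ * vj * b * γ := by
  have hκ2 : |κ| ≤ 2 * |J| * vi := by
    have : κ = (κ - J * vi) + J * vi := by ring
    rw [this]
    refine (abs_add_le _ _).trans ?_
    rw [abs_mul, abs_of_pos hvi]
    have : J ^ 2 = |J| * |J| := by rw [← sq, sq_abs]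
    nlinarith [abs_nonneg J, mul_nonneg (abs_nonneg J) hvi.le]
  have t1 : -(vi * (3 * |J| * vj) * (|b| * |γ|)) ≤ vi * (b * ω * γ) := by
    have : |vi * (b * ω * γ)| ≤ vi * (3 * |J| * vj) * (|b| * |γ|) := by
      rw [abs_mul, abs_mul, abs_mul, abs_of_pos hvi]
      calc vi * (|b| * |ω| * |γ|) ≤ vi * (|b| * (3 * |J| * vj) * |γ|) := by gcongr
        _ = _ := by ring
    exact (abs_le.1 this).1
  have t2 : -(4 * |J| * vi * vj * (|b| * |γ|)) ≤ 2 * s * κ * vj * b * γ := by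
    have : |2 * s * κ * vj * b * γ| ≤ 4 * |J| * vi * vj * (|b| * |γ|) := by
      rw [abs_mul, abs_mul, abs_mul, abs_mul, abs_mul, abs_two, hs, abs_of_pos hvj]
      calc 2 * 1 * |κ| * vj * |b| * |γ| ≤ 2 * 1 * (2 * |J| * vi) * vj * |b| * |γ| := by gcongr
        _ = _ := by ring
    exact (abs_le.1 this).1
  have t3 : -(8 * J ^ 2 * vi * vj * (|a| * |b|)) ≤ -((κ - J * vi) * vj * a * b) := by
    have : |(κ - J * vi) * vj * a * b| ≤ 8 * J ^ 2 * vi * vj * (|a| * |b|) := by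
      rw [abs_mul, abs_mul, abs_mul, abs_of_pos hvj]
      calc |κ - J * vi| * vj * |a| * |b| ≤ (8 * J ^ 2 * vi) * vj * |a| * |b| := by gcongr
        _ = _ := by ring
    linarith [(abs_le.1 this).2]
  have t4 : vi * (1 / 2 * vj * γ ^ 2) ≤ vi * (vj' * γ ^ 2) := by gcongr
  have p := mul_pos hvi hvj
  -- The coefficient 7 = 3 + 4 collects both cross terms in b γ. They consume one half of the
  -- available γ²/2, leaving the γ²/4 of the claim.
  have u1 : 7 * (|J| * |b|) * |γ| ≤ 1 / 4 * γ ^ 2 + 49 * (J ^ 2 * b ^ 2) := by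
    rw [← sq_abs γ, ← sq_abs J, ← sq_abs b]
    nlinarith [sq_nonneg (1 / 2 * |γ| - 7 * (|J| * |b|))]
  have u2 : 8 * J ^ 2 * (|a| * |b|) ≤ 4 * J ^ 2 * (a ^ 2 + b ^ 2) := by
    rw [← sq_abs a, ← sq_abs b]
    nlinarith [mul_nonneg (sq_nonneg J) (sq_nonneg (|a| - |b|))]
  have u1' := mul_le_mul_of_nonneg_left u1 p.le
  have u2' := mul_le_mul_of_nonneg_left u2 p.le
  have u3 : 0 ≤ vi * vj * (J ^ 2 * (a ^ 2 + b ^ 2)) := by positivity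
  have u4 : 0 ≤ vi * vj * (J ^ 2 * (a ^ 2)) := by positivity
  linarith

theorem flip_mem_univ_iff (k : Fin N) (σ : Config N) :
    flip k σ ∈ (Finset.univ : Finset (Config N)) ↔ σ ∈ (Finset.univ : Finset (Config N)) := by simp

/-- Lower bound for the off-diagonal terms of the Bochner formula. -/
theorem bochner_offdiag (hij : i ≠ j) (hJ : ∀ σ, |grad i (grad j H) σ| ≤ 1 / 8)
    (f : Config N → ℝ) :
    ∑ σ, Real.exp (H σ) * (1 / 4 * (spinVar H i σ * spinVar H j σ * grad i (grad j f) σ ^ 2) -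
        grad i (grad j H) σ * (spinVar H i σ * grad i f σ) * (spinVar H j σ * grad j f σ) -
        60 * (grad i (grad j H) σ ^ 2 * (spinVar H i σ * spinVar H j σ) *
          (grad i f σ ^ 2 + grad j f σ ^ 2))) ≤
      ∑ σ, Real.exp (H σ) * (((spin σ i - mag H i σ) * grad i f σ) *
        ((spin σ j - mag H j σ) * grad j f σ)) := by
  -- Integration by parts in spin j. The Leibniz rule evaluates m_i at the flipped configuration;
  -- rewriting it at σ produces the term with 2σ_j.
  have e1 : ∑ σ, Real.exp (H σ) * (((spin σ i - mag H i σ) * grad i f σ) *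
      ((spin σ j - mag H j σ) * grad j f σ)) =
      ∑ σ, Real.exp (H σ) * (spinVar H j σ * (((spin σ i - mag H i σ) * grad i (grad j f) σ -
        grad j (mag H i) σ * grad i f σ + 2 * spin σ j * grad j (mag H i) σ *
          grad i (grad j f) σ) * grad j f σ)) := by
    have := sum_spin_sub_mag_mul (S := Finset.univ) (flip_mem_univ_iff j) H
      (fun σ => ((spin σ i - mag H i σ) * grad i f σ) * grad j f σ)
    refine Eq.trans (Finset.sum_congr rfl fun σ _ => by ring) (this.trans ?_)
    refine Finset.sum_congr rfl fun σ _ => ?_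
    rw [grad_mul_of_invariant (fun σ => grad_flip_self j f σ), grad_mul, grad_sub,
      grad_spin_ne hij, spin_flip_ne hij, apply_flip j (mag H i), grad_comm j i]
    ring
  -- The one term that still contains σ_i − m_i is integrated by parts again, now in spin i; it
  -- yields the square of the second derivative.
  have e2 : ∑ σ, Real.exp (H σ) * ((spin σ i - mag H i σ) *
        (spinVar H j σ * grad j f σ * grad i (grad j f) σ)) =
      ∑ σ, Real.exp (H σ) * (spinVar H i σ * ((spinVar H j (flip i σ) * grad i (grad j f) σ +
        grad j f σ * grad i (spinVar H j) σ) * grad i (grad j f) σ)) := by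
    rw [sum_spin_sub_mag_mul (S := Finset.univ) (flip_mem_univ_iff i) H]
    refine Finset.sum_congr rfl fun σ _ => ?_
    rw [grad_mul_of_invariant (fun σ => grad_flip_self i _ σ), grad_mul]
  have e3 : ∑ σ, Real.exp (H σ) * (((spin σ i - mag H i σ) * grad i f σ) *
      ((spin σ j - mag H j σ) * grad j f σ)) =
      ∑ σ, Real.exp (H σ) * (spinVar H i σ * (grad i (grad j f) σ *
        (spinVar H j (flip i σ) * grad i (grad j f) σ + grad j f σ * grad i (spinVar H j) σ)) -
        grad j (mag H i) σ * spinVar H j σ * grad i f σ * grad j f σ +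
        2 * spin σ j * grad j (mag H i) σ * spinVar H j σ * grad j f σ * grad i (grad j f) σ) := by
    rw [e1]
    have : ∀ σ, Real.exp (H σ) * (spinVar H j σ * (((spin σ i - mag H i σ) * grad i (grad j f) σ -
        grad j (mag H i) σ * grad i f σ + 2 * spin σ j * grad j (mag H i) σ *
          grad i (grad j f) σ) * grad j f σ)) =
        Real.exp (H σ) * ((spin σ i - mag H i σ) *
        (spinVar H j σ * grad j f σ * grad i (grad j f) σ)) + Real.exp (H σ) *
        (- (grad j (mag H i) σ * spinVar H j σ * grad i f σ * grad j f σ) +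
        2 * spin σ j * grad j (mag H i) σ * spinVar H j σ * grad j f σ * grad i (grad j f) σ) := by
      intro σ; ring
    simp only [this]
    rw [Finset.sum_add_distrib, e2, ← Finset.sum_add_distrib]
    exact Finset.sum_congr rfl fun σ _ => by ring
  rw [e3]
  refine Finset.sum_le_sum fun σ _ => mul_le_mul_of_nonneg_left ?_ (Real.exp_pos _).le
  have hJ' : |grad j (grad i H) σ| ≤ 1 / 8 := by rw [grad_comm]; exact hJ σ
  have hκ := abs_grad_mag_sub_le H hJ'
  rw [grad_comm j i H] at hκ
  exact bochner_integrand_le (hJ σ) (spinVar_pos H i σ) (spinVar_pos H j σ)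
    (spinVar_flip_ge H (hJ σ)) (abs_grad_spinVar_le H (hJ σ)) hκ (abs_spin σ j)

/-- Given the other spins, `grad i f` is constant and σ_i − m_i is centered with variance v_i. -/
theorem bochner_diag (i : Fin N) (f : Config N → ℝ) :
    ∑ σ, Real.exp (H σ) * (((spin σ i - mag H i σ) * grad i f σ) *
        ((spin σ i - mag H i σ) * grad i f σ)) =
      ∑ σ, Real.exp (H σ) * (spinVar H i σ * grad i f σ ^ 2) := by
  have := sum_spin_sub_mag_mul (S := Finset.univ) (flip_mem_univ_iff i) H
    (fun σ => (spin σ i - mag H i σ) * (grad i f σ * grad i f σ))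
  refine Eq.trans (Finset.sum_congr rfl fun σ _ => by ring) (this.trans ?_)
  refine Finset.sum_congr rfl fun σ _ => ?_
  rw [grad_mul_of_invariant (fun σ => by rw [grad_flip_self]), grad_sub, grad_spin_self,
    grad_eq_zero (mag_flip H i)]
  ring

/-- The unnormalized Dirichlet form of the spins in `A`. -/
def blockForm (H : Config N → ℝ) (A : Finset (Fin N)) (f : Config N → ℝ) : ℝ :=
  ∑ k ∈ A, ∑ σ, Real.exp (H σ) * (spinVar H k σ * grad k f σ ^ 2)

/-- The generator of the heat-bath dynamics of the spins in `A`. -/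
def generator (H : Config N → ℝ) (A : Finset (Fin N)) (f : Config N → ℝ) (σ : Config N) : ℝ :=
  ∑ k ∈ A, (spin σ k - mag H k σ) * grad k f σ

theorem blockForm_nonneg (H : Config N → ℝ) (A : Finset (Fin N)) (f : Config N → ℝ) :
    0 ≤ blockForm H A f :=
  Finset.sum_nonneg fun k _ => Finset.sum_nonneg fun σ _ =>
    mul_nonneg (Real.exp_pos _).le (mul_nonneg (spinVar_pos H k σ).le (sq_nonneg _))

theorem sum_mul_generator (H : Config N → ℝ) (A : Finset (Fin N)) (f g : Config N → ℝ) :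
    ∑ σ, Real.exp (H σ) * (f σ * generator H A g σ) =
      ∑ k ∈ A, ∑ σ, Real.exp (H σ) * (spinVar H k σ * (grad k f σ * grad k g σ)) := by
  simp only [generator, Finset.mul_sum]
  rw [Finset.sum_comm]
  refine Finset.sum_congr rfl fun k _ => ?_
  have := sum_spin_sub_mag_mul (S := Finset.univ) (flip_mem_univ_iff k) H
    (fun σ => f σ * grad k g σ)
  refine Eq.trans (Finset.sum_congr rfl fun σ _ => by ring) (this.trans ?_)
  refine Finset.sum_congr rfl fun σ _ => ?_
  rw [grad_mul_of_invariant (fun σ => grad_flip_self k g σ)]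

/-- The square of the generator is a double sum over spins: diagonal pairs give D exactly, the
others are bounded by `bochner_offdiag`. The J² errors are summed along rows of J, at cost r² each;
120 is 60 for each of the two symmetric halves. -/
theorem bochner (H : Config N → ℝ) (A : Finset (Fin N)) {r : ℝ} (hr0 : 0 ≤ r) (hr : r ≤ 1 / 8)
    (hrow : ∀ i σ, ∑ j, grad i (grad j H) σ ^ 2 ≤ r ^ 2) (f : Config N → ℝ) :
    (1 - 120 * r ^ 2) * blockForm H A f +
      1 / 4 * (∑ i ∈ A, ∑ j ∈ A, ∑ σ, Real.exp (H σ) *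
        (spinVar H i σ * spinVar H j σ * grad i (grad j f) σ ^ 2)) -
      ∑ σ, Real.exp (H σ) * (∑ i ∈ A, ∑ j ∈ A, grad i (grad j H) σ *
        (spinVar H i σ * grad i f σ) * (spinVar H j σ * grad j f σ)) ≤
      ∑ σ, Real.exp (H σ) * generator H A f σ ^ 2 := by
  have hJ : ∀ i j σ, |grad i (grad j H) σ| ≤ 1 / 8 := by
    intro i j σ
    have h1 := (Finset.single_le_sum (f := fun j => grad i (grad j H) σ ^ 2)
      (fun j _ => sq_nonneg _) (Finset.mem_univ j)).trans (hrow i σ)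
    exact (abs_le_of_sq_le_sq h1 hr0).trans hr
  set Γ : Fin N → Fin N → ℝ := fun i j => ∑ σ, Real.exp (H σ) *
        (spinVar H i σ * spinVar H j σ * grad i (grad j f) σ ^ 2) with hΓ
  set X : Fin N → Fin N → ℝ := fun i j => ∑ σ, Real.exp (H σ) * (grad i (grad j H) σ *
        (spinVar H i σ * grad i f σ) * (spinVar H j σ * grad j f σ)) with hX
  set R : Fin N → Fin N → ℝ := fun i j => ∑ σ, Real.exp (H σ) *
        (grad i (grad j H) σ ^ 2 * (spinVar H i σ * spinVar H j σ) * grad i f σ ^ 2) with hR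
  set D : Fin N → ℝ := fun i => ∑ σ, Real.exp (H σ) * (spinVar H i σ * grad i f σ ^ 2) with hD
  have hRs : ∀ i j, ∑ σ, Real.exp (H σ) * (grad i (grad j H) σ ^ 2 *
      (spinVar H i σ * spinVar H j σ) * grad j f σ ^ 2) = R j i := by
    intro i j
    refine Finset.sum_congr rfl fun σ _ => ?_
    rw [grad_comm i j H]; ring
  have hRD : ∀ i, ∑ j ∈ A, R i j ≤ r ^ 2 * D i := by
    intro i
    simp only [hR, hD]
    rw [Finset.sum_comm, Finset.mul_sum]
    refine Finset.sum_le_sum fun σ _ => ?_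
    rw [← Finset.mul_sum, mul_left_comm]
    refine mul_le_mul_of_nonneg_left ?_ (Real.exp_pos _).le
    calc _ ≤ ∑ j ∈ A, grad i (grad j H) σ ^ 2 * (spinVar H i σ * grad i f σ ^ 2) := by
          refine Finset.sum_le_sum fun j _ => ?_
          have h1 := spinVar_le_one H j σ
          have h2 := (spinVar_pos H i σ).le
          have h3 : 0 ≤ grad i (grad j H) σ ^ 2 * (spinVar H i σ * grad i f σ ^ 2) := by positivity
          nlinarith
      _ = (∑ j ∈ A, grad i (grad j H) σ ^ 2) * (spinVar H i σ * grad i f σ ^ 2) := by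
          rw [Finset.sum_mul]
      _ ≤ _ := by
          refine mul_le_mul_of_nonneg_right ?_
            (mul_nonneg (spinVar_pos H i σ).le (sq_nonneg _))
          exact (Finset.sum_le_univ_sum_of_nonneg fun j => sq_nonneg _).trans (hrow i σ)
  have hQ : ∀ i ∈ A, ∀ j ∈ A, (if i = j then D i else 0) + 1 / 4 * Γ i j - X i j -
      60 * (R i j + R j i) ≤ ∑ σ, Real.exp (H σ) * (((spin σ i - mag H i σ) * grad i f σ) *
        ((spin σ j - mag H j σ) * grad j f σ)) := by
    intro i _ j _
    by_cases hij : i = j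
    · subst hij
      rw [bochner_diag, if_pos rfl]
      -- Second derivatives in the same spin vanish, so the diagonal may be included in all double
      -- sums.
      have : Γ i i = 0 ∧ X i i = 0 ∧ R i i = 0 := by
        simp [hΓ, hX, hR, grad_grad_self]
      rw [this.1, this.2.1, this.2.2]; simp [hD]
    · rw [if_neg hij]
      refine le_trans (le_of_eq ?_) (bochner_offdiag H hij (hJ i j) f)
      rw [← hRs i j]
      simp only [hΓ, hX, hR, Finset.mul_sum]
      rw [zero_add, ← Finset.sum_add_distrib, Finset.mul_sum, ← Finset.sum_sub_distrib,
        ← Finset.sum_sub_distrib]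
      exact Finset.sum_congr rfl fun σ _ => by ring
  have hsum := Finset.sum_le_sum fun i hi => Finset.sum_le_sum (hQ i hi)
  have hL : ∑ σ, Real.exp (H σ) * generator H A f σ ^ 2 = ∑ i ∈ A, ∑ j ∈ A, ∑ σ, Real.exp (H σ) *
      (((spin σ i - mag H i σ) * grad i f σ) * ((spin σ j - mag H j σ) * grad j f σ)) := by
    have : ∀ σ, Real.exp (H σ) * generator H A f σ ^ 2 = ∑ i ∈ A, ∑ j ∈ A, Real.exp (H σ) *
      (((spin σ i - mag H i σ) * grad i f σ) * ((spin σ j - mag H j σ) * grad j f σ)) := by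
      intro σ
      rw [generator, sq, Finset.sum_mul_sum, Finset.mul_sum]
      exact Finset.sum_congr rfl fun i _ => by rw [Finset.mul_sum]
    simp only [this]
    rw [Finset.sum_comm]
    exact Finset.sum_congr rfl fun i _ => Finset.sum_comm
  have hXs : ∑ σ, Real.exp (H σ) * (∑ i ∈ A, ∑ j ∈ A, grad i (grad j H) σ *
        (spinVar H i σ * grad i f σ) * (spinVar H j σ * grad j f σ)) =
      ∑ i ∈ A, ∑ j ∈ A, X i j := by
    simp only [Finset.mul_sum, hX]
    rw [Finset.sum_comm]
    exact Finset.sum_congr rfl fun i _ => Finset.sum_comm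
  rw [hL, hXs]
  refine le_trans ?_ hsum
  have hR2 : ∑ i ∈ A, ∑ j ∈ A, R j i = ∑ i ∈ A, ∑ j ∈ A, R i j := Finset.sum_comm
  have hR3 : ∑ i ∈ A, ∑ j ∈ A, R i j ≤ r ^ 2 * ∑ i ∈ A, D i := by
    rw [Finset.mul_sum]; exact Finset.sum_le_sum fun i _ => hRD i
  have hDs : blockForm H A f = ∑ i ∈ A, D i := rfl
  have hd : ∑ i ∈ A, ∑ j ∈ A, (if i = j then D i else 0) = ∑ i ∈ A, D i :=
    Finset.sum_congr rfl fun i hi => by simp [hi]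
  simp only [Finset.sum_sub_distrib, Finset.sum_add_distrib, ← Finset.mul_sum]
  rw [hd, hR2, hDs]
  linarith

/-! ### From the Bochner inequality to a spectral gap on fibers -/

-- The range of a symmetric T is the orthogonal complement of its kernel, so x = T y. Positivity of
-- T at T y − l y, together with T² ≥ l T at y, gives T ≥ l on the range.
open scoped InnerProductSpace in
theorem sq_norm_le_of_isSymmetric {E : Type*} [NormedAddCommGroup E] [InnerProductSpace ℝ E]
    [FiniteDimensional ℝ E] {T : E →ₗ[ℝ] E} (hT : T.IsSymmetric) (hpos : ∀ x, 0 ≤ ⟪x, T x⟫_ℝ)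
    {l : ℝ} (hl : 0 ≤ l) (h : ∀ x, l * ⟪x, T x⟫_ℝ ≤ ⟪T x, T x⟫_ℝ) {x : E}
    (hx : ∀ y, T y = 0 → ⟪y, x⟫_ℝ = 0) : l * ⟪x, x⟫_ℝ ≤ ⟪x, T x⟫_ℝ := by
  have hr : x ∈ LinearMap.range T := by
    rw [← Submodule.orthogonal_orthogonal (LinearMap.range T), hT.orthogonal_range]
    exact (Submodule.mem_orthogonal _ _).2 fun y hy => hx y hy
  obtain ⟨y, rfl⟩ := hr
  have h1 := hpos (T y - l • y)
  have h2 := h y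
  rw [map_sub, map_smul] at h1
  simp only [inner_sub_left, inner_sub_right, real_inner_smul_left, real_inner_smul_right] at h1
  have h3 : ⟪y, T (T y)⟫_ℝ = ⟪T y, T y⟫_ℝ := (hT y (T y)).symm
  rw [h3] at h1
  nlinarith

/-- The expectation under the Gibbs measure conditioned on `S`. -/
def condMean (S : Finset (Config N)) (H f : Config N → ℝ) : ℝ :=
  (∑ σ ∈ S, Real.exp (H σ) * f σ) / ∑ σ ∈ S, Real.exp (H σ)

/-- The spectral gap inequality, with constant `a`, for the spins in `b` when the others are
frozen. -/
def BlockGap (b : Finset (Fin N)) (H : Config N → ℝ) (a : ℝ) : Prop :=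
  ∀ (τ : Config N) (f : Config N → ℝ),
    ∑ σ ∈ fiber b τ, Real.exp (H σ) * (f σ - condMean (fiber b τ) H f) ^ 2 ≤
      a * ∑ k ∈ b, ∑ σ ∈ fiber b τ, Real.exp (H σ) * (spinVar H k σ * grad k f σ ^ 2)

theorem eq_of_mem_fiber {b : Finset (Fin N)} {f : Config N → ℝ}
    (h : ∀ k ∈ b, ∀ σ, f (flip k σ) = f σ) {σ τ : Config N} (hσ : σ ∈ fiber b τ) : f σ = f τ := by
  induction b using Finset.induction_on generalizing σ with
  | empty =>
    congr 1; funext i; exact (mem_fiber.1 hσ) i (by simp)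
  | insert k b hk ih =>
    have ih' := @ih fun j hj => h j (Finset.mem_insert_of_mem hj)
    rw [mem_fiber] at hσ
    by_cases hs : σ k = τ k
    · refine ih' (mem_fiber.2 fun i hi => ?_)
      by_cases e : i = k
      · rw [e, hs]
      · exact hσ i (by simp [e, hi])
    · rw [← h k (Finset.mem_insert_self _ _) σ]
      refine ih' (mem_fiber.2 fun i hi => ?_)
      by_cases e : i = k
      · subst e
        simp only [flip, Function.update_self]
        rcases Int.units_eq_one_or (σ i) with h1 | h1 <;>
          rcases Int.units_eq_one_or (τ i) with h2 | h2 <;> simp_all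
      · rw [flip, Function.update_of_ne e]; exact hσ i (by simp [e, hi])

theorem grad_eq_zero_of_blockForm {H : Config N → ℝ} {A : Finset (Fin N)} {f : Config N → ℝ}
    (h : blockForm H A f = 0) : ∀ k ∈ A, ∀ σ, f (flip k σ) = f σ := by
  intro k hk σ
  have p : ∀ k σ, 0 ≤ Real.exp (H σ) * (spinVar H k σ * grad k f σ ^ 2) := fun k σ =>
    mul_nonneg (Real.exp_pos _).le (mul_nonneg (spinVar_pos H k σ).le (sq_nonneg _))
  have h1 := (Finset.sum_eq_zero_iff_of_nonneg fun k _ => Finset.sum_nonneg fun σ _ => p k σ).1 h k hk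
  have h2 := (Finset.sum_eq_zero_iff_of_nonneg fun σ _ => p k σ).1 h1 σ (Finset.mem_univ _)
  have h3 : grad k f σ = 0 := by
    have := spinVar_pos H k σ
    have e := Real.exp_pos (H σ)
    simpa [this.ne', e.ne'] using h2
  rw [apply_flip k f, h3]; ring

-- Conjugation by e^{H/2} moves the generator to Euclidean space, where it is symmetric with form
-- `blockForm`. Its kernel consists of the functions invariant under flips in A, that is, constant
-- on fibers; a function centered on one fiber and zero elsewhere is orthogonal to it.
open scoped InnerProductSpace in
theorem blockGap_of_generator {H : Config N → ℝ} {A : Finset (Fin N)} {l : ℝ} (hl : 0 < l)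
    (h : ∀ f, l * blockForm H A f ≤ ∑ σ, Real.exp (H σ) * generator H A f σ ^ 2) :
    BlockGap A H l⁻¹ := by
  intro τ f
  set S := fiber A τ with hS
  set c := condMean S H f with hc
  have hgl : ∀ f g : Config N → ℝ, ∀ σ, generator H A (f + g) σ =
      generator H A f σ + generator H A g σ := by
    intro f g σ
    simp only [generator, ← Finset.sum_add_distrib]
    refine Finset.sum_congr rfl fun k _ => ?_
    rw [show f + g = fun σ => f σ + g σ from rfl, grad_add]; ring
  have hgs : ∀ (a : ℝ) (f : Config N → ℝ), ∀ σ, generator H A (a • f) σ =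
      a * generator H A f σ := by
    intro a f σ
    simp only [generator, Finset.mul_sum]
    refine Finset.sum_congr rfl fun k _ => ?_
    rw [show a • f = fun σ => a * f σ from rfl, grad_const_mul]; ring
  let un : EuclideanSpace ℝ (Config N) → Config N → ℝ := fun x σ => Real.exp (-(H σ / 2)) * x σ
  have hun_add : ∀ x y, un (x + y) = un x + un y := by
    intro x y; funext σ; simp [un, mul_add]
  have hun_smul : ∀ (a : ℝ) x, un (a • x) = a • un x := by
    intro a x; funext σ; simp [un]; ring
  let T : EuclideanSpace ℝ (Config N) →ₗ[ℝ] EuclideanSpace ℝ (Config N) :=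
    { toFun := fun x => WithLp.toLp 2 fun σ => Real.exp (H σ / 2) * generator H A (un x) σ
      map_add' := by
        intro x y; ext σ; simp [hun_add, hgl, mul_add]
      map_smul' := by
        intro a x; ext σ; simp [hun_smul, hgs]; ring }
  have hexp : ∀ σ, Real.exp (H σ) = Real.exp (H σ / 2) * Real.exp (H σ / 2) := by
    intro σ; rw [← Real.exp_add]; ring_nf
  have hinv : ∀ σ, Real.exp (H σ / 2) * Real.exp (-(H σ / 2)) = 1 := by
    intro σ; rw [← Real.exp_add]; simp
  have hux : ∀ (x : EuclideanSpace ℝ (Config N)) σ, x σ = Real.exp (H σ / 2) * un x σ := by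
    intro x σ; simp only [un]; rw [← mul_assoc, hinv, one_mul]
  have hi : ∀ x y : EuclideanSpace ℝ (Config N), ⟪x, y⟫_ℝ = ∑ σ, Real.exp (H σ) * (un x σ * un y σ) := by
    intro x y
    rw [PiLp.inner_apply]
    refine Finset.sum_congr rfl fun σ _ => ?_
    rw [hux x σ, hux y σ, hexp]
    simp only [RCLike.inner_apply, conj_trivial]; ring
  have huT : ∀ x, un (T x) = generator H A (un x) := by
    intro x; funext σ
    simp only [un, T, LinearMap.coe_mk, AddHom.coe_mk]
    rw [← mul_assoc, mul_comm (Real.exp _), hinv, one_mul]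
  have hiT : ∀ x y : EuclideanSpace ℝ (Config N), ⟪x, T y⟫_ℝ = ∑ k ∈ A, ∑ σ, Real.exp (H σ) *
      (spinVar H k σ * (grad k (un x) σ * grad k (un y) σ)) := by
    intro x y
    rw [hi, huT, sum_mul_generator]
  have hiD : ∀ x : EuclideanSpace ℝ (Config N), ⟪x, T x⟫_ℝ = blockForm H A (un x) := by
    intro x; rw [hiT]; simp only [blockForm, sq]
  have hT : T.IsSymmetric := by
    intro x y
    rw [real_inner_comm, hiT, hiT]
    exact Finset.sum_congr rfl fun k _ => Finset.sum_congr rfl fun σ _ => by ring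
  -- Cutting off to the fiber S creates no gradient: flips in A preserve S.
  let F : Config N → ℝ := fun σ => if σ ∈ S then f σ - c else 0
  let x : EuclideanSpace ℝ (Config N) := WithLp.toLp 2 fun σ => Real.exp (H σ / 2) * F σ
  have hF : un x = F := by
    funext σ
    simp only [un, x]
    rw [← mul_assoc, mul_comm (Real.exp _), hinv, one_mul]
  have hFsum : ∑ σ ∈ S, Real.exp (H σ) * (f σ - c) = 0 := by
    have hZ : 0 < ∑ σ ∈ S, Real.exp (H σ) :=
      Finset.sum_pos (fun σ _ => Real.exp_pos _) (fiber_nonempty A τ)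
    simp only [mul_sub, Finset.sum_sub_distrib, ← Finset.sum_mul]
    rw [hc, condMean, mul_div_cancel₀ _ hZ.ne', sub_self]
  have hgradF : ∀ k ∈ A, ∀ σ, grad k F σ = if σ ∈ S then grad k f σ else 0 := by
    intro k hk σ
    have : flip k σ ∈ S ↔ σ ∈ S := flip_mem_fiber hk
    by_cases hσ : σ ∈ S
    · simp only [grad, F, if_pos hσ, if_pos (this.2 hσ)]; ring
    · have h2 : flip k σ ∉ S := fun h => hσ (this.1 h)
      simp only [grad, F, if_neg hσ, if_neg h2]; ring
  have key := sq_norm_le_of_isSymmetric (T := T) hT (fun x => by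
      rw [hiD]; exact blockForm_nonneg H A _) hl.le (fun x => by
      rw [hiD, hi, huT]; simpa only [sq] using h (un x)) (x := x) (by
      intro y hy
      have h0 : blockForm H A (un y) = 0 := by rw [← hiD, hy, inner_zero_right]
      rw [hi, hF]
      have hcst := grad_eq_zero_of_blockForm h0
      have : ∀ σ, Real.exp (H σ) * (un y σ * F σ) =
          if σ ∈ S then un y τ * (Real.exp (H σ) * (f σ - c)) else 0 := by
        intro σ
        by_cases hσ : σ ∈ S
        · simp only [F, if_pos hσ]; rw [eq_of_mem_fiber hcst hσ]; ring
        · simp only [F, if_neg hσ, mul_zero]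
      simp only [this, Finset.sum_ite_mem, Finset.univ_inter, ← Finset.mul_sum, hFsum, mul_zero])
  rw [hiD, hi, hF] at key
  have k1 : ∑ σ, Real.exp (H σ) * (F σ * F σ) = ∑ σ ∈ S, Real.exp (H σ) * (f σ - c) ^ 2 := by
    have : ∀ σ, Real.exp (H σ) * (F σ * F σ) =
        if σ ∈ S then Real.exp (H σ) * (f σ - c) ^ 2 else 0 := by
      intro σ; simp only [F]; split_ifs <;> ring
    simp only [this, Finset.sum_ite_mem, Finset.univ_inter]
  have k2 : blockForm H A F = ∑ k ∈ A, ∑ σ ∈ S, Real.exp (H σ) * (spinVar H k σ * grad k f σ ^ 2) := by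
    refine Finset.sum_congr rfl fun k hk => ?_
    have : ∀ σ, Real.exp (H σ) * (spinVar H k σ * grad k F σ ^ 2) =
        if σ ∈ S then Real.exp (H σ) * (spinVar H k σ * grad k f σ ^ 2) else 0 := by
      intro σ; rw [hgradF k hk]; split_ifs <;> ring
    simp only [this, Finset.sum_ite_mem, Finset.univ_inter]
  rw [k1, k2] at key
  rw [inv_mul_eq_div, le_div_iff₀ hl, mul_comm]
  exact key

/-- The weight of a pair of configurations times v_k is 4 / (e^{-H(σ)} + e^{-H(flip)}), a harmonic
mean. In this form the Dirichlet weight is monotone in H, so a perturbation of H bounded by δ costs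
only a factor e^δ, although v_k depends on H as well. -/
theorem exp_add_exp_flip_mul (H : Config N → ℝ) (k : Fin N) (σ : Config N) :
    (Real.exp (H σ) + Real.exp (H (flip k σ))) * spinVar H k σ *
      (Real.exp (-H σ) + Real.exp (-H (flip k σ))) = 4 := by
  set m := H σ - spin σ k * grad k H σ with hm'
  have hb : H (flip k σ) = m + -(spin σ k * grad k H σ) := by
    rw [apply_flip k H σ]; ring
  have ha : H σ = m + spin σ k * grad k H σ := by rw [hm']; ring
  have ha1 : Real.exp (H σ) = Real.exp m * Real.exp (spin σ k * grad k H σ) := by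
    rw [← Real.exp_add, ← ha]
  have ha2 : Real.exp (-H σ) = Real.exp (-m) * Real.exp (-(spin σ k * grad k H σ)) := by
    rw [← Real.exp_add, ← neg_add, ← ha]
  have hb1 : Real.exp (H (flip k σ)) = Real.exp m * Real.exp (-(spin σ k * grad k H σ)) := by
    rw [← Real.exp_add, ← hb]
  have hb2 : Real.exp (-H (flip k σ)) = Real.exp (-m) * Real.exp (spin σ k * grad k H σ) := by
    rw [← Real.exp_add, hb]; ring_nf
  rw [ha1, ha2, hb1, hb2, spinVar]
  set B := grad k H σ
  have hc := Real.cosh_pos B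
  have hs : Real.exp (spin σ k * B) + Real.exp (-(spin σ k * B)) = 2 * Real.cosh B := by
    rw [Real.cosh_eq]
    rcases spin_eq_or σ k with h | h <;> rw [h] <;> simp <;> ring
  have hm : Real.exp m * Real.exp (-m) = 1 := by rw [← Real.exp_add]; simp
  rw [← mul_add, ← mul_add, add_comm (Real.exp (-(spin σ k * B))), hs]
  field_simp
  linear_combination 4 * hm

/-! ### Conditional means, variances and covariances -/

section condMean

variable {S : Finset (Config N)} (hS : S.Nonempty) (H : Config N → ℝ)

theorem weight_pos (hS : S.Nonempty) : 0 < ∑ σ ∈ S, Real.exp (H σ) :=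
  Finset.sum_pos (fun _ _ => Real.exp_pos _) hS

theorem condMean_mul_weight (hS : S.Nonempty) (f : Config N → ℝ) :
    condMean S H f * ∑ σ ∈ S, Real.exp (H σ) = ∑ σ ∈ S, Real.exp (H σ) * f σ :=
  div_mul_cancel₀ _ (weight_pos H hS).ne'

theorem condMean_add (f g : Config N → ℝ) :
    condMean S H (fun σ => f σ + g σ) = condMean S H f + condMean S H g := by
  simp only [condMean, mul_add, Finset.sum_add_distrib, add_div]

theorem condMean_sub (f g : Config N → ℝ) :
    condMean S H (fun σ => f σ - g σ) = condMean S H f - condMean S H g := by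
  simp only [condMean, mul_sub, Finset.sum_sub_distrib, sub_div]

theorem condMean_const_mul (c : ℝ) (f : Config N → ℝ) :
    condMean S H (fun σ => c * f σ) = c * condMean S H f := by
  simp only [condMean, mul_left_comm _ c, ← Finset.mul_sum, mul_div_assoc]

theorem condMean_const (hS : S.Nonempty) (c : ℝ) : condMean S H (fun _ => c) = c := by
  rw [condMean, ← Finset.sum_mul, mul_div_assoc, mul_div_left_comm,
    div_self (weight_pos H hS).ne', mul_one]

theorem condMean_sum {ι : Type*} (s : Finset ι) (f : ι → Config N → ℝ) :
    condMean S H (fun σ => ∑ a ∈ s, f a σ) = ∑ a ∈ s, condMean S H (f a) := by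
  simp only [condMean, Finset.mul_sum]
  rw [Finset.sum_comm, Finset.sum_div]

theorem condMean_mono {f g : Config N → ℝ} (h : ∀ σ ∈ S, f σ ≤ g σ) :
    condMean S H f ≤ condMean S H g := by
  refine div_le_div_of_nonneg_right ?_ (Finset.sum_nonneg fun _ _ => (Real.exp_pos _).le)
  exact Finset.sum_le_sum fun σ hσ => mul_le_mul_of_nonneg_left (h σ hσ) (Real.exp_pos _).le

theorem condMean_nonneg {f : Config N → ℝ} (h : ∀ σ ∈ S, 0 ≤ f σ) : 0 ≤ condMean S H f :=
  div_nonneg (Finset.sum_nonneg fun σ hσ => mul_nonneg (Real.exp_pos _).le (h σ hσ))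
    (Finset.sum_nonneg fun _ _ => (Real.exp_pos _).le)

/-- The variance under the conditional Gibbs measure. -/
def condVar (S : Finset (Config N)) (H f : Config N → ℝ) : ℝ :=
  condMean S H fun σ => (f σ - condMean S H f) ^ 2

/-- The covariance under the conditional Gibbs measure. -/
def condCov (S : Finset (Config N)) (H f g : Config N → ℝ) : ℝ :=
  condMean S H (fun σ => f σ * g σ) - condMean S H f * condMean S H g

theorem condVar_nonneg (f : Config N → ℝ) : 0 ≤ condVar S H f :=
  condMean_nonneg H fun _ _ => sq_nonneg _

theorem condMean_sub_sq (hS : S.Nonempty) (f : Config N → ℝ) (c : ℝ) :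
    condMean S H (fun σ => (f σ - c) ^ 2) = condVar S H f + (condMean S H f - c) ^ 2 := by
  set m := condMean S H f with hm
  have : ∀ σ, (f σ - c) ^ 2 = (f σ - m) ^ 2 + (2 * (m - c) * f σ + (c ^ 2 - m ^ 2)) := by
    intro σ; ring
  simp only [this]
  rw [condMean_add, condMean_add, condMean_const_mul, condMean_const H hS, condVar, ← hm]
  ring

theorem condVar_eq (hS : S.Nonempty) (f : Config N → ℝ) :
    condVar S H f = condMean S H (fun σ => f σ ^ 2) - condMean S H f ^ 2 := by
  have := condMean_sub_sq H hS f 0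
  simp only [sub_zero] at this
  linarith

theorem condVar_const_mul (c : ℝ) (f : Config N → ℝ) :
    condVar S H (fun σ => c * f σ) = c ^ 2 * condVar S H f := by
  have : ∀ σ, (c * f σ - condMean S H fun σ => c * f σ) ^ 2 =
      c ^ 2 * (f σ - condMean S H f) ^ 2 := by
    intro σ; rw [condMean_const_mul]; ring
  simp only [condVar, this]
  rw [condMean_const_mul]

theorem condCov_eq (hS : S.Nonempty) (f g : Config N → ℝ) : condCov S H f g =
    condMean S H (fun σ => (f σ - condMean S H f) * (g σ - condMean S H g)) := by
  set m := condMean S H f with hm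
  set m' := condMean S H g with hm'
  have : ∀ σ, (f σ - m) * (g σ - m') = f σ * g σ - (m' * f σ + (m * g σ - m * m')) := by
    intro σ; ring
  simp only [this]
  rw [condMean_sub, condMean_add, condMean_const_mul, condMean_sub, condMean_const_mul,
    condMean_const H hS, condCov, ← hm, ← hm']
  ring

theorem condMean_mul_sq_le (f g : Config N → ℝ) :
    condMean S H (fun σ => f σ * g σ) ^ 2 ≤
      condMean S H (fun σ => f σ ^ 2) * condMean S H (fun σ => g σ ^ 2) := by
  simp only [condMean, div_pow, div_mul_div_comm, ← sq]
  refine div_le_div_of_nonneg_right ?_ (sq_nonneg _)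
  have := Finset.sum_mul_sq_le_sq_mul_sq S (fun σ => Real.exp (H σ / 2) * f σ)
    (fun σ => Real.exp (H σ / 2) * g σ)
  have e : ∀ σ, Real.exp (H σ) = Real.exp (H σ / 2) * Real.exp (H σ / 2) := by
    intro σ; rw [← Real.exp_add]; ring_nf
  refine le_of_eq_of_le ?_ (this.trans (le_of_eq ?_))
  · congr 1; refine Finset.sum_congr rfl fun σ _ => ?_; rw [e]; ring
  · congr 1 <;> refine Finset.sum_congr rfl fun σ _ => ?_ <;> rw [e] <;> ring

theorem condCov_sq_le (hS : S.Nonempty) (f g : Config N → ℝ) :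
    condCov S H f g ^ 2 ≤ condVar S H f * condVar S H g := by
  rw [condCov_eq H hS]; exact condMean_mul_sq_le H _ _

theorem condMean_sq_le (hS : S.Nonempty) (f : Config N → ℝ) :
    condMean S H f ^ 2 ≤ condMean S H (fun σ => f σ ^ 2) := by
  have := condVar_nonneg (S := S) H f
  rw [condVar_eq H hS] at this; linarith

/-- The mean minimizes the quadratic deviation, and the absolute value is 1-Lipschitz. -/
theorem condVar_abs_le (hS : S.Nonempty) (f : Config N → ℝ) :
    condVar S H (fun σ => |f σ|) ≤ condVar S H f := by
  have h1 := condMean_sub_sq H hS (fun σ => |f σ|) |condMean S H f|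
  have h2 : condMean S H (fun σ => (|f σ| - |condMean S H f|) ^ 2) ≤ condVar S H f :=
    condMean_mono H fun σ _ => by
      rw [← sq_abs (|f σ| - _), ← sq_abs (f σ - _)]
      exact pow_le_pow_left₀ (abs_nonneg _) (abs_abs_sub_abs_le _ _) 2
  nlinarith [sq_nonneg (condMean S H (fun σ => |f σ|) - |condMean S H f|)]

theorem hasDerivAt_condMean (hS : S.Nonempty) (P f : Config N → ℝ) (s : ℝ) :
    HasDerivAt (fun s => condMean S (fun σ => H σ + s * P σ) f)
      (condCov S (fun σ => H σ + s * P σ) f P) s := by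
  have h : ∀ σ, HasDerivAt (fun s => Real.exp (H σ + s * P σ))
      (Real.exp (H σ + s * P σ) * P σ) s := by
    intro σ
    have : HasDerivAt (fun s => H σ + s * P σ) (P σ) s := by
      simpa using ((hasDerivAt_id s).mul_const (P σ)).const_add (H σ)
    exact this.exp
  have h1 : HasDerivAt (fun s => ∑ σ ∈ S, Real.exp (H σ + s * P σ) * f σ)
      (∑ σ ∈ S, Real.exp (H σ + s * P σ) * P σ * f σ) s :=
    HasDerivAt.fun_sum fun σ _ => (h σ).mul_const (f σ)
  have h2 : HasDerivAt (fun s => ∑ σ ∈ S, Real.exp (H σ + s * P σ))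
      (∑ σ ∈ S, Real.exp (H σ + s * P σ) * P σ) s :=
    HasDerivAt.fun_sum fun σ _ => h σ
  have hZ := weight_pos (fun σ => H σ + s * P σ) hS
  have := h1.div h2 hZ.ne'
  refine this.congr_deriv ?_
  simp only [condCov, condMean]
  have e : ∑ σ ∈ S, Real.exp (H σ + s * P σ) * (f σ * P σ) =
      ∑ σ ∈ S, Real.exp (H σ + s * P σ) * P σ * f σ :=
    Finset.sum_congr rfl fun σ _ => by ring
  rw [e]
  field_simp

end condMean

/-! ### Perturbation of block gaps -/

theorem BlockGap.condVar_le {b : Finset (Fin N)} {H : Config N → ℝ} {a : ℝ} (h : BlockGap b H a)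
    (τ : Config N) (f : Config N → ℝ) : condVar (fiber b τ) H f ≤
      a * condMean (fiber b τ) H (fun σ => ∑ k ∈ b, spinVar H k σ * grad k f σ ^ 2) := by
  rw [condMean_sum, condVar, condMean, div_le_iff₀ (weight_pos H (fiber_nonempty b τ)), mul_assoc,
    Finset.sum_mul]
  simp only [condMean_mul_weight H (fiber_nonempty b τ)]
  exact h τ f

/-- Holley–Stroock perturbation. -/
theorem BlockGap.perturb {b : Finset (Fin N)} {H H' : Config N → ℝ} {a δ : ℝ} (h : BlockGap b H a)
    (ha : 0 ≤ a) (hH : ∀ σ, |H' σ - H σ| ≤ δ) : BlockGap b H' (a * Real.exp (2 * δ)) := by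
  intro τ f
  have hS := fiber_nonempty b τ
  have e1 : ∀ σ, Real.exp (H' σ) ≤ Real.exp δ * Real.exp (H σ) := by
    intro σ; rw [← Real.exp_add, Real.exp_le_exp]; linarith [(abs_le.1 (hH σ)).2]
  have e2 : ∀ σ, Real.exp (-H' σ) ≤ Real.exp δ * Real.exp (-H σ) := by
    intro σ; rw [← Real.exp_add, Real.exp_le_exp]; linarith [(abs_le.1 (hH σ)).1]
  -- The mean under `H'` minimizes the quadratic deviation, so the mean under `H` may replace it.
  have h1 : ∑ σ ∈ fiber b τ, Real.exp (H' σ) * (f σ - condMean (fiber b τ) H' f) ^ 2 ≤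
      ∑ σ ∈ fiber b τ, Real.exp (H' σ) * (f σ - condMean (fiber b τ) H f) ^ 2 := by
    have := condMean_sub_sq H' hS f (condMean (fiber b τ) H f)
    have h2 : condVar (fiber b τ) H' f ≤
        condMean (fiber b τ) H' (fun σ => (f σ - condMean (fiber b τ) H f) ^ 2) := by
      rw [this]; nlinarith [sq_nonneg (condMean (fiber b τ) H' f - condMean (fiber b τ) H f)]
    have h3 := mul_le_mul_of_nonneg_right h2 (weight_pos H' hS).le
    rwa [condVar, condMean_mul_weight H' hS, condMean_mul_weight H' hS] at h3
  have h2 : ∑ σ ∈ fiber b τ, Real.exp (H' σ) * (f σ - condMean (fiber b τ) H f) ^ 2 ≤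
      Real.exp δ * ∑ σ ∈ fiber b τ, Real.exp (H σ) * (f σ - condMean (fiber b τ) H f) ^ 2 := by
    rw [Finset.mul_sum]
    refine Finset.sum_le_sum fun σ _ => ?_
    rw [← mul_assoc]
    exact mul_le_mul_of_nonneg_right (e1 σ) (sq_nonneg _)
  have h3 : ∑ k ∈ b, ∑ σ ∈ fiber b τ, Real.exp (H σ) * (spinVar H k σ * grad k f σ ^ 2) ≤
      Real.exp δ * ∑ k ∈ b, ∑ σ ∈ fiber b τ, Real.exp (H' σ) *
        (spinVar H' k σ * grad k f σ ^ 2) := by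
    rw [Finset.mul_sum]
    refine Finset.sum_le_sum fun k hk => ?_
    rw [Finset.mul_sum]
    -- Weights are compared on pairs {σ, flip k σ}, where `grad k f` and v_k are constant.
    refine sum_le_flip (fun σ => flip_mem_fiber hk) fun σ => ?_
    rw [spinVar_flip, spinVar_flip, grad_flip_self]
    have x1 := exp_add_exp_flip_mul H k σ
    have x2 := exp_add_exp_flip_mul H' k σ
    set X := Real.exp (-H σ) + Real.exp (-H (flip k σ))
    set X' := Real.exp (-H' σ) + Real.exp (-H' (flip k σ))
    have p : 0 < X := by positivity
    have p' : 0 < X' := by positivity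
    have hX : X' ≤ Real.exp δ * X := by
      have := e2 σ
      have := e2 (flip k σ)
      simp only [X, X']; linarith
    have y1 : (Real.exp (H σ) + Real.exp (H (flip k σ))) * spinVar H k σ = 4 / X := by
      rw [eq_div_iff p.ne', x1]
    have y2 : (Real.exp (H' σ) + Real.exp (H' (flip k σ))) * spinVar H' k σ = 4 / X' := by
      rw [eq_div_iff p'.ne', x2]
    have y3 : 4 / X ≤ Real.exp δ * (4 / X') := by
      rw [← mul_div_assoc, div_le_div_iff₀ p p']
      nlinarith
    have y4 := mul_le_mul_of_nonneg_right y3 (sq_nonneg (grad k f σ))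
    rw [← y1, ← y2] at y4
    linarith
  have h4 := h τ f
  calc _ ≤ _ := h1
    _ ≤ _ := h2
    _ ≤ Real.exp δ * (a * (Real.exp δ * ∑ k ∈ b, ∑ σ ∈ fiber b τ, Real.exp (H' σ) *
        (spinVar H' k σ * grad k f σ ^ 2))) := by
      refine mul_le_mul_of_nonneg_left (h4.trans ?_) (Real.exp_pos _).le
      exact mul_le_mul_of_nonneg_left h3 ha
    _ = _ := by
      rw [show 2 * δ = δ + δ by ring, Real.exp_add]; ring

theorem BlockGap.mono {b : Finset (Fin N)} {H : Config N → ℝ} {a a' : ℝ} (h : BlockGap b H a)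
    (haa : a ≤ a') : BlockGap b H a' := fun τ f =>
  (h τ f).trans (mul_le_mul_of_nonneg_right haa (Finset.sum_nonneg fun k _ =>
    Finset.sum_nonneg fun σ _ => mul_nonneg (Real.exp_pos _).le
      (mul_nonneg (spinVar_pos H k σ).le (sq_nonneg _))))

/-! ### Energy and disorder on a small block -/

/-- The overlap of two configurations. -/
def overlap (σ σ' : Config N) : ℝ := (∑ i, spin σ i * spin σ' i) / N

/-- Regularity of an energy density `E` on a small block `b`, at degree `d ^ 2`. -/
structure RegularOn (b : Finset (Fin N)) (d K : ℝ) (E : Config N → ℝ) : Prop where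
  one_le_d : 1 ≤ d
  one_le_K : 1 ≤ K
  card_le : 2 * d * b.card ≤ N
  cube_le : d ^ 3 ≤ N
  abs_le : ∀ σ, |E σ| ≤ K
  -- The first term is the tangential part of the gradient. The second is the radial part, of size
  -- q|E| by Euler's identity, and it is felt only in proportion to the total weight of the block.
  sum_grad_le : ∀ σ (w : Fin N → ℝ), (∀ k, 0 ≤ w k ∧ w k ≤ 1) →
    ∑ k ∈ b, w k * grad k E σ ^ 2 ≤
      (2 * K ^ 2 * d ^ 2 + 2 * d ^ 4 * E σ ^ 2 * (∑ k ∈ b, w k) / N) / N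

theorem abs_sub_le_of_hasDerivAt {f f' : ℝ → ℝ} {T C : ℝ} (hT : 0 ≤ T)
    (hf : ∀ s, HasDerivAt f (f' s) s) (hC : ∀ s, 0 ≤ s → s ≤ T → |f' s| ≤ C) :
    |f T - f 0| ≤ C * T := by
  have := (convex_Icc 0 T).norm_image_sub_le_of_norm_hasDerivWithin_le
    (f := f) (f' := f') (C := C) (fun s _ => (hf s).hasDerivWithinAt)
    (fun s hs => by rw [Real.norm_eq_abs]; exact hC s hs.1 hs.2)
    (Set.left_mem_Icc.2 hT) (Set.right_mem_Icc.2 hT)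
  simpa [abs_of_nonneg hT] using this

theorem grad_linear {b : Finset (Fin N)} {k : Fin N} (hk : k ∈ b) (c : Fin N → ℝ) (σ : Config N) :
    grad k (fun σ => ∑ i ∈ b, c i * spin σ i) σ = c k := by
  rw [grad_sum, Finset.sum_eq_single k]
  · rw [grad_const_mul, grad_spin_self, mul_one]
  · intro i _ hi
    rw [grad_const_mul, grad_spin_ne hi, mul_zero]
  · exact fun h => absurd hk h

theorem BlockGap.condVar_linear_le {b : Finset (Fin N)} {H : Config N → ℝ} (h : BlockGap b H 2)
    (τ : Config N) {c : Fin N → ℝ} (hc : ∀ i, c i ^ 2 ≤ 1) :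
    condVar (fiber b τ) H (fun σ => ∑ i ∈ b, c i * spin σ i) ≤ 2 * b.card := by
  refine (h.condVar_le τ _).trans (mul_le_mul_of_nonneg_left ?_ zero_le_two)
  rw [← condMean_const H (fiber_nonempty b τ) (b.card : ℝ)]
  refine condMean_mono H fun σ _ => ?_
  rw [← nsmul_one, ← Finset.sum_const]
  refine Finset.sum_le_sum fun k hk => ?_
  rw [grad_linear hk]
  exact mul_le_one₀ (spinVar_le_one H k σ) (sq_nonneg _) (hc k)

theorem condMean_spin_sq_le (S : Finset (Config N)) (hS : S.Nonempty) (H : Config N → ℝ)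
    (k : Fin N) : condMean S H (fun σ => spin σ k) ^ 2 ≤ 1 := by
  refine (condMean_sq_le H hS _).trans (le_of_eq ?_)
  simp only [spin_sq]
  exact condMean_const H hS 1

/-- The non-magnetized part of the block. -/
def disorder (b : Finset (Fin N)) (τ : Config N) (H : Config N → ℝ) : ℝ :=
  (∑ k ∈ b, (1 - condMean (fiber b τ) H (fun σ => spin σ k) ^ 2)) / N

theorem disorder_nonneg (b : Finset (Fin N)) (τ : Config N) (H : Config N → ℝ) :
    0 ≤ disorder b τ H :=
  div_nonneg (Finset.sum_nonneg fun k _ =>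
    sub_nonneg.2 (condMean_spin_sq_le _ (fiber_nonempty b τ) H k)) N.cast_nonneg

theorem disorder_le (b : Finset (Fin N)) (τ : Config N) (H : Config N → ℝ) :
    disorder b τ H ≤ b.card / N := by
  refine div_le_div_of_nonneg_right ?_ N.cast_nonneg
  rw [← nsmul_one, ← Finset.sum_const]
  exact Finset.sum_le_sum fun k _ => sub_le_self _ (sq_nonneg _)

namespace RegularOn

variable {b : Finset (Fin N)} {d K : ℝ} {E : Config N → ℝ} (R : RegularOn b d K E)
include R

theorem N_pos : 0 < (N : ℝ) :=
  lt_of_lt_of_le (pow_pos (zero_lt_one.trans_le R.one_le_d) 3) R.cube_le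

/-- The block has at most N/(2d) spins, which trades one power of d in the radial term. -/
theorem sum_grad_le' (H : Config N → ℝ) (σ : Config N) :
    ∑ k ∈ b, spinVar H k σ * grad k E σ ^ 2 ≤ (2 * K ^ 2 * d ^ 2 + d ^ 3 * E σ ^ 2) / N := by
  have hN := R.N_pos
  have hd := R.one_le_d
  refine (R.sum_grad_le σ (fun k => spinVar H k σ)
    fun k => ⟨(spinVar_pos H k σ).le, spinVar_le_one H k σ⟩).trans ?_
  refine div_le_div_of_nonneg_right ?_ hN.le
  have h1 : ∑ k ∈ b, spinVar H k σ ≤ b.card := by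
    rw [← nsmul_one, ← Finset.sum_const]
    exact Finset.sum_le_sum fun k _ => spinVar_le_one H k σ
  have h2 : 2 * d * (∑ k ∈ b, spinVar H k σ) ≤ N :=
    le_trans (mul_le_mul_of_nonneg_left h1 (by linarith)) R.card_le
  have h3 : 2 * d ^ 4 * E σ ^ 2 * (∑ k ∈ b, spinVar H k σ) / N ≤ d ^ 3 * E σ ^ 2 := by
    rw [div_le_iff₀ hN]
    calc _ = d ^ 3 * E σ ^ 2 * (2 * d * (∑ k ∈ b, spinVar H k σ)) := by ring
      _ ≤ _ := by gcongr
  linarith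

theorem sq_le (σ : Config N) : E σ ^ 2 ≤ K ^ 2 := by
  rw [← sq_abs]; exact pow_le_pow_left₀ (abs_nonneg _) (R.abs_le σ) 2

theorem sum_grad_le_const (H : Config N → ℝ) (σ : Config N) :
    ∑ k ∈ b, spinVar H k σ * grad k E σ ^ 2 ≤ 3 * K ^ 2 * d ^ 3 / N := by
  refine (R.sum_grad_le' H σ).trans (div_le_div_of_nonneg_right ?_ R.N_pos.le)
  have hd := R.one_le_d
  have h1 := R.sq_le σ
  have h2 : d ^ 2 ≤ d ^ 3 := pow_le_pow_right₀ hd (by norm_num)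
  have h3 : 0 ≤ d ^ 3 := by positivity
  nlinarith [sq_nonneg K]

theorem condVar_le {H : Config N → ℝ} (h : BlockGap b H 2) (τ : Config N) :
    condVar (fiber b τ) H E ≤
      4 / N * (K ^ 2 * d ^ 2 + d ^ 3 / 2 * condMean (fiber b τ) H (fun σ => E σ ^ 2)) := by
  refine (h.condVar_le τ E).trans ?_
  have h1 := condMean_mono (S := fiber b τ) H fun σ _ => R.sum_grad_le' H σ
  have h2 : condMean (fiber b τ) H (fun σ => (2 * K ^ 2 * d ^ 2 + d ^ 3 * E σ ^ 2) / N) =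
      (2 * K ^ 2 * d ^ 2 + d ^ 3 * condMean (fiber b τ) H (fun σ => E σ ^ 2)) / N := by
    rw [← condMean_const_mul, ← condMean_const H (fiber_nonempty b τ) (2 * K ^ 2 * d ^ 2),
      ← condMean_add, div_eq_inv_mul, ← condMean_const_mul]
    simp only [div_eq_inv_mul, condMean_const H (fiber_nonempty b τ)]
  rw [h2] at h1
  have := R.N_pos
  calc _ ≤ 2 * ((2 * K ^ 2 * d ^ 2 + d ^ 3 * condMean (fiber b τ) H (fun σ => E σ ^ 2)) / N) := by
        gcongr
    _ = _ := by field_simp; ring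

theorem condVar_le_const {H : Config N → ℝ} (h : BlockGap b H 2) (τ : Config N) :
    condVar (fiber b τ) H E ≤ 6 * K ^ 2 * d ^ 3 / N := by
  refine (h.condVar_le τ E).trans ?_
  have h1 := condMean_mono (S := fiber b τ) H fun σ _ => R.sum_grad_le_const H σ
  rw [condMean_const H (fiber_nonempty b τ)] at h1
  calc _ ≤ 2 * (3 * K ^ 2 * d ^ 3 / N) := by gcongr
    _ = _ := by ring

/-- Let y(s) = ⟨|E|⟩ at coupling s. Then y' = βN Cov(|E|, E), which is at most βN Var(E) in modulus.
The block gap bounds Var(E) by the gradient of E, hence by 4/N times K²d² + d³⟨E²⟩/2, and ⟨E²⟩ ≤ K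
y. The smallness of β d³ K closes the estimate. -/
theorem condMean_abs_le {H : Config N → ℝ} {β T : ℝ} (hT : 0 ≤ T) (hT1 : T ≤ 1) (hβ : 0 ≤ β)
    (hβK : 4 * β * d ^ 3 * K ≤ 1)
    (h : ∀ s, 0 ≤ s → s ≤ T → BlockGap b (fun σ => H σ + s * (β * N * E σ)) 2) (τ : Config N) :
    condMean (fiber b τ) (fun σ => H σ + T * (β * N * E σ)) (fun σ => |E σ|) ≤
      2 * condMean (fiber b τ) H (fun σ => |E σ|) + 8 * K ^ 2 * β * d ^ 2 := by
  have hS := fiber_nonempty b τ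
  have hN := R.N_pos
  have hd := R.one_le_d
  have hK := R.one_le_K
  set y : ℝ → ℝ := fun s => condMean (fiber b τ) (fun σ => H σ + s * (β * N * E σ)) (fun σ => |E σ|)
  have hy : ∀ s, HasDerivAt y (condCov (fiber b τ) (fun σ => H σ + s * (β * N * E σ))
      (fun σ => |E σ|) (fun σ => β * N * E σ)) s := fun s =>
    hasDerivAt_condMean H hS (fun σ => β * N * E σ) (fun σ => |E σ|) s
  have hy0 : ∀ s, 0 ≤ y s := fun s => condMean_nonneg _ fun _ _ => abs_nonneg _
  -- At a maximizer of y the term 2βd³K y(s₁) ≤ y(s₁)/2 is absorbed on the left; this replaces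
  -- Gronwall's inequality.
  obtain ⟨s₁, hs₁, hmax⟩ := isCompact_Icc.exists_isMaxOn (Set.nonempty_Icc.2 hT)
    (fun s _ => (hy s).continuousAt.continuousWithinAt)
  have hder : ∀ s, 0 ≤ s → s ≤ s₁ → |condCov (fiber b τ) (fun σ => H σ + s * (β * N * E σ))
      (fun σ => |E σ|) (fun σ => β * N * E σ)| ≤ 4 * β * K ^ 2 * d ^ 2 + 2 * β * d ^ 3 * K * y s₁ := by
    intro s h0 h1
    set Hs : Config N → ℝ := fun σ => H σ + s * (β * N * E σ) with hHs
    have hg := h s h0 (h1.trans hs₁.2)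
    have hv := R.condVar_le hg τ
    have hv0 := condVar_nonneg (S := fiber b τ) Hs E
    have hm : condMean (fiber b τ) Hs (fun σ => E σ ^ 2) ≤ K * y s₁ := by
      have : condMean (fiber b τ) Hs (fun σ => E σ ^ 2) ≤ K * y s := by
        simp only [y]
        rw [← condMean_const_mul]
        refine condMean_mono _ fun σ _ => ?_
        rw [← sq_abs, sq]
        exact mul_le_mul_of_nonneg_right (R.abs_le σ) (abs_nonneg _)
      exact this.trans (mul_le_mul_of_nonneg_left (hmax ⟨h0, h1.trans hs₁.2⟩) (by linarith))
    have hc : condCov (fiber b τ) Hs (fun σ => |E σ|) E ^ 2 ≤ condVar (fiber b τ) Hs E ^ 2 := by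
      refine (condCov_sq_le Hs hS _ _).trans ?_
      rw [sq]
      exact mul_le_mul_of_nonneg_right (condVar_abs_le Hs hS E) hv0
    have hc' := abs_le_of_sq_le_sq hc hv0
    have he : condCov (fiber b τ) Hs (fun σ => |E σ|) (fun σ => β * N * E σ) =
        β * N * condCov (fiber b τ) Hs (fun σ => |E σ|) E := by
      simp only [condCov, mul_left_comm _ (β * N), condMean_const_mul]; ring
    rw [he, abs_mul, abs_of_nonneg (by positivity)]
    calc β * N * |condCov (fiber b τ) Hs (fun σ => |E σ|) E|
        ≤ β * N * (4 / N * (K ^ 2 * d ^ 2 + d ^ 3 / 2 * (K * y s₁))) := by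
          refine mul_le_mul_of_nonneg_left (hc'.trans (hv.trans ?_)) (by positivity)
          gcongr
      _ = _ := by field_simp; ring
  have hmain := abs_sub_le_of_hasDerivAt hs₁.1 hy hder
  have h1 : y s₁ - y 0 ≤ 4 * β * K ^ 2 * d ^ 2 + 2 * β * d ^ 3 * K * y s₁ := by
    refine (le_abs_self _).trans (hmain.trans ?_)
    have := hy0 s₁
    exact mul_le_of_le_one_right (by positivity) (hs₁.2.trans hT1)
  have h2 : 2 * β * d ^ 3 * K * y s₁ ≤ 1 / 2 * y s₁ := by
    refine mul_le_mul_of_nonneg_right (by linarith) (hy0 s₁)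
  have h3 : y T ≤ y s₁ := hmax ⟨hT, le_rfl⟩
  have h4 : y 0 = condMean (fiber b τ) H (fun σ => |E σ|) := by simp [y]
  rw [← h4]
  change y T ≤ _
  linarith

theorem condVar_linear_le {H : Config N → ℝ} (h : BlockGap b H 2) (τ : Config N) {c : Fin N → ℝ}
    (hc : ∀ i, c i ^ 2 ≤ 1) :
    condVar (fiber b τ) H (fun σ => ∑ i ∈ b, c i * spin σ i) ≤ N / d := by
  have hd := R.one_le_d
  rw [le_div_iff₀ (by linarith)]
  have := h.condVar_linear_le τ hc
  nlinarith [R.card_le]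

/-- The derivative of the disorder in the coupling is −2β Cov(Σ ⟨σ_k⟩ σ_k, E). The block gap bounds
the two variances by N/d and 6K²d³/N, so the covariance is at most √6 K d ≤ (5/2) K d. -/
theorem disorder_le_add {H : Config N → ℝ} {β T : ℝ} (hT : 0 ≤ T) (hT1 : T ≤ 1) (hβ : 0 ≤ β)
    (h : ∀ s, 0 ≤ s → s ≤ T → BlockGap b (fun σ => H σ + s * (β * N * E σ)) 2) (τ : Config N) :
    disorder b τ (fun σ => H σ + T * (β * N * E σ)) ≤ disorder b τ H + 5 * K * β * d := by
  have hS := fiber_nonempty b τ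
  have hN := R.N_pos
  have hd := R.one_le_d
  have hK := R.one_le_K
  set Hs : ℝ → Config N → ℝ := fun s σ => H σ + s * (β * N * E σ) with hHs
  have hy : ∀ s, HasDerivAt (fun s => disorder b τ (Hs s))
      (-(2 * β * condCov (fiber b τ) (Hs s)
        (fun σ => ∑ k ∈ b, condMean (fiber b τ) (Hs s) (fun σ => spin σ k) * spin σ k) E)) s := by
    intro s
    have h1 := HasDerivAt.fun_sum (u := b) fun k _ => ((hasDerivAt_condMean H hS
      (fun σ => β * N * E σ) (fun σ => spin σ k) s).pow 2).const_sub 1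
    refine (h1.div_const (N : ℝ)).congr_deriv ?_
    have e1 : ∀ k, condCov (fiber b τ) (Hs s) (fun σ => spin σ k) (fun σ => β * N * E σ) =
        β * N * condCov (fiber b τ) (Hs s) (fun σ => spin σ k) E := by
      intro k
      simp only [condCov, mul_left_comm _ (β * N), condMean_const_mul]; ring
    have e2 : condCov (fiber b τ) (Hs s)
        (fun σ => ∑ k ∈ b, condMean (fiber b τ) (Hs s) (fun σ => spin σ k) * spin σ k) E =
        ∑ k ∈ b, condMean (fiber b τ) (Hs s) (fun σ => spin σ k) *
          condCov (fiber b τ) (Hs s) (fun σ => spin σ k) E := by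
      simp only [condCov, Finset.sum_mul, condMean_sum, mul_assoc, condMean_const_mul, mul_sub,
        Finset.sum_sub_distrib]
    rw [e2]
    change (∑ k ∈ b, -(_ * _ * condCov (fiber b τ) (Hs s) (fun σ => spin σ k)
      (fun σ => β * N * E σ))) / (N : ℝ) = _
    simp only [e1, Finset.mul_sum, Finset.sum_div, ← Finset.sum_neg_distrib]
    refine Finset.sum_congr rfl fun k _ => ?_
    simp only [hHs]
    field_simp
    simp
    ring
  have hder : ∀ s, 0 ≤ s → s ≤ T → |-(2 * β * condCov (fiber b τ) (Hs s)
        (fun σ => ∑ k ∈ b, condMean (fiber b τ) (Hs s) (fun σ => spin σ k) * spin σ k) E)| ≤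
      5 * K * β * d := by
    intro s h0 h1
    have hg := h s h0 h1
    rw [abs_neg, abs_mul, abs_of_nonneg (show 0 ≤ 2 * β by positivity)]
    have h2 := condCov_sq_le (Hs s) hS
      (fun σ => ∑ k ∈ b, condMean (fiber b τ) (Hs s) (fun σ => spin σ k) * spin σ k) E
    have h3 := R.condVar_linear_le hg τ (c := fun k => condMean (fiber b τ) (Hs s) fun σ => spin σ k)
      fun i => condMean_spin_sq_le _ hS _ i
    have h4 := R.condVar_le_const hg τ
    have h5 : condCov (fiber b τ) (Hs s)
      (fun σ => ∑ k ∈ b, condMean (fiber b τ) (Hs s) (fun σ => spin σ k) * spin σ k) E ^ 2 ≤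
        (5 / 2 * K * d) ^ 2 := by
      refine h2.trans ?_
      calc _ ≤ N / d * (6 * K ^ 2 * d ^ 3 / N) :=
            mul_le_mul h3 h4 (condVar_nonneg _ _) (by positivity)
        _ = 6 * K ^ 2 * d ^ 2 := by field_simp
        _ ≤ _ := by nlinarith [sq_nonneg (K * d)]
    have h6 := abs_le_of_sq_le_sq h5 (by positivity)
    calc _ ≤ 2 * β * (5 / 2 * K * d) := by gcongr
      _ = _ := by ring
  have hmain := (le_abs_self _).trans (abs_sub_le_of_hasDerivAt hT hy hder)
  have h4 : Hs 0 = H := by funext σ; simp [Hs]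
  have h5 : 5 * K * β * d * T ≤ 5 * K * β * d := mul_le_of_le_one_right (by positivity) hT1
  rw [h4] at hmain
  change disorder b τ (Hs T) ≤ _
  linarith

theorem overlap_fiber {σ σ' τ : Config N} (h : σ ∈ fiber b τ) (h' : σ' ∈ fiber b τ) :
    overlap σ σ' = 1 - (∑ k ∈ b, (1 - spin σ k * spin σ' k)) / N := by
  have hN := R.N_pos
  have : ∑ k ∈ b, (1 - spin σ k * spin σ' k) = ∑ k, (1 - spin σ k * spin σ' k) := by
    refine Finset.sum_subset (Finset.subset_univ b) fun k _ hk => ?_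
    have : spin σ k = spin σ' k := by
      rw [spin, spin, mem_fiber.1 h k hk, mem_fiber.1 h' k hk]
    rw [this, spin_mul_self, sub_self]
  rw [this, overlap, Finset.sum_sub_distrib]
  simp
  field_simp
  ring

omit R in
theorem sq_mul_one_sub_pow_le {x : ℝ} (h0 : 0 ≤ x) (h1 : x ≤ 1) {q : ℕ} (hq : 0 < q) :
    x ^ 2 * (1 - x) ^ q ≤ 2 / (q : ℝ) ^ 2 := by
  have hq' : (0 : ℝ) < q := by exact_mod_cast hq
  have e1 : (1 - x) ^ q ≤ Real.exp (-(q * x)) := by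
    calc (1 - x) ^ q ≤ Real.exp (-x) ^ q :=
          pow_le_pow_left₀ (by linarith) (by linarith [Real.add_one_le_exp (-x)]) q
      _ = _ := by rw [← Real.exp_nat_mul]; ring_nf
  have e2 : (q * x) ^ 2 / 2 ≤ Real.exp (q * x) := by
    have := Real.quadratic_le_exp_of_nonneg (show 0 ≤ q * x by positivity)
    have : 0 ≤ q * x := by positivity
    linarith
  have e3 : Real.exp (-(q * x)) * Real.exp (q * x) = 1 := by rw [← Real.exp_add]; simp
  have e4 := Real.exp_pos (-(q * x))
  rw [le_div_iff₀ (by positivity)]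
  calc x ^ 2 * (1 - x) ^ q * q ^ 2 ≤ x ^ 2 * Real.exp (-(q * x)) * q ^ 2 := by gcongr
    _ ≤ 2 := by nlinarith

/-- On the fiber R = 1 − x, where x has mean m at least half the disorder and, by the block gap,
variance at most 1/(dN) ≤ d⁻⁴. In m² ≤ 2x² + 2(x − m)² the first term is beaten by (1 − x)^q ≤
e^{-qx}, giving order q⁻² = d⁻⁴, and the second is the variance. -/
theorem disorder_sq_mul_le {H : Config N → ℝ} (h : BlockGap b H 2) {τ σ : Config N}
    (hσ : σ ∈ fiber b τ) {q : ℕ} (hq : (q : ℝ) = d ^ 2) :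
    disorder b τ H ^ 2 * condMean (fiber b τ) H (fun σ' => overlap σ σ' ^ q) ≤ 24 / d ^ 4 := by
  have hS := fiber_nonempty b τ
  have hN := R.N_pos
  have hd := R.one_le_d
  have hq0 : 0 < q := by
    have : (0 : ℝ) < q := by rw [hq]; positivity
    exact_mod_cast this
  set x : Config N → ℝ := fun σ' => (∑ k ∈ b, (1 - spin σ k * spin σ' k)) / N with hx
  have hx0 : ∀ σ', 0 ≤ x σ' := fun σ' => div_nonneg (Finset.sum_nonneg fun k _ => by
    rcases spin_eq_or σ k with h | h <;> rcases spin_eq_or σ' k with h' | h' <;> rw [h, h'] <;>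
      norm_num) hN.le
  have hx1 : ∀ σ', x σ' ≤ 1 := by
    intro σ'
    rw [hx, div_le_one hN]
    have : ∑ k ∈ b, (1 - spin σ k * spin σ' k) ≤ ∑ k ∈ b, (2 : ℝ) :=
      Finset.sum_le_sum fun k _ => by
        rcases spin_eq_or σ k with h | h <;> rcases spin_eq_or σ' k with h' | h' <;> rw [h, h'] <;>
          norm_num
    rw [Finset.sum_const, nsmul_eq_mul] at this
    have h2 := R.card_le
    have h3 : (0 : ℝ) ≤ b.card := Nat.cast_nonneg _
    nlinarith
  set m := condMean (fiber b τ) H x with hm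
  -- With c = ⟨σ_k⟩ and a sign s, 2(1 − sc) − (1 − c²) = (s − c)² ≥ 0.
  have hm2 : disorder b τ H ≤ 2 * m := by
    have : m = (∑ k ∈ b, (1 - spin σ k * condMean (fiber b τ) H (fun σ => spin σ k))) / N := by
      rw [hm, hx]
      simp only [div_eq_inv_mul]
      rw [condMean_const_mul, condMean_sum]
      congr 1
      refine Finset.sum_congr rfl fun k _ => ?_
      rw [condMean_sub, condMean_const _ hS, condMean_const_mul]
    rw [this, disorder, ← mul_div_assoc]
    refine div_le_div_of_nonneg_right ?_ hN.le
    rw [Finset.mul_sum]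
    refine Finset.sum_le_sum fun k _ => ?_
    have h1 := spin_sq σ k
    nlinarith [sq_nonneg (spin σ k - condMean (fiber b τ) H (fun σ => spin σ k))]
  have hvar : condVar (fiber b τ) H x ≤ 1 / d ^ 4 := by
    have e : condVar (fiber b τ) H x =
        (1 / (N : ℝ)) ^ 2 * condVar (fiber b τ) H (fun σ' => ∑ k ∈ b, -spin σ k * spin σ' k) := by
      have e1 : ∀ σ', x σ' = 1 / N * (∑ k ∈ b, -spin σ k * spin σ' k) + b.card / N := by
        intro σ'
        simp only [hx, Finset.sum_sub_distrib, neg_mul, Finset.sum_neg_distrib, Finset.sum_const,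
          nsmul_eq_mul, mul_one]
        ring
      rw [← condVar_const_mul]
      unfold condVar
      have e2 : condMean (fiber b τ) H x = condMean (fiber b τ) H
          (fun σ' => 1 / N * (∑ k ∈ b, -spin σ k * spin σ' k)) + b.card / N := by
        rw [show x = fun σ' => 1 / N * (∑ k ∈ b, -spin σ k * spin σ' k) + b.card / N from funext e1,
          condMean_add, condMean_const _ hS]
      rw [e2]
      simp only [e1, add_sub_add_right_eq_sub]
    rw [e]
    have := R.condVar_linear_le h τ (c := fun k => -spin σ k) fun k => by rw [neg_sq, spin_sq]
    calc _ ≤ (1 / (N : ℝ)) ^ 2 * (N / d) := by gcongr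
      _ = 1 / (d * N) := by field_simp
      _ ≤ 1 / d ^ 4 := by
        apply one_div_le_one_div_of_le (by positivity)
        nlinarith [R.cube_le]
  have hR : ∀ σ' ∈ fiber b τ, overlap σ σ' ^ q = (1 - x σ') ^ q := fun σ' h' => by
    rw [R.overlap_fiber hσ h']
  have hmain : m ^ 2 * condMean (fiber b τ) H (fun σ' => overlap σ σ' ^ q) ≤ 6 / d ^ 4 := by
    rw [← condMean_const_mul]
    calc _ ≤ condMean (fiber b τ) H (fun σ' => 4 / d ^ 4 + 2 * (x σ' - m) ^ 2) := by
          refine condMean_mono H fun σ' h' => ?_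
          rw [hR σ' h']
          have h1 := sq_mul_one_sub_pow_le (hx0 σ') (hx1 σ') hq0
          rw [hq, ← pow_mul] at h1
          have h2 : (1 - x σ') ^ q ≤ 1 := pow_le_one₀ (by linarith [hx1 σ']) (by linarith [hx0 σ'])
          have h3 : 0 ≤ (1 - x σ') ^ q := pow_nonneg (by linarith [hx1 σ']) q
          have h4 : m ^ 2 ≤ 2 * x σ' ^ 2 + 2 * (x σ' - m) ^ 2 := by
            nlinarith [sq_nonneg (x σ' + (x σ' - m))]
          calc m ^ 2 * (1 - x σ') ^ q ≤ (2 * x σ' ^ 2 + 2 * (x σ' - m) ^ 2) * (1 - x σ') ^ q := by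
                gcongr
            _ = 2 * (x σ' ^ 2 * (1 - x σ') ^ q) + 2 * (x σ' - m) ^ 2 * (1 - x σ') ^ q := by ring
            _ ≤ 2 * (2 / d ^ (2 * 2)) + 2 * (x σ' - m) ^ 2 * 1 := by gcongr
            _ = _ := by ring
      _ = 4 / d ^ 4 + 2 * condVar (fiber b τ) H x := by
          rw [condMean_add, condMean_const _ hS, condMean_const_mul, condVar]
      _ ≤ 4 / d ^ 4 + 2 * (1 / d ^ 4) := by gcongr
      _ = _ := by ring
  have hr0 : 0 ≤ condMean (fiber b τ) H (fun σ' => overlap σ σ' ^ q) :=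
    condMean_nonneg H fun σ' h' => by
      rw [hR σ' h']; exact pow_nonneg (by linarith [hx1 σ']) q
  have hm0 : 0 ≤ disorder b τ H := disorder_nonneg b τ H
  calc _ ≤ (2 * m) ^ 2 * condMean (fiber b τ) H (fun σ' => overlap σ σ' ^ q) := by gcongr
    _ = 4 * (m ^ 2 * condMean (fiber b τ) H (fun σ' => overlap σ σ' ^ q)) := by ring
    _ ≤ 4 * (6 / d ^ 4) := by gcongr
    _ = _ := by ring

end RegularOn

theorem condMean_mul_spin {b : Finset (Fin N)} {k : Fin N} (hk : k ∈ b) (τ : Config N)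
    (H U : Config N → ℝ) :
    condMean (fiber b τ) H (fun σ => U σ * spin σ k) =
      condMean (fiber b τ) H (fun σ => U σ * mag H k σ) +
        condMean (fiber b τ) H (fun σ => spinVar H k σ * grad k U σ) := by
  have h := sum_spin_sub_mag_mul (S := fiber b τ) (k := k) (fun σ => flip_mem_fiber hk) H U
  rw [← sub_eq_iff_eq_add', ← condMean_sub]
  simp only [condMean]
  rw [← h]
  congr 1
  exact Finset.sum_congr rfl fun σ _ => by ring

/-- v_k = 1 − m_k² ≤ 1 + c² − 2c m_k for every c. Integration by parts then replaces m_k by the spin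
σ_k itself, at the price of a gradient of U. -/
theorem condMean_mul_spinVar_le {b : Finset (Fin N)} {k : Fin N} (hk : k ∈ b) (τ : Config N)
    (H : Config N → ℝ) {U : Config N → ℝ} (hU : ∀ σ, 0 ≤ U σ) {c : ℝ} (hc : c ^ 2 ≤ 1) :
    condMean (fiber b τ) H (fun σ => U σ * spinVar H k σ) ≤
      ((1 + c ^ 2) * condMean (fiber b τ) H U -
        2 * condMean (fiber b τ) H (fun σ => U σ * (c * spin σ k))) +
      2 * condMean (fiber b τ) H (fun σ => spinVar H k σ * |grad k U σ|) := by
  have h1 := condMean_mul_spin hk τ H U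
  have h2 : condMean (fiber b τ) H (fun σ => U σ * spinVar H k σ) ≤
      condMean (fiber b τ) H (fun σ => (1 + c ^ 2) * U σ - 2 * c * (U σ * mag H k σ)) :=
    condMean_mono H fun σ _ => by
      rw [show spinVar H k σ = 1 - mag H k σ ^ 2 by linarith [mag_sq_add_spinVar H k σ]]
      have : 0 ≤ U σ * (mag H k σ - c) ^ 2 := mul_nonneg (hU σ) (sq_nonneg _)
      nlinarith
  rw [condMean_sub, condMean_const_mul, condMean_const_mul] at h2
  have h3 : |c * condMean (fiber b τ) H (fun σ => spinVar H k σ * grad k U σ)| ≤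
      condMean (fiber b τ) H (fun σ => spinVar H k σ * |grad k U σ|) := by
    have hc1 : |c| ≤ 1 := by rwa [← sq_le_one_iff_abs_le_one]
    rw [abs_mul]
    refine (mul_le_of_le_one_left (abs_nonneg _) hc1).trans (abs_le.2 ⟨?_, ?_⟩)
    · rw [← neg_one_mul, ← condMean_const_mul]
      refine condMean_mono H fun σ _ => ?_
      rw [neg_one_mul, ← mul_neg]
      exact mul_le_mul_of_nonneg_left (neg_abs_le _) (spinVar_pos H k σ).le
    · exact condMean_mono H fun σ _ =>
        mul_le_mul_of_nonneg_left (le_abs_self _) (spinVar_pos H k σ).le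
  have h4 : condMean (fiber b τ) H (fun σ => U σ * (c * spin σ k)) =
      c * condMean (fiber b τ) H (fun σ => U σ * spin σ k) := by
    simp only [mul_left_comm _ c, condMean_const_mul]
  rw [h4, h1]
  have := (abs_le.1 h3).2
  linarith

namespace RegularOn

variable {b : Finset (Fin N)} {d K : ℝ} {E : Config N → ℝ} (R : RegularOn b d K E)
include R

theorem disorder_le' (τ : Config N) (H : Config N → ℝ) : disorder b τ H ≤ 1 / (2 * d) := by
  refine (disorder_le b τ H).trans ?_
  have hd := R.one_le_d
  rw [div_le_div_iff₀ R.N_pos (by linarith)]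
  linarith [R.card_le]

theorem sum_spinVar_mul_abs_grad_le (H : Config N → ℝ) (σ : Config N) :
    ∑ k ∈ b, spinVar H k σ * |grad k (fun σ => |E σ|) σ| ≤ 5 / 4 * K * d := by
  have hd := R.one_le_d
  have hK := R.one_le_K
  have hN := R.N_pos
  have h1 : ∑ k ∈ b, spinVar H k σ * |grad k (fun σ => |E σ|) σ| ≤
      ∑ k ∈ b, spinVar H k σ * |grad k E σ| :=
    Finset.sum_le_sum fun k _ =>
      mul_le_mul_of_nonneg_left (abs_grad_abs_le k E σ) (spinVar_pos H k σ).le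
  refine h1.trans ((le_abs_self _).trans (abs_le_of_sq_le_sq ?_ (by positivity)))
  have h2 := Finset.sum_mul_sq_le_sq_mul_sq b (fun k => √(spinVar H k σ))
    (fun k => √(spinVar H k σ) * |grad k E σ|)
  simp only [← mul_assoc, Real.mul_self_sqrt (spinVar_pos H _ σ).le, mul_pow, sq_abs,
    Real.sq_sqrt (spinVar_pos H _ σ).le] at h2
  have h3 : 2 * d * ∑ k ∈ b, spinVar H k σ ≤ N := by
    refine le_trans (mul_le_mul_of_nonneg_left ?_ (by linarith)) R.card_le
    rw [← nsmul_one, ← Finset.sum_const]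
    exact Finset.sum_le_sum fun k _ => spinVar_le_one H k σ
  have h3' : ∑ k ∈ b, spinVar H k σ ≤ N / (2 * d) := by
    rw [le_div_iff₀ (by linarith)]; linarith
  have h4 := R.sum_grad_le_const H σ
  calc _ ≤ _ := h2
    _ ≤ N / (2 * d) * (3 * K ^ 2 * d ^ 3 / N) :=
        mul_le_mul h3' h4 (Finset.sum_nonneg fun k _ =>
          mul_nonneg (spinVar_pos H k σ).le (sq_nonneg _)) (by positivity)
    _ = 3 / 2 * K ^ 2 * d ^ 2 := by field_simp
    _ ≤ _ := by nlinarith [sq_nonneg (K * d)]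

/-- `condMean_mul_spinVar_le` is summed over the block with U = |E| and c_k = ⟨σ_k⟩, which turns Σ
v_k/N into the disorder. The errors are the covariance of |E| with Σ c_k σ_k and a gradient term, at
most (5/2)Kd and (5/4)Kd by the block gap and Cauchy–Schwarz. Each enters twice, whence 15/2, and is
divided by N ≥ d³. -/
theorem condMean_abs_mul_le {H : Config N → ℝ} (h : BlockGap b H 2) (τ : Config N) :
    condMean (fiber b τ) H (fun σ => |E σ| * ((∑ k ∈ b, spinVar H k σ) / N)) ≤
      disorder b τ H * condMean (fiber b τ) H (fun σ => |E σ|) + 15 / 2 * K / d ^ 2 := by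
  have hS := fiber_nonempty b τ
  have hd := R.one_le_d
  have hK := R.one_le_K
  have hN := R.N_pos
  set U : Config N → ℝ := fun σ => |E σ| with hU
  set c : Fin N → ℝ := fun k => condMean (fiber b τ) H fun σ => spin σ k with hc
  have hc1 : ∀ k, c k ^ 2 ≤ 1 := fun k => condMean_spin_sq_le _ hS H k
  set L : Config N → ℝ := fun σ => ∑ k ∈ b, c k * spin σ k with hL
  have hcov : |condCov (fiber b τ) H U L| ≤ 5 / 2 * K * d := by
    refine abs_le_of_sq_le_sq ?_ (by positivity)
    calc _ ≤ _ := condCov_sq_le H hS U L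
      _ ≤ (6 * K ^ 2 * d ^ 3 / N) * (N / d) :=
          mul_le_mul ((condVar_abs_le H hS E).trans (R.condVar_le_const h τ))
            (R.condVar_linear_le h τ hc1) (condVar_nonneg _ _) (by positivity)
      _ = 6 * K ^ 2 * d ^ 2 := by field_simp
      _ ≤ _ := by nlinarith [sq_nonneg (K * d)]
  have h1 := Finset.sum_le_sum fun k (hk : k ∈ b) =>
    condMean_mul_spinVar_le hk τ H (U := U) (fun σ => abs_nonneg _) (hc1 k)
  have h2 : ∑ k ∈ b, 2 * condMean (fiber b τ) H (fun σ => spinVar H k σ * |grad k U σ|) ≤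
      2 * (5 / 4 * K * d) := by
    rw [← Finset.mul_sum, ← condMean_sum]
    refine mul_le_mul_of_nonneg_left ?_ zero_le_two
    rw [← condMean_const H hS (5 / 4 * K * d)]
    exact condMean_mono H fun σ _ => R.sum_spinVar_mul_abs_grad_le H σ
  have h3 : ∑ k ∈ b, 2 * condMean (fiber b τ) H (fun σ => U σ * (c k * spin σ k)) =
      2 * (condCov (fiber b τ) H U L + condMean (fiber b τ) H U * ∑ k ∈ b, c k ^ 2) := by
    rw [← Finset.mul_sum, ← condMean_sum, condCov]
    have e1 : condMean (fiber b τ) H L = ∑ k ∈ b, c k ^ 2 := by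
      rw [hL, condMean_sum]
      exact Finset.sum_congr rfl fun k _ => by rw [condMean_const_mul, sq]
    rw [e1, sub_add_cancel]
    simp only [hL, Finset.mul_sum]
  have h4 : ∑ k ∈ b, condMean (fiber b τ) H (fun σ => U σ * spinVar H k σ) =
      N * condMean (fiber b τ) H (fun σ => U σ * ((∑ k ∈ b, spinVar H k σ) / N)) := by
    rw [← condMean_const_mul, ← condMean_sum]
    congr 1; funext σ
    rw [← Finset.mul_sum]; field_simp
  rw [Finset.sum_add_distrib, Finset.sum_sub_distrib, h3, h4, ← Finset.sum_mul] at h1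
  have h5 : N * disorder b τ H = ∑ k ∈ b, (1 + c k ^ 2) - 2 * ∑ k ∈ b, c k ^ 2 := by
    rw [disorder, mul_div_cancel₀ _ hN.ne', Finset.mul_sum, ← Finset.sum_sub_distrib]
    exact Finset.sum_congr rfl fun k _ => by simp only [hc]; ring
  have h6 : N * condMean (fiber b τ) H (fun σ => U σ * ((∑ k ∈ b, spinVar H k σ) / N)) ≤
      N * (disorder b τ H * condMean (fiber b τ) H U) + 15 / 2 * K * d := by
    rw [← mul_assoc, h5]
    nlinarith [(_root_.abs_le.1 hcov).1]
  have h7 : 15 / 2 * K * d ≤ N * (15 / 2 * K / d ^ 2) := by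
    rw [← mul_div_assoc, le_div_iff₀ (by positivity)]
    have := mul_le_mul_of_nonneg_left R.cube_le (show 0 ≤ 15 / 2 * K by positivity)
    nlinarith
  refine le_of_mul_le_mul_left ?_ hN
  rw [mul_add]
  exact h6.trans (by linarith)

/-- The main estimate on a block: the energy density is small wherever the block is not frozen. -/
theorem condMean_abs_mul_disorder_le {H : Config N → ℝ} {β T : ℝ} (hT : 0 ≤ T) (hT1 : T ≤ 1)
    (hβ : 0 ≤ β) (hβK : 4 * β * d ^ 3 * K ≤ 1)
    (h : ∀ s, 0 ≤ s → s ≤ T → BlockGap b (fun σ => H σ + s * (β * N * E σ)) 2) {τ : Config N}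
    {q : ℕ} (hq : (q : ℝ) = d ^ 2)
    (h2 : ∃ σ ∈ fiber b τ, condMean (fiber b τ) H (fun σ => E σ ^ 2) ≤
      K * (1 / N + condMean (fiber b τ) H (fun σ' => overlap σ σ' ^ q))) :
    condMean (fiber b τ) (fun σ => H σ + T * (β * N * E σ)) (fun σ => |E σ| *
      ((∑ k ∈ b, spinVar (fun σ => H σ + T * (β * N * E σ)) k σ) / N)) ≤ 24 * K ^ 3 / d ^ 2 := by
  have hS := fiber_nonempty b τ
  have hd := R.one_le_d
  have hK := R.one_le_K
  have hN := R.N_pos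
  have hH : BlockGap b H 2 := by simpa using h 0 le_rfl hT
  refine (R.condMean_abs_mul_le (h T hT le_rfl) τ).trans ?_
  have a1 := R.condMean_abs_le hT hT1 hβ hβK h τ
  have a2 := R.disorder_le_add hT hT1 hβ h τ
  obtain ⟨σ, hσ, h2⟩ := h2
  have a3 := R.disorder_sq_mul_le hH hσ hq
  have a4 := R.disorder_le' τ H
  set S₀ := disorder b τ H
  set y₀ := condMean (fiber b τ) H (fun σ => |E σ|) with hy₀
  have hS0 : 0 ≤ S₀ := disorder_nonneg b τ H
  have hy0 : 0 ≤ y₀ := condMean_nonneg _ fun _ _ => abs_nonneg _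
  have hyK : y₀ ≤ K := by
    rw [← condMean_const H hS K]; exact condMean_mono H fun σ _ => R.abs_le σ
  have hySq : y₀ ^ 2 ≤ condMean (fiber b τ) H (fun σ => E σ ^ 2) := by
    simpa only [sq_abs] using condMean_sq_le H hS (fun σ => |E σ|)
  -- Without degree q, ⟨E²⟩ is large only if the overlaps are close to 1, and then the disorder is
  -- small.
  have hSy : S₀ * y₀ ≤ 5 * K / d ^ 2 := by
    refine (le_abs_self _).trans (abs_le_of_sq_le_sq ?_ (by positivity))
    have b1 : S₀ ^ 2 * (1 / N) ≤ 1 / d ^ 4 := by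
      have : S₀ ^ 2 ≤ (1 / (2 * d)) ^ 2 := pow_le_pow_left₀ hS0 a4 2
      calc S₀ ^ 2 * (1 / N) ≤ (1 / (2 * d)) ^ 2 * (1 / d ^ 3) := by
            gcongr; exact R.cube_le
        _ = 1 / (4 * d ^ 5) := by field_simp; norm_num
        _ ≤ 1 / d ^ 4 := by
            apply one_div_le_one_div_of_le (by positivity)
            have : d ^ 4 ≤ d ^ 5 := pow_le_pow_right₀ hd (by norm_num)
            nlinarith [pow_pos (zero_lt_one.trans_le hd) 5]
    calc (S₀ * y₀) ^ 2 = S₀ ^ 2 * y₀ ^ 2 := by ring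
      _ ≤ S₀ ^ 2 * (K * (1 / N + condMean (fiber b τ) H (fun σ' => overlap σ σ' ^ q))) := by
          gcongr; exact hySq.trans h2
      _ = K * (S₀ ^ 2 * (1 / N) + S₀ ^ 2 * condMean (fiber b τ) H (fun σ' => overlap σ σ' ^ q)) := by
          ring
      _ ≤ K * (1 / d ^ 4 + 24 / d ^ 4) := by gcongr
      _ = 25 * K * 1 / d ^ 4 := by ring
      _ ≤ 25 * K * K / d ^ 4 := by gcongr
      _ = _ := by ring
  have hβ1 : 4 * (β * d ^ 3) ≤ 1 := by
    have : 0 ≤ β * d ^ 3 := by positivity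
    nlinarith
  have hd2 : β * d ≤ 1 / 4 / d ^ 2 := by
    rw [le_div_iff₀ (by positivity)]; nlinarith
  -- The three other terms of (S₀ + 5Kβd)(2y₀ + 8K²βd²); each is of order d⁻² because 4βd³ ≤ 1.
  have t2 : 8 * K ^ 2 * β * d ^ 2 * S₀ ≤ K ^ 2 / d ^ 2 := by
    calc 8 * K ^ 2 * β * d ^ 2 * S₀ ≤ 8 * K ^ 2 * β * d ^ 2 * (1 / (2 * d)) := by gcongr
      _ = 4 * K ^ 2 * (β * d) := by field_simp; ring
      _ ≤ 4 * K ^ 2 * (1 / 4 / d ^ 2) := by gcongr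
      _ = _ := by ring
  have t3 : 10 * K * β * d * y₀ ≤ 5 / 2 * K ^ 2 / d ^ 2 := by
    calc 10 * K * β * d * y₀ ≤ 10 * K * β * d * K := by gcongr
      _ = 10 * K ^ 2 * (β * d) := by ring
      _ ≤ 10 * K ^ 2 * (1 / 4 / d ^ 2) := by gcongr
      _ = _ := by ring
  have t4 : 40 * K ^ 3 * β ^ 2 * d ^ 3 ≤ 5 / 2 * K ^ 3 / d ^ 2 := by
    have hβ2 : β * d ^ 2 ≤ 1 / 4 := by
      have : d ^ 2 ≤ d ^ 3 := pow_le_pow_right₀ hd (by norm_num)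
      nlinarith
    calc 40 * K ^ 3 * β ^ 2 * d ^ 3 = 40 * K ^ 3 * ((β * d) * (β * d ^ 2)) := by ring
      _ ≤ 40 * K ^ 3 * ((1 / 4 / d ^ 2) * (1 / 4)) := by gcongr
      _ = _ := by ring
  have hm : disorder b τ (fun σ => H σ + T * (β * N * E σ)) *
      condMean (fiber b τ) (fun σ => H σ + T * (β * N * E σ)) (fun σ => |E σ|) ≤
      (S₀ + 5 * K * β * d) * (2 * y₀ + 8 * K ^ 2 * β * d ^ 2) :=
    mul_le_mul a2 a1 (condMean_nonneg _ fun _ _ => abs_nonneg _) (by positivity)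
  have hKK : K ≤ K ^ 3 := by nlinarith [sq_nonneg K]
  have hKK2 : K ^ 2 ≤ K ^ 3 := pow_le_pow_right₀ hK (by norm_num)
  have hfin : (10 * K + K ^ 2 + 5 / 2 * K ^ 2 + 5 / 2 * K ^ 3 + 15 / 2 * K) / d ^ 2 ≤
      24 * K ^ 3 / d ^ 2 := by
    apply div_le_div_of_nonneg_right _ (by positivity)
    linarith
  have hexp : (10 * K + K ^ 2 + 5 / 2 * K ^ 2 + 5 / 2 * K ^ 3 + 15 / 2 * K) / d ^ 2 =
      2 * (5 * K / d ^ 2) + K ^ 2 / d ^ 2 + 5 / 2 * K ^ 2 / d ^ 2 + 5 / 2 * K ^ 3 / d ^ 2 +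
        15 / 2 * K / d ^ 2 := by ring
  rw [hexp] at hfin
  nlinarith

end RegularOn

/-! ### Tangential and radial derivatives of homogeneous polynomials -/

/-- Regularity of a homogeneous polynomial `p` of degree `q` on the cube. -/
structure PolyBound (K : ℝ) (q : ℕ) (p : Config N → ℝ) : Prop where
  abs_le : ∀ σ, |p σ| ≤ K * N
  -- Only directions orthogonal to σ are estimated; the radial direction is given exactly by the two
  -- Euler identities.
  grad_le : ∀ (σ : Config N) (x : Fin N → ℝ), ∑ k, x k * spin σ k = 0 →
    (∑ k, x k * grad k p σ) ^ 2 ≤ K ^ 2 * q * N * ∑ k, x k ^ 2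
  hess_le : ∀ (σ : Config N) (x : Fin N → ℝ), ∑ k, x k * spin σ k = 0 →
    ∑ j, (∑ k, x k * grad j (grad k p) σ) ^ 2 ≤ K ^ 2 * q ^ 3 * ∑ k, x k ^ 2
  euler : ∀ σ, ∑ k, spin σ k * grad k p σ = q * p σ
  euler_grad : ∀ σ j, ∑ k, spin σ k * grad j (grad k p) σ = (q - 1) * grad j p σ

theorem sum_sub_proj_mul_spin (hN : 0 < N) (σ : Config N) (x : Fin N → ℝ) :
    ∑ k, (x k - (∑ i, x i * spin σ i) / N * spin σ k) * spin σ k = 0 := by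
  have hN' : (N : ℝ) ≠ 0 := by positivity
  simp only [sub_mul, mul_assoc, spin_mul_self, mul_one, Finset.sum_sub_distrib, Finset.sum_const,
    Finset.card_univ, Fintype.card_fin, nsmul_eq_mul]
  field_simp; simp

theorem sum_sq_sub_proj (hN : 0 < N) (σ : Config N) (x : Fin N → ℝ) :
    ∑ k, (x k - (∑ i, x i * spin σ i) / N * spin σ k) ^ 2 =
      ∑ k, x k ^ 2 - (∑ i, x i * spin σ i) ^ 2 / N := by
  have hN' : (N : ℝ) ≠ 0 := by positivity
  set c := (∑ i, x i * spin σ i) / N with hc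
  have e : ∀ k, (x k - c * spin σ k) ^ 2 = x k ^ 2 - 2 * c * (x k * spin σ k) + c ^ 2 := by
    intro k
    have := spin_sq σ k
    linear_combination c ^ 2 * this
  simp only [e, Finset.sum_add_distrib, Finset.sum_sub_distrib, ← Finset.mul_sum, Finset.sum_const,
    Finset.card_univ, Fintype.card_fin, nsmul_eq_mul]
  rw [hc]; field_simp; ring

namespace PolyBound

variable {K : ℝ} {q : ℕ} {p : Config N → ℝ} (hp : PolyBound K q p) (hN : 0 < N)
include hp hN

/-- The gradient is tested against x_k = w_k `grad k p` on b. The tangential part of x is bounded by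
`grad_le`; the radial part pairs with the gradient to q p s/N with s = Σ x_k σ_k, and s² ≤ W G by
Cauchy–Schwarz. The outcome is quadratic in G and one factor G is cancelled. -/
theorem sum_weighted_grad_le (b : Finset (Fin N)) (σ : Config N) {w : Fin N → ℝ}
    (hw : ∀ k, 0 ≤ w k ∧ w k ≤ 1) : ∑ k ∈ b, w k * grad k p σ ^ 2 ≤
      2 * K ^ 2 * q * N + 2 * q ^ 2 * (p σ / N) ^ 2 * ∑ k ∈ b, w k := by
  have hN' : (0 : ℝ) < N := by exact_mod_cast hN
  set x : Fin N → ℝ := fun k => if k ∈ b then w k * grad k p σ else 0 with hx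
  set G := ∑ k ∈ b, w k * grad k p σ ^ 2 with hG
  set W := ∑ k ∈ b, w k with hW
  have hG0 : 0 ≤ G := Finset.sum_nonneg fun k _ => mul_nonneg (hw k).1 (sq_nonneg _)
  have hW0 : 0 ≤ W := Finset.sum_nonneg fun k _ => (hw k).1
  have hxg : ∑ k, x k * grad k p σ = G := by
    simp only [hx, ite_mul, zero_mul, Finset.sum_ite_mem, Finset.univ_inter]
    exact Finset.sum_congr rfl fun k _ => by ring
  have hxx : ∑ k, x k ^ 2 ≤ G := by
    simp only [hx, ite_pow, ne_eq, OfNat.ofNat_ne_zero, not_false_eq_true, zero_pow,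
      Finset.sum_ite_mem, Finset.univ_inter]
    refine Finset.sum_le_sum fun k _ => ?_
    nlinarith [mul_nonneg (mul_nonneg (hw k).1 (sub_nonneg.2 (hw k).2)) (sq_nonneg (grad k p σ))]
  set s := ∑ i, x i * spin σ i with hs
  have hs2 : s ^ 2 ≤ W * G := by
    have h2 := Finset.sum_mul_sq_le_sq_mul_sq b (fun k => √(w k))
      (fun k => √(w k) * (grad k p σ * spin σ k))
    simp only [← mul_assoc, Real.mul_self_sqrt (hw _).1, mul_pow, Real.sq_sqrt (hw _).1,
      spin_sq, mul_one] at h2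
    refine le_trans (le_of_eq ?_) h2
    congr 1
    simp only [hs, hx, ite_mul, zero_mul, Finset.sum_ite_mem, Finset.univ_inter]
  have h1 := hp.grad_le σ _ (sum_sub_proj_mul_spin hN σ x)
  rw [sum_sq_sub_proj hN, ← hs] at h1
  have h3 : ∑ k, (x k - s / N * spin σ k) * grad k p σ = G - s / N * (q * p σ) := by
    rw [← hp.euler σ, ← hxg, Finset.mul_sum, ← Finset.sum_sub_distrib]
    exact Finset.sum_congr rfl fun k _ => by ring
  rw [h3] at h1
  have h4 : 0 ≤ s ^ 2 / N := by positivity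
  have h5 : (G - s / N * (q * p σ)) ^ 2 ≤ K ^ 2 * q * N * G :=
    h1.trans (mul_le_mul_of_nonneg_left (by linarith) (by positivity))
  have h6 : (s / N * (q * p σ)) ^ 2 ≤ q ^ 2 * (p σ / N) ^ 2 * (W * G) := by
    calc _ = q ^ 2 * (p σ / N) ^ 2 * s ^ 2 := by ring
      _ ≤ _ := by gcongr
  have h7 : G * G ≤ (2 * K ^ 2 * q * N + 2 * q ^ 2 * (p σ / N) ^ 2 * W) * G := by
    nlinarith [sq_nonneg ((G - s / N * (q * p σ)) - s / N * (q * p σ))]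
  rcases hG0.eq_or_lt with h0 | h0
  · rw [← h0]; positivity
  · exact le_of_mul_le_mul_right h7 h0

theorem sum_grad_sq_le (hq : 1 ≤ q) (σ : Config N) :
    ∑ k, grad k p σ ^ 2 ≤ 4 * K ^ 2 * q ^ 2 * N := by
  have hN' : (0 : ℝ) < N := by exact_mod_cast hN
  have h := hp.sum_weighted_grad_le hN Finset.univ σ (w := fun _ => 1)
    (fun _ => ⟨zero_le_one, le_rfl⟩)
  simp only [one_mul, Finset.sum_const, Finset.card_univ, Fintype.card_fin, nsmul_eq_mul,
    mul_one] at h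
  have h1 : (p σ / N) ^ 2 ≤ K ^ 2 := by
    rw [div_pow, div_le_iff₀ (by positivity), ← mul_pow, ← sq_abs]
    exact pow_le_pow_left₀ (abs_nonneg _) (hp.abs_le σ) 2
  have h2 : (q : ℝ) ≤ q ^ 2 := by
    have : (1 : ℝ) ≤ q := by exact_mod_cast hq
    nlinarith
  calc _ ≤ _ := h
    _ ≤ 2 * K ^ 2 * q ^ 2 * N + 2 * q ^ 2 * K ^ 2 * N := by gcongr
    _ = _ := by ring

/-- A row is the Hessian applied to a basis vector. Removing its radial part σ_i σ/N costs (q/N)²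
times the squared gradient, which is harmless because q ≤ N. -/
theorem row_le (hq : 1 ≤ q) (hqN : q ≤ N) (i : Fin N) (σ : Config N) :
    ∑ j, grad i (grad j p) σ ^ 2 ≤ 10 * K ^ 2 * q ^ 3 := by
  have hN' : (0 : ℝ) < N := by exact_mod_cast hN
  have hq' : (1 : ℝ) ≤ q := by exact_mod_cast hq
  have hqN' : (q : ℝ) ≤ N := by exact_mod_cast hqN
  set x : Fin N → ℝ := fun k => if k = i then 1 else 0 with hx
  have hs : ∑ k, x k * spin σ k = spin σ i := by simp [hx]
  have hxx : ∑ k, x k ^ 2 = 1 := by simp [hx]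
  have h1 := hp.hess_le σ _ (sum_sub_proj_mul_spin hN σ x)
  rw [sum_sq_sub_proj hN, hs, hxx, spin_sq] at h1
  have h3 : ∀ j, ∑ k, (x k - spin σ i / N * spin σ k) * grad j (grad k p) σ =
      grad j (grad i p) σ - spin σ i / N * ((q - 1) * grad j p σ) := by
    intro j
    rw [← hp.euler_grad σ j, Finset.mul_sum]
    simp only [sub_mul, Finset.sum_sub_distrib, mul_assoc]
    simp [hx]
  simp only [h3] at h1
  have h2 := hp.sum_grad_sq_le hN hq σ
  have h4 : ∑ j, grad i (grad j p) σ ^ 2 ≤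
      2 * ∑ j, (grad j (grad i p) σ - spin σ i / N * ((q - 1) * grad j p σ)) ^ 2 +
        2 * (q ^ 2 / N ^ 2) * ∑ j, grad j p σ ^ 2 := by
    rw [Finset.mul_sum, Finset.mul_sum, ← Finset.sum_add_distrib]
    refine Finset.sum_le_sum fun j _ => ?_
    rw [grad_comm i j]
    have h5 : (spin σ i / N * ((q - 1) * grad j p σ)) ^ 2 ≤ q ^ 2 / N ^ 2 * grad j p σ ^ 2 := by
      rw [mul_pow, div_pow, spin_sq, mul_pow, ← mul_assoc, one_div_mul_eq_div]
      gcongr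
      linarith
    nlinarith [sq_nonneg (grad j (grad i p) σ - 2 * (spin σ i / N * ((q - 1) * grad j p σ)))]
  have h6 : 2 * ((q : ℝ) ^ 2 / N ^ 2) * ∑ j, grad j p σ ^ 2 ≤ 8 * K ^ 2 * q ^ 3 := by
    calc _ ≤ 2 * ((q : ℝ) ^ 2 / N ^ 2) * (4 * K ^ 2 * q ^ 2 * N) := by gcongr
      _ = 8 * K ^ 2 * q ^ 3 * (q / N) := by field_simp; ring
      _ ≤ 8 * K ^ 2 * q ^ 3 * 1 := by
          gcongr; rw [div_le_one hN']; exact hqN'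
      _ = _ := by ring
  have h7 : K ^ 2 * q ^ 3 * (1 - 1 / N) ≤ K ^ 2 * q ^ 3 * 1 := by
    gcongr; linarith [show (0 : ℝ) ≤ 1 / N by positivity]
  linarith

/-- Split x = y + (s/N)σ with y orthogonal to σ. Every term that contains y is of order q^{3/2}, by
the tangential bounds and the Euler identities. The purely radial term q(q − 1) p s²/N² is kept
apart, since in general it is larger. -/
theorem quad_le (hK : 0 ≤ K) (hq : 1 ≤ q) (σ : Config N) (x : Fin N → ℝ) :
    ∑ j, ∑ k, grad j (grad k p) σ * x j * x k ≤ 2 * K * √q ^ 3 * ∑ k, x k ^ 2 +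
      q ^ 2 * |p σ / N| * ((∑ k, x k * spin σ k) ^ 2 / N) := by
  have hN' : (0 : ℝ) < N := by exact_mod_cast hN
  have hq' : (1 : ℝ) ≤ q := by exact_mod_cast hq
  have hd := Real.sq_sqrt (show (0 : ℝ) ≤ q by positivity)
  set d := √(q : ℝ)
  have hd0 : 0 ≤ d := Real.sqrt_nonneg _
  set X := ∑ k, x k ^ 2
  have hX0 : 0 ≤ X := Finset.sum_nonneg fun k _ => sq_nonneg _
  set s := ∑ k, x k * spin σ k with hs
  set y : Fin N → ℝ := fun k => x k - s / N * spin σ k with hy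
  have hy0 : ∑ k, y k * spin σ k = 0 := sum_sub_proj_mul_spin hN σ x
  have hyy : ∑ k, y k ^ 2 = X - s ^ 2 / N := sum_sq_sub_proj hN σ x
  have hs0 : 0 ≤ s ^ 2 / N := by positivity
  have hsX : s ^ 2 / N ≤ X := by
    have : 0 ≤ ∑ k, y k ^ 2 := Finset.sum_nonneg fun k _ => sq_nonneg _
    linarith
  have e1 : ∀ k, x k = y k + s / N * spin σ k := fun k => by simp [hy]
  have e2 : ∑ j, ∑ k, grad j (grad k p) σ * x j * x k =
      ∑ j, x j * (∑ k, y k * grad j (grad k p) σ) +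
        (q - 1) * (s / N) * ∑ j, y j * grad j p σ + (q - 1) * (s / N) ^ 2 * (q * p σ) := by
    have : ∀ j, ∑ k, grad j (grad k p) σ * x j * x k =
        x j * (∑ k, y k * grad j (grad k p) σ) + x j * (s / N * ((q - 1) * grad j p σ)) := by
      intro j
      rw [← hp.euler_grad σ j, Finset.mul_sum, Finset.mul_sum, Finset.mul_sum,
        ← Finset.sum_add_distrib]
      exact Finset.sum_congr rfl fun k _ => by rw [e1 k]; ring
    simp only [this]
    rw [Finset.sum_add_distrib, add_assoc]
    congr 1
    rw [← hp.euler σ, Finset.mul_sum, Finset.mul_sum, ← Finset.sum_add_distrib]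
    exact Finset.sum_congr rfl fun k _ => by rw [e1 k]; ring
  have b1 : ∑ j, x j * (∑ k, y k * grad j (grad k p) σ) ≤ K * d ^ 3 * X := by
    refine (le_abs_self _).trans (abs_le_of_sq_le_sq ?_ (by positivity))
    calc _ ≤ _ := Finset.sum_mul_sq_le_sq_mul_sq _ _ _
      _ ≤ X * (K ^ 2 * q ^ 3 * X) := by
          refine mul_le_mul_of_nonneg_left ((hp.hess_le σ y hy0).trans ?_) hX0
          rw [hyy]; gcongr; linarith
      _ = _ := by rw [← hd]; ring
  have b2 : (q - 1) * (s / N) * ∑ j, y j * grad j p σ ≤ K * d ^ 3 * X := by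
    refine (le_abs_self _).trans (abs_le_of_sq_le_sq ?_ (by positivity))
    calc ((q - 1) * (s / N) * ∑ j, y j * grad j p σ) ^ 2
        = (q - 1) ^ 2 * (s ^ 2 / N) * (1 / N) * (∑ j, y j * grad j p σ) ^ 2 := by
          field_simp
      _ ≤ q ^ 2 * X * (1 / N) * (K ^ 2 * q * N * X) := by
          have h1 := hp.grad_le σ y hy0
          rw [hyy] at h1
          have h2 : K ^ 2 * q * N * (X - s ^ 2 / N) ≤ K ^ 2 * q * N * X := by gcongr; linarith
          have h3 : ((q : ℝ) - 1) ^ 2 ≤ q ^ 2 := by nlinarith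
          have h4 := h1.trans h2
          gcongr
      _ = (K * d ^ 3 * X) ^ 2 := by rw [← hd]; field_simp
  have b3 : (q - 1) * (s / N) ^ 2 * (q * p σ) ≤ q ^ 2 * |p σ / N| * (s ^ 2 / N) := by
    have h1 : p σ / N ≤ |p σ / N| := le_abs_self _
    have h2 : 0 ≤ |p σ / N| := abs_nonneg _
    calc (q - 1) * (s / N) ^ 2 * (q * p σ) = (q - 1) * q * (s ^ 2 / N) * (p σ / N) := by
          field_simp
      _ ≤ (q - 1) * q * (s ^ 2 / N) * |p σ / N| := by
          apply mul_le_mul_of_nonneg_left h1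
          have : (0 : ℝ) ≤ q - 1 := by linarith
          positivity
      _ ≤ q * q * (s ^ 2 / N) * |p σ / N| := by gcongr; linarith
      _ = _ := by ring
  rw [e2]
  linarith

theorem regularOn (hK : 1 ≤ K) (hq : 1 ≤ q) (hqN : q ^ 3 ≤ N ^ 2) {b : Finset (Fin N)}
    (hb : 2 * √(q : ℝ) * b.card ≤ N) : RegularOn b √(q : ℝ) K (fun σ => p σ / N) := by
  have hN' : (0 : ℝ) < N := by exact_mod_cast hN
  have hd := Real.sq_sqrt (show (0 : ℝ) ≤ q by positivity)
  refine ⟨?_, hK, hb, ?_, ?_, ?_⟩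
  · rw [Real.one_le_sqrt]; exact_mod_cast hq
  · refine (le_abs_self _).trans (abs_le_of_sq_le_sq ?_ hN'.le)
    rw [← pow_mul, mul_comm 3 2, pow_mul, hd]; exact_mod_cast hqN
  · intro σ
    rw [abs_div, abs_of_pos hN', div_le_iff₀ hN']
    exact hp.abs_le σ
  · intro σ w hw
    have h := hp.sum_weighted_grad_le hN b σ hw
    have e : ∀ k, grad k (fun σ => p σ / N) σ = grad k p σ / N := by
      intro k; unfold grad; ring
    simp only [e, div_pow, ← mul_div_assoc]
    rw [← Finset.sum_div, show √(q : ℝ) ^ 4 = (√(q : ℝ) ^ 2) ^ 2 by ring, hd,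
      div_le_iff₀ (by positivity)]
    refine h.trans (le_of_eq ?_)
    field_simp

end PolyBound

/-! ### Form bounds and regular systems -/

/-- If `U` is small on average over every block, then it is a small form perturbation. -/
theorem sum_mul_sq_le {b : Finset (Fin N)} {H U : Config N → ℝ} (h : BlockGap b H 2)
    {m M : ℝ} (hU0 : ∀ σ, 0 ≤ U σ) (hUM : ∀ σ, U σ ≤ M)
    (hUm : ∀ τ, condMean (fiber b τ) H U ≤ m) (F : Config N → ℝ) :
    ∑ σ, Real.exp (H σ) * (U σ * F σ ^ 2) ≤
      2 * m * ∑ σ, Real.exp (H σ) * F σ ^ 2 + 4 * M * blockForm H b F := by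
  have hM : 0 ≤ M := (hU0 1).trans (hUM 1)
  have hm : 0 ≤ m := (condMean_nonneg H fun σ _ => hU0 σ).trans (hUm 1)
  have hfib : ∀ τ, ∑ σ ∈ fiber b τ, Real.exp (H σ) * (U σ * F σ ^ 2) ≤
      ∑ σ ∈ fiber b τ, (2 * m * (Real.exp (H σ) * F σ ^ 2) + 4 * M * ∑ k ∈ b, Real.exp (H σ) *
        (spinVar H k σ * grad k F σ ^ 2)) := by
    intro τ
    have hS := fiber_nonempty b τ
    have hZ := weight_pos H hS
    set c := condMean (fiber b τ) H F with hc
    have h1 := h τ F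
    rw [← hc] at h1
    have h2 : c ^ 2 * ∑ σ ∈ fiber b τ, Real.exp (H σ) ≤ ∑ σ ∈ fiber b τ, Real.exp (H σ) * F σ ^ 2 := by
      have := mul_le_mul_of_nonneg_right (condMean_sq_le H hS F) hZ.le
      rwa [condMean_mul_weight H hS] at this
    have h3 : ∑ σ ∈ fiber b τ, Real.exp (H σ) * U σ ≤ m * ∑ σ ∈ fiber b τ, Real.exp (H σ) := by
      rw [← condMean_mul_weight H hS]
      exact mul_le_mul_of_nonneg_right (hUm τ) hZ.le
    -- F is split into its conditional mean, which sees only the average of U, and its fluctuation,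
    -- which pays sup U times a variance bounded through the block gap.
    have h4 : ∑ σ ∈ fiber b τ, Real.exp (H σ) * (U σ * F σ ^ 2) ≤
        2 * c ^ 2 * ∑ σ ∈ fiber b τ, Real.exp (H σ) * U σ +
          2 * M * ∑ σ ∈ fiber b τ, Real.exp (H σ) * (F σ - c) ^ 2 := by
      rw [Finset.mul_sum, Finset.mul_sum, ← Finset.sum_add_distrib]
      refine Finset.sum_le_sum fun σ _ => ?_
      have e := (Real.exp_pos (H σ)).le
      have h5 : U σ * F σ ^ 2 ≤ 2 * c ^ 2 * U σ + 2 * M * (F σ - c) ^ 2 := by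
        have i1 : F σ ^ 2 ≤ 2 * c ^ 2 + 2 * (F σ - c) ^ 2 := by nlinarith [sq_nonneg (F σ - 2 * c)]
        have i2 := mul_le_mul_of_nonneg_left i1 (hU0 σ)
        have i3 := mul_le_mul_of_nonneg_right (hUM σ) (sq_nonneg (F σ - c))
        linarith
      have := mul_le_mul_of_nonneg_left h5 e
      linarith
    rw [Finset.sum_add_distrib, ← Finset.mul_sum, ← Finset.mul_sum, Finset.sum_comm]
    have h6 := mul_le_mul_of_nonneg_left h3 (show 0 ≤ 2 * c ^ 2 by positivity)
    have h7 := mul_le_mul_of_nonneg_left h2 (show 0 ≤ 2 * m by positivity)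
    have h8 := mul_le_mul_of_nonneg_left h1 (show 0 ≤ 2 * M by positivity)
    linarith
  -- Summing over all boundary conditions counts each configuration equally often.
  have hsum := Finset.sum_le_sum fun τ (_ : τ ∈ (Finset.univ : Finset (Config N))) => hfib τ
  rw [sum_sum_fiber, sum_sum_fiber] at hsum
  have hcard : (0 : ℝ) < (fiber b (1 : Config N)).card := by
    exact_mod_cast Finset.card_pos.2 (fiber_nonempty b 1)
  refine (le_of_mul_le_mul_left hsum hcard).trans (le_of_eq ?_)
  rw [Finset.sum_add_distrib, ← Finset.mul_sum, ← Finset.mul_sum, blockForm, Finset.sum_comm]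

/-- The property that the second moment of each `p q` is controlled on small blocks. -/
def SecondMomentBound (K : ℝ) (Q : Finset ℕ) (b : ℕ → ℝ) (p : ℕ → Config N → ℝ)
    (h : Config N → ℝ) : Prop :=
  -- Degree q is absent from the Hamiltonian, which makes `p q` independent of it for random
  -- couplings. The temperatures t/N form a finite grid, so that a union bound applies.
  ∀ q ∈ Q, ∀ (A : Finset (Fin N)), 2 * √(q : ℝ) * A.card ≤ N →
    ∀ (τ : Config N) (t : ℕ → ℕ), (∀ q, t q ≤ N) → ∃ σ ∈ fiber A τ,
      condMean (fiber A τ) (fun σ => h σ + ∑ q ∈ Q.erase q, (t q : ℝ) / N * (b q * p q σ))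
        (fun σ => p q σ ^ 2) ≤
      K * (N + N ^ 2 * condMean (fiber A τ)
        (fun σ => h σ + ∑ q ∈ Q.erase q, (t q : ℝ) / N * (b q * p q σ))
        (fun σ' => overlap σ σ' ^ q))

/-- An external field plus polynomials satisfying the regularity needed for a spectral gap. -/
structure RegularSystem (K : ℝ) (Q : Finset ℕ) (b : ℕ → ℝ) (p : ℕ → Config N → ℝ)
    (h : Config N → ℝ) : Prop where
  N_pos : 0 < N
  one_le_K : 1 ≤ K
  b_nonneg : ∀ q ∈ Q, 0 ≤ b q
  two_le : ∀ q ∈ Q, 2 ≤ q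
  cube_le : ∀ q ∈ Q, q ^ 3 ≤ N ^ 2
  poly : ∀ q ∈ Q, PolyBound K q (p q)
  hess_field : ∀ i j σ, grad i (grad j h) σ = 0
  second_moment : SecondMomentBound K Q b p h
  small : 1000 * K ^ 3 * ∑ q ∈ Q, √(q : ℝ) ^ 3 * b q ≤ 1

theorem blockForm_sum_chunks (H F : Config N → ℝ) (A : Finset (Fin N)) {m : ℕ} (c : Fin N → ℕ)
    (hc : ∀ k, c k < m) :
    ∑ j ∈ Finset.range m, blockForm H (A.filter fun k => c k = j) F = blockForm H A F :=
  Finset.sum_fiberwise_of_maps_to (fun k _ => Finset.mem_range.2 (hc k)) _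

theorem card_chunk_le (A : Finset (Fin N)) {n : ℕ} (hn : 0 < n) (j : ℕ) :
    (A.filter fun k : Fin N => (k : ℕ) / n = j).card ≤ n := by
  have : ((A.filter fun k : Fin N => (k : ℕ) / n = j).map Fin.valEmbedding) ⊆
      Finset.Ico (j * n) (j * n + n) := by
    intro x hx
    simp only [Finset.mem_map, Finset.mem_filter, Fin.valEmbedding_apply] at hx
    obtain ⟨k, ⟨_, hk⟩, rfl⟩ := hx
    rw [Finset.mem_Ico]
    have h1 := Nat.div_add_mod (k : ℕ) n
    have h2 := Nat.mod_lt (k : ℕ) hn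
    rw [hk] at h1
    rw [mul_comm j n]
    exact ⟨h1 ▸ Nat.le_add_right _ _, by rw [← h1]; exact Nat.add_lt_add_left h2 _⟩
  have := Finset.card_le_card this
  simpa using this

/-- The gradients `grad k f / cosh B_k`, whose squares sum up to the density of `blockForm`. -/
def scaledGrad (H f : Config N → ℝ) (k : Fin N) (σ : Config N) : ℝ :=
  (Real.cosh (grad k H σ))⁻¹ * grad k f σ

theorem scaledGrad_sq (H f : Config N → ℝ) (k : Fin N) (σ : Config N) :
    scaledGrad H f k σ ^ 2 = spinVar H k σ * grad k f σ ^ 2 := by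
  rw [scaledGrad, mul_pow, inv_pow, spinVar]

/-- By the product rule, a derivative falls either on `grad k f`, giving the second-derivative sum
that `bochner` provides with a positive sign, or on 1/cosh B_k, giving J² terms. The latter are
summed along rows to at most 4r² ≤ 1/16. -/
theorem sum_blockForm_scaledGrad_le (H : Config N → ℝ) (A : Finset (Fin N)) {r : ℝ} (hr0 : 0 ≤ r)
    (hr : r ≤ 1 / 8) (hrow : ∀ i σ, ∑ j, grad i (grad j H) σ ^ 2 ≤ r ^ 2) (f : Config N → ℝ) :
    ∑ k ∈ A, blockForm H A (scaledGrad H f k) ≤ 4 * (∑ i ∈ A, ∑ j ∈ A, ∑ σ, Real.exp (H σ) *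
        (spinVar H i σ * spinVar H j σ * grad i (grad j f) σ ^ 2)) + blockForm H A f := by
  have hJ : ∀ i j σ, |grad i (grad j H) σ| ≤ 1 / 8 := by
    intro i j σ
    have h1 := (Finset.single_le_sum (f := fun j => grad i (grad j H) σ ^ 2)
      (fun j _ => sq_nonneg _) (Finset.mem_univ j)).trans (hrow i σ)
    exact (abs_le_of_sq_le_sq h1 hr0).trans hr
  have h1 : ∀ k ∈ A, blockForm H A (scaledGrad H f k) ≤ ∑ j ∈ A, ∑ σ, (4 * (Real.exp (H σ) *
      (spinVar H k σ * spinVar H j σ * grad k (grad j f) σ ^ 2)) +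
      4 * grad k (grad j H) σ ^ 2 * (Real.exp (H σ) * (spinVar H k σ * grad k f σ ^ 2))) := by
    intro k _
    refine Finset.sum_le_sum fun j _ => Finset.sum_le_sum fun σ _ => ?_
    have h2 := grad_inv_cosh_mul_sq_le H (hJ j k σ) (grad k f)
    rw [grad_comm j k, grad_comm j k H] at h2
    have e := Real.exp_pos (H σ)
    have v := spinVar_pos H j σ
    have v' := spinVar_pos H k σ
    have h3 := mul_le_mul_of_nonneg_left h2 (mul_nonneg e.le v.le)
    have h4 : Real.exp (H σ) * spinVar H j σ * (4 * grad k (grad j H) σ ^ 2 * spinVar H k σ *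
        grad k f σ ^ 2) ≤ Real.exp (H σ) * 1 * (4 * grad k (grad j H) σ ^ 2 * spinVar H k σ *
        grad k f σ ^ 2) := by
      gcongr; exact spinVar_le_one H j σ
    calc _ = Real.exp (H σ) * spinVar H j σ * grad j (scaledGrad H f k) σ ^ 2 := by ring
      _ ≤ _ := h3
      _ ≤ _ := by linarith
  refine (Finset.sum_le_sum h1).trans ?_
  simp only [Finset.sum_add_distrib, ← Finset.mul_sum]
  refine add_le_add le_rfl ?_
  rw [blockForm]
  refine Finset.sum_le_sum fun k _ => ?_
  rw [Finset.sum_comm]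
  refine Finset.sum_le_sum fun σ _ => ?_
  rw [← Finset.sum_mul, ← Finset.mul_sum]
  refine mul_le_of_le_one_left (mul_nonneg (Real.exp_pos _).le
    (mul_nonneg (spinVar_pos H k σ).le (sq_nonneg _))) ?_
  have h2 := (Finset.sum_le_univ_sum_of_nonneg (s := A) fun j =>
    sq_nonneg (grad k (grad j H) σ)).trans (hrow k σ)
  have h3 : r ^ 2 ≤ (1 / 8) ^ 2 := by gcongr
  linarith

/-- The Γ in the Hessian bound has coefficient 40Kκ ≤ 1/25 and is absorbed by the Γ/4 of the Bochner
inequality; the rest is a small multiple of D. -/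
theorem gap_arithmetic {K κ D Γ X I : ℝ} (hK : 1 ≤ K) (hκ : 0 ≤ κ) (hs : 1000 * K ^ 3 * κ ≤ 1)
    (hD : 0 ≤ D) (hΓ : 0 ≤ Γ) (hI : (1 - 120 * (4 * K * κ) ^ 2) * D + 1 / 4 * Γ - X ≤ I)
    (hX : X ≤ κ * (242 * K ^ 3 * D + 10 * K * (4 * Γ + D))) : (1 - 303 * K ^ 3 * κ) * D ≤ I := by
  have hKK : K ≤ K ^ 3 := by nlinarith [sq_nonneg K]
  have hKκ : K * κ ≤ K ^ 3 * κ := mul_le_mul_of_nonneg_right hKK hκ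
  have hKκ0 : 0 ≤ K * κ := by positivity
  have f1 : 120 * (4 * K * κ) ^ 2 * D ≤ 2 * (K ^ 3 * κ) * D := by
    refine mul_le_mul_of_nonneg_right ?_ hD
    nlinarith
  have f2 : K * κ * Γ ≤ 1 / 1000 * Γ := mul_le_mul_of_nonneg_right (by linarith) hΓ
  have f3 : K * κ * D ≤ K ^ 3 * κ * D := mul_le_mul_of_nonneg_right hKκ hD
  have f4 : 0 ≤ K ^ 3 * κ * D := by positivity
  linarith

/-! ### The spectral gap of a regular system, by induction on the block -/

namespace RegularSystem

variable {K : ℝ} {Q : Finset ℕ} {b : ℕ → ℝ} {p : ℕ → Config N → ℝ} {h : Config N → ℝ}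

/-- The interpolating Hamiltonian. -/
def energy (N : ℕ) (Q : Finset ℕ) (b : ℕ → ℝ) (p : ℕ → Config N → ℝ) (h : Config N → ℝ)
    (t : ℕ → ℕ) (σ : Config N) : ℝ := h σ + ∑ q ∈ Q, (t q : ℝ) / N * (b q * p q σ)

theorem energy_update {q : ℕ} (hq : q ∈ Q) (t : ℕ → ℕ) (k : ℕ) (σ : Config N) :
    energy N Q b p h (Function.update t q k) σ =
      (h σ + ∑ q ∈ Q.erase q, (t q : ℝ) / N * (b q * p q σ)) + (k : ℝ) / N * (b q * p q σ) := by
  rw [energy, ← Finset.add_sum_erase _ _ hq, Function.update_self]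
  have : ∑ x ∈ Q.erase q, ((Function.update t q k x : ℕ) : ℝ) / N * (b x * p x σ) =
      ∑ q ∈ Q.erase q, (t q : ℝ) / N * (b q * p q σ) :=
    Finset.sum_congr rfl fun x hx => by rw [Function.update_of_ne (Finset.ne_of_mem_erase hx)]
  rw [this]; ring

variable (S : RegularSystem K Q b p h)
include S

theorem N_pos' : (0 : ℝ) < N := by exact_mod_cast S.N_pos

theorem one_le_sqrt {q : ℕ} (hq : q ∈ Q) : 1 ≤ √(q : ℝ) := by
  rw [Real.one_le_sqrt]
  exact_mod_cast (by linarith [S.two_le q hq] : 1 ≤ q)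

theorem sqrt_cube_mul_le {q : ℕ} (hq : q ∈ Q) :
    √(q : ℝ) ^ 3 * b q ≤ ∑ q ∈ Q, √(q : ℝ) ^ 3 * b q :=
  Finset.single_le_sum (f := fun q : ℕ => √(q : ℝ) ^ 3 * b q) (fun q hq =>
    mul_nonneg (by positivity) (S.b_nonneg q hq)) hq

theorem K_mul_le {q : ℕ} (hq : q ∈ Q) : 1000 * (K * (√(q : ℝ) ^ 3 * b q)) ≤ 1 := by
  have h1 := S.small
  have h2 := S.sqrt_cube_mul_le hq
  have hK := S.one_le_K
  have h3 : K ≤ K ^ 3 := by nlinarith [sq_nonneg K]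
  have h4 : 0 ≤ √(q : ℝ) ^ 3 * b q := mul_nonneg (by positivity) (S.b_nonneg q hq)
  have h5 : K * (√(q : ℝ) ^ 3 * b q) ≤ K ^ 3 * ∑ q ∈ Q, √(q : ℝ) ^ 3 * b q := by gcongr
  linarith

theorem le_N {q : ℕ} (hq : q ∈ Q) : q ≤ N := by
  have h1 := S.cube_le q hq
  have h2 := S.two_le q hq
  by_contra h
  push Not at h
  have : N ^ 2 < q ^ 2 := Nat.pow_lt_pow_left h (by norm_num)
  nlinarith

/-- The error term of degree `q` in the Bochner formula on a block. -/
theorem sum_abs_mul_le {q : ℕ} (hq : q ∈ Q) {A : Finset (Fin N)} {t : ℕ → ℕ} (ht : ∀ q, t q ≤ N)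
    (ih : ∀ B : Finset (Fin N), B.card < A.card → ∀ t : ℕ → ℕ, (∀ q, t q ≤ N) →
      BlockGap B (energy N Q b p h t) (3 / 2)) (F : Config N → ℝ) :
    ∑ σ, Real.exp (energy N Q b p h t σ) * (|p q σ / N| *
      ((∑ k ∈ A, spinVar (energy N Q b p h t) k σ) / N) * F σ ^ 2) ≤
      240 * K ^ 3 / √(q : ℝ) * ∑ σ, Real.exp (energy N Q b p h t σ) * F σ ^ 2 +
        10 * K / √(q : ℝ) * blockForm (energy N Q b p h t) A F := by
  have hN := S.N_pos'
  have hK := S.one_le_K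
  have hd1 := S.one_le_sqrt hq
  have hdq := Real.sq_sqrt (show (0 : ℝ) ≤ q by positivity)
  have hb := S.b_nonneg q hq
  set d := √(q : ℝ) with hd
  set H := energy N Q b p h t with hH
  have hI : 0 ≤ ∑ σ, Real.exp (H σ) * F σ ^ 2 :=
    Finset.sum_nonneg fun σ _ => mul_nonneg (Real.exp_pos _).le (sq_nonneg _)
  have hE : ∀ σ, |p q σ / N| ≤ K := fun σ => by
    rw [abs_div, abs_of_pos hN, div_le_iff₀ hN]; exact (S.poly q hq).abs_le σ
  have hρ0 : ∀ (B : Finset (Fin N)) σ, 0 ≤ (∑ k ∈ B, spinVar H k σ) / N := fun B σ =>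
    div_nonneg (Finset.sum_nonneg fun k _ => (spinVar_pos H k σ).le) hN.le
  have hUM : ∀ B : Finset (Fin N), 2 * d * B.card ≤ N → ∀ σ,
      |p q σ / N| * ((∑ k ∈ B, spinVar H k σ) / N) ≤ K / (2 * d) := by
    intro B hB σ
    have h1 : (∑ k ∈ B, spinVar H k σ) / N ≤ 1 / (2 * d) := by
      rw [div_le_div_iff₀ hN (by linarith)]
      have : ∑ k ∈ B, spinVar H k σ ≤ B.card := by
        rw [← nsmul_one, ← Finset.sum_const]
        exact Finset.sum_le_sum fun k _ => spinVar_le_one H k σ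
      nlinarith
    calc _ ≤ K * (1 / (2 * d)) := mul_le_mul (hE σ) h1 (hρ0 B σ) (by linarith)
      _ = _ := by ring
  -- For a small set A the factor Σ v_k/N is itself at most 1/(2d), and a pointwise bound suffices.
  by_cases hA : 2 * d * A.card ≤ N
  · have h1 : ∑ σ, Real.exp (H σ) * (|p q σ / N| *
        ((∑ k ∈ A, spinVar H k σ) / N) * F σ ^ 2) ≤
        K / (2 * d) * ∑ σ, Real.exp (H σ) * F σ ^ 2 := by
      rw [Finset.mul_sum]
      refine Finset.sum_le_sum fun σ _ => ?_
      have := mul_le_mul_of_nonneg_right (hUM A hA σ)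
        (mul_nonneg (Real.exp_pos (H σ)).le (sq_nonneg (F σ)))
      linarith
    have h2 : K / (2 * d) ≤ 240 * K ^ 3 / d := by
      rw [div_le_div_iff₀ (by linarith) (by linarith)]
      have : K ≤ K ^ 3 := by nlinarith [sq_nonneg K]
      nlinarith
    have h3 := mul_le_mul_of_nonneg_right h2 hI
    have h4 : 0 ≤ 10 * K / d * blockForm H A F :=
      mul_nonneg (by positivity) (blockForm_nonneg _ _ _)
    linarith
  · push Not at hA
    have hd3 : d ^ 3 ≤ N := (le_abs_self _).trans (abs_le_of_sq_le_sq (by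
      rw [← pow_mul, mul_comm 3 2, pow_mul, hdq]; exact_mod_cast S.cube_le q hq) hN.le)
    have hq2 : (2 : ℝ) ≤ d ^ 2 := by rw [hdq]; exact_mod_cast S.two_le q hq
    -- The chunk size n is the largest allowed for `RegularOn`. It is positive because 2d ≤ d³ ≤ N,
    -- so rounding loses at most a factor 2 and there are at most 5d chunks, all smaller than A.
    set n := ⌊(N : ℝ) / (2 * d)⌋₊ with hn
    have hx1 : 1 ≤ (N : ℝ) / (2 * d) := by
      rw [le_div_iff₀ (by linarith)]; nlinarith
    have hn1 : 1 ≤ n := (Nat.one_le_floor_iff _).2 hx1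
    have hnle : 2 * d * n ≤ N := by
      have := Nat.floor_le (show 0 ≤ (N : ℝ) / (2 * d) by positivity)
      rw [le_div_iff₀ (by linarith)] at this
      linarith
    have hnge : (N : ℝ) ≤ 4 * d * n := by
      have h1 := Nat.lt_floor_add_one ((N : ℝ) / (2 * d))
      rw [← hn, div_lt_iff₀ (by linarith)] at h1
      have : (1 : ℝ) ≤ n := by exact_mod_cast hn1
      nlinarith
    set m := N / n + 1 with hm
    have hm5 : (m : ℝ) ≤ 5 * d := by
      have h1 : ((N / n : ℕ) : ℝ) ≤ (N : ℝ) / n := Nat.cast_div_le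
      have h2 : (N : ℝ) / n ≤ 4 * d := by
        rw [div_le_iff₀ (by exact_mod_cast hn1)]; exact hnge
      rw [hm]; push_cast; linarith
    set c : Fin N → ℕ := fun k => (k : ℕ) / n with hc
    have hcm : ∀ k, c k < m := fun k => Nat.lt_succ_of_le (Nat.div_le_div_right k.2.le)
    have hchunk : ∀ j ∈ Finset.range m, ∑ σ, Real.exp (H σ) * (|p q σ / N| *
        ((∑ k ∈ A.filter (fun k => c k = j), spinVar H k σ) / N) * F σ ^ 2) ≤
        2 * (24 * K ^ 3 / d ^ 2) * ∑ σ, Real.exp (H σ) * F σ ^ 2 +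
          4 * (K / (2 * d)) * blockForm H (A.filter fun k => c k = j) F := by
      intro j _
      set B := A.filter fun k => c k = j with hB
      have hBn : B.card ≤ n := card_chunk_le A hn1 j
      have hBN : 2 * d * B.card ≤ N := by
        have : (B.card : ℝ) ≤ n := by exact_mod_cast hBn
        nlinarith
      have hBA : B.card < A.card := by
        have : 2 * d * B.card < 2 * d * A.card := lt_of_le_of_lt hBN hA
        exact_mod_cast lt_of_mul_lt_mul_left this (by linarith)
      set H₀ : Config N → ℝ := fun σ => h σ + ∑ q ∈ Q.erase q, (t q : ℝ) / N * (b q * p q σ) with hH₀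
      set T : ℝ := (t q : ℝ) / N with hT
      have hT0 : 0 ≤ T := by positivity
      have hT1 : T ≤ 1 := by
        rw [hT, div_le_one hN]; exact_mod_cast ht q
      have hpe : ∀ σ, b q * N * (p q σ / N) = b q * p q σ := fun σ => by field_simp
      have hHT : H = fun σ => H₀ σ + T * (b q * N * (p q σ / N)) := by
        funext σ
        have := energy_update (h := h) (b := b) (p := p) hq t (t q) σ
        rw [Function.update_eq_self] at this
        rw [hH, this, hpe]
      have hKb : 2 * (K * b q) ≤ 1 / 100 := by
        have h1 := S.K_mul_le hq
        have h2 : K * b q ≤ K * (√(q : ℝ) ^ 3 * b q) := by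
          refine mul_le_mul_of_nonneg_left ?_ (by linarith)
          exact le_mul_of_one_le_left hb (one_le_pow₀ hd1)
        linarith
      have hgap : ∀ s, 0 ≤ s → s ≤ T → BlockGap B (fun σ => H₀ σ + s * (b q * N * (p q σ / N))) 2 := by
        intro s hs0 hsT
        -- The induction hypothesis covers only grid temperatures. Moving s to the grid point k/N
        -- changes the Hamiltonian by at most K b_q, so Holley–Stroock turns the constant 3/2 into
        -- 2.
        set k := ⌊s * N⌋₊ with hk
        have hk1 : (k : ℝ) ≤ s * N := Nat.floor_le (by positivity)
        have hk2 : s * N < k + 1 := Nat.lt_floor_add_one _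
        have hkN : k ≤ N := by
          have : (k : ℝ) ≤ N := by nlinarith
          exact_mod_cast this
        have h1 := ih B hBA (Function.update t q k) (by
          intro q'
          by_cases e : q' = q
          · rw [e, Function.update_self]; exact hkN
          · rw [Function.update_of_ne e]; exact ht q')
        have h2 := h1.perturb (H' := fun σ => H₀ σ + s * (b q * N * (p q σ / N))) (δ := K * b q)
          (by norm_num) (by
            intro σ
            rw [energy_update hq, hpe]
            have e : H₀ σ + s * (b q * p q σ) - (h σ + ∑ q ∈ Q.erase q, (t q : ℝ) / N *
              (b q * p q σ) + (k : ℝ) / N * (b q * p q σ)) = (s * N - k) * b q * (p q σ / N) := by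
              simp only [hH₀]; field_simp; ring
            rw [e, abs_mul, abs_mul, abs_of_nonneg hb, abs_of_nonneg (by linarith)]
            calc _ ≤ 1 * b q * K := by
                  gcongr
                  · linarith
                  · exact hE σ
              _ = _ := by ring)
        refine h2.mono ?_
        have : Real.exp (2 * (K * b q)) ≤ 4 / 3 := by
          have := exp_le_one_add_of_le (u := 2 * (K * b q)) (by positivity) (by linarith)
          nlinarith [show 0 ≤ 2 * (K * b q) by positivity]
        linarith
      have hR := (S.poly q hq).regularOn S.N_pos hK (by linarith [S.two_le q hq]) (S.cube_le q hq) hBN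
      have hmean : ∀ τ, condMean (fiber B τ) H (fun σ => |p q σ / N| *
          ((∑ k ∈ B, spinVar H k σ) / N)) ≤ 24 * K ^ 3 / d ^ 2 := by
        intro τ
        rw [hHT]
        refine hR.condMean_abs_mul_disorder_le hT0 hT1 hb ?_ hgap hdq.symm ?_
        · have := S.K_mul_le hq
          have h3 : 4 * b q * √(q : ℝ) ^ 3 * K = 4 * (K * (√(q : ℝ) ^ 3 * b q)) := by ring
          rw [h3]
          have : 0 ≤ K * (√(q : ℝ) ^ 3 * b q) := by positivity
          linarith
        · obtain ⟨σ, hσ, h4⟩ := S.second_moment q hq B hBN τ t ht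
          refine ⟨σ, hσ, ?_⟩
          have e : ∀ σ, (p q σ / N) ^ 2 = 1 / (N : ℝ) ^ 2 * p q σ ^ 2 := fun σ => by ring
          simp only [e]
          rw [condMean_const_mul, one_div_mul_eq_div, div_le_iff₀ (by positivity)]
          change _ ≤ K * (N + N ^ 2 * condMean (fiber B τ) H₀ _) at h4
          refine h4.trans (le_of_eq ?_)
          generalize condMean (fiber B τ) H₀ (fun σ' => overlap σ σ' ^ q) = r
          field_simp
      have hg2 : BlockGap B H 2 := by rw [hHT]; exact hgap T hT0 le_rfl
      have := sum_mul_sq_le hg2 (U := fun σ => |p q σ / N| * ((∑ k ∈ B, spinVar H k σ) / N))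
        (fun σ => mul_nonneg (abs_nonneg _) (hρ0 B σ)) (hUM B hBN) hmean F
      exact this
    have hsum := Finset.sum_le_sum hchunk
    rw [Finset.sum_add_distrib, Finset.sum_const, Finset.card_range, nsmul_eq_mul,
      ← Finset.mul_sum (Finset.range m), blockForm_sum_chunks H F A c hcm, Finset.sum_comm] at hsum
    have hl : ∀ σ, ∑ j ∈ Finset.range m, Real.exp (H σ) * (|p q σ / N| *
        ((∑ k ∈ A.filter (fun k => c k = j), spinVar H k σ) / N) * F σ ^ 2) =
        Real.exp (H σ) * (|p q σ / N| * ((∑ k ∈ A, spinVar H k σ) / N) * F σ ^ 2) := by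
      intro σ
      rw [← Finset.sum_fiberwise_of_maps_to (s := A) (t := Finset.range m) (g := c)
        (fun k _ => Finset.mem_range.2 (hcm k)) (fun k => spinVar H k σ), Finset.sum_div,
        Finset.mul_sum, Finset.sum_mul, Finset.mul_sum]
    simp only [hl] at hsum
    -- At most 5d chunks, each contributing 48K³/d². The Dirichlet forms of the chunks add up to
    -- that of A without loss.
    refine hsum.trans (add_le_add ?_ ?_)
    · rw [← mul_assoc]
      refine mul_le_mul_of_nonneg_right ?_ hI
      calc (m : ℝ) * (2 * (24 * K ^ 3 / d ^ 2)) ≤ 5 * d * (2 * (24 * K ^ 3 / d ^ 2)) := by gcongr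
        _ = _ := by field_simp; norm_num
    · refine mul_le_mul_of_nonneg_right ?_ (blockForm_nonneg _ _ _)
      calc 4 * (K / (2 * d)) = 2 * K / d := by field_simp; norm_num
        _ ≤ _ := by gcongr; norm_num

theorem coeff_le {q : ℕ} (hq : q ∈ Q) {t : ℕ → ℕ} (ht : ∀ q, t q ≤ N) :
    (t q : ℝ) / N * b q ≤ b q := by
  refine mul_le_of_le_one_left (S.b_nonneg q hq) ?_
  rw [div_le_one S.N_pos']; exact_mod_cast ht q

theorem grad_grad_energy (t : ℕ → ℕ) (i j : Fin N) (σ : Config N) :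
    grad i (grad j (energy N Q b p h t)) σ =
      ∑ q ∈ Q, (t q : ℝ) / N * b q * grad i (grad j (p q)) σ := by
  have e : grad j (energy N Q b p h t) =
      fun σ => grad j h σ + ∑ q ∈ Q, (t q : ℝ) / N * (b q * grad j (p q) σ) := by
    funext σ
    unfold energy
    rw [grad_add, grad_sum]
    congr 1
    exact Finset.sum_congr rfl fun q _ => by rw [grad_const_mul, grad_const_mul]
  rw [e, grad_add, grad_sum, S.hess_field, zero_add]
  exact Finset.sum_congr rfl fun q _ => by rw [grad_const_mul, grad_const_mul, mul_assoc]

/-- Cauchy–Schwarz over the degrees with weights q^{3/2} b_q reduces the claim to `PolyBound.row_le`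
for each degree; the 4 bounds √10. -/
theorem sum_grad_grad_energy_sq_le {t : ℕ → ℕ} (ht : ∀ q, t q ≤ N) (i : Fin N) (σ : Config N) :
    ∑ j, grad i (grad j (energy N Q b p h t)) σ ^ 2 ≤
      (4 * K * ∑ q ∈ Q, √(q : ℝ) ^ 3 * b q) ^ 2 := by
  have hN := S.N_pos'
  have hK := S.one_le_K
  set κ := ∑ q ∈ Q, √(q : ℝ) ^ 3 * b q with hκ
  have hκ0 : 0 ≤ κ := Finset.sum_nonneg fun q hq => mul_nonneg (by positivity) (S.b_nonneg q hq)
  have hs0 : ∀ q ∈ Q, 0 ≤ (t q : ℝ) / N * b q := fun q hq =>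
    mul_nonneg (by positivity) (S.b_nonneg q hq)
  have hd0 : ∀ q ∈ Q, 0 < √(q : ℝ) ^ 3 := fun q hq =>
    pow_pos (zero_lt_one.trans_le (S.one_le_sqrt hq)) 3
  have h1 : ∀ j, grad i (grad j (energy N Q b p h t)) σ ^ 2 ≤
      κ * ∑ q ∈ Q, b q / √(q : ℝ) ^ 3 * grad i (grad j (p q)) σ ^ 2 := by
    intro j
    rw [S.grad_grad_energy]
    refine (Finset.sum_sq_le_sum_mul_sum_of_sq_le_mul Q
      (f := fun q => √(q : ℝ) ^ 3 * ((t q : ℝ) / N * b q))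
      (g := fun q => ((t q : ℝ) / N * b q) / √(q : ℝ) ^ 3 * grad i (grad j (p q)) σ ^ 2)
      (fun q hq => mul_nonneg (hd0 q hq).le (hs0 q hq))
      (fun q hq => mul_nonneg (div_nonneg (hs0 q hq) (hd0 q hq).le) (sq_nonneg _))
      (fun q hq => le_of_eq (by
        have := (hd0 q hq).ne'
        generalize √(q : ℝ) ^ 3 = w at *
        field_simp))).trans ?_
    refine mul_le_mul ?_ ?_ ?_ hκ0
    · exact Finset.sum_le_sum fun q hq =>
        mul_le_mul_of_nonneg_left (S.coeff_le hq ht) (hd0 q hq).le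
    · exact Finset.sum_le_sum fun q hq => mul_le_mul_of_nonneg_right
        (div_le_div_of_nonneg_right (S.coeff_le hq ht) (hd0 q hq).le) (sq_nonneg _)
    · exact Finset.sum_nonneg fun q hq =>
        mul_nonneg (div_nonneg (hs0 q hq) (hd0 q hq).le) (sq_nonneg _)
  calc _ ≤ ∑ j, κ * ∑ q ∈ Q, b q / √(q : ℝ) ^ 3 * grad i (grad j (p q)) σ ^ 2 :=
        Finset.sum_le_sum fun j _ => h1 j
    _ = κ * ∑ q ∈ Q, b q / √(q : ℝ) ^ 3 * ∑ j, grad i (grad j (p q)) σ ^ 2 := by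
        rw [← Finset.mul_sum, Finset.sum_comm]
        simp only [Finset.mul_sum]
    _ ≤ κ * ∑ q ∈ Q, b q / √(q : ℝ) ^ 3 * (10 * K ^ 2 * q ^ 3) := by
        refine mul_le_mul_of_nonneg_left (Finset.sum_le_sum fun q hq => ?_) hκ0
        exact mul_le_mul_of_nonneg_left ((S.poly q hq).row_le S.N_pos
          (by linarith [S.two_le q hq]) (S.le_N hq) i σ)
          (div_nonneg (S.b_nonneg q hq) (hd0 q hq).le)
    _ = 10 * K ^ 2 * κ ^ 2 := by
        have e : ∑ q ∈ Q, b q / √(q : ℝ) ^ 3 * (10 * K ^ 2 * q ^ 3) = 10 * K ^ 2 * κ := by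
          rw [hκ, Finset.mul_sum]
          refine Finset.sum_congr rfl fun q hq => ?_
          have h2 : (q : ℝ) ^ 3 = √(q : ℝ) ^ 3 * √(q : ℝ) ^ 3 := by
            rw [← mul_pow, Real.mul_self_sqrt (by positivity)]
          have := (hd0 q hq).ne'
          rw [h2]
          generalize √(q : ℝ) ^ 3 = w at *
          field_simp
        rw [e]; ring
    _ ≤ _ := by nlinarith [sq_nonneg (K * κ)]

/-- `PolyBound.quad_le` is applied with x_k = v_k `grad k f`. Cauchy–Schwarz on the radial part
produces |p_q/N| Σ v_k/N times the squared scaled gradients, which `sum_abs_mul_le` bounds by order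
1/d; thus d⁴ improves to d³. -/
theorem sum_hess_le {q : ℕ} (hq : q ∈ Q) {A : Finset (Fin N)} {t : ℕ → ℕ} (ht : ∀ q, t q ≤ N)
    (ih : ∀ B : Finset (Fin N), B.card < A.card → ∀ t : ℕ → ℕ, (∀ q, t q ≤ N) →
      BlockGap B (energy N Q b p h t) (3 / 2)) {H : Config N → ℝ} (hH : H = energy N Q b p h t)
    (f : Config N → ℝ) {x : Config N → Fin N → ℝ}
    (hx : x = fun σ k => if k ∈ A then spinVar H k σ * grad k f σ else 0) :
    ∑ σ, Real.exp (H σ) * (∑ j, ∑ k, grad j (grad k (p q)) σ * x σ j * x σ k) ≤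
      √(q : ℝ) ^ 3 * (242 * K ^ 3 * blockForm H A f +
        10 * K * ∑ k ∈ A, blockForm H A (scaledGrad H f k)) := by
  have hN := S.N_pos'
  have hK := S.one_le_K
  have hKK : K ≤ K ^ 3 := by nlinarith [sq_nonneg K]
  set F := scaledGrad H f
  have hF2 : ∀ k σ, F k σ ^ 2 = spinVar H k σ * grad k f σ ^ 2 := scaledGrad_sq H f
  have hFD : ∑ k ∈ A, ∑ σ, Real.exp (H σ) * F k σ ^ 2 = blockForm H A f := by
    simp only [hF2]; rfl
  have hd1 := S.one_le_sqrt hq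
  have hdq := Real.sq_sqrt (show (0 : ℝ) ≤ q by positivity)
  set d := √(q : ℝ) with hd
  have h1 : ∀ σ, ∑ j, ∑ k, grad j (grad k (p q)) σ * x σ j * x σ k ≤
      ∑ k ∈ A, (2 * K * d ^ 3 * F k σ ^ 2 + d ^ 4 * (|p q σ / N| *
        ((∑ k ∈ A, spinVar H k σ) / N) * F k σ ^ 2)) := by
    intro σ
    refine ((S.poly q hq).quad_le S.N_pos (by linarith) (by linarith [S.two_le q hq]) σ (x σ)).trans ?_
    rw [Finset.sum_add_distrib, ← Finset.mul_sum, ← Finset.mul_sum, ← Finset.mul_sum]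
    have e1 : ∑ k, x σ k ^ 2 ≤ ∑ k ∈ A, F k σ ^ 2 := by
      simp only [hx, ite_pow, ne_eq, OfNat.ofNat_ne_zero, not_false_eq_true, zero_pow,
        Finset.sum_ite_mem, Finset.univ_inter]
      refine Finset.sum_le_sum fun k _ => ?_
      rw [hF2]
      have v := spinVar_pos H k σ
      have v1 := spinVar_le_one H k σ
      nlinarith [mul_nonneg (mul_nonneg v.le (sub_nonneg.2 v1)) (sq_nonneg (grad k f σ))]
    have e2 : (∑ k, x σ k * spin σ k) ^ 2 ≤ (∑ k ∈ A, spinVar H k σ) * ∑ k ∈ A, F k σ ^ 2 := by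
      simp only [hx, ite_mul, zero_mul, Finset.sum_ite_mem, Finset.univ_inter]
      refine Finset.sum_sq_le_sum_mul_sum_of_sq_le_mul A
        (fun k _ => (spinVar_pos H k σ).le) (fun k _ => sq_nonneg _) fun k _ => ?_
      rw [hF2, mul_pow, spin_sq]; exact le_of_eq (by ring)
    refine add_le_add ?_ ?_
    · gcongr
    · calc (q : ℝ) ^ 2 * |p q σ / N| * ((∑ k, x σ k * spin σ k) ^ 2 / N)
          ≤ (q : ℝ) ^ 2 * |p q σ / N| * (((∑ k ∈ A, spinVar H k σ) * ∑ k ∈ A, F k σ ^ 2) / N) := by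
            gcongr
        _ = _ := by rw [← hdq]; ring
  have h2 : ∀ k ∈ A, ∑ σ, Real.exp (H σ) * (2 * K * d ^ 3 * F k σ ^ 2 + d ^ 4 * (|p q σ / N| *
        ((∑ k ∈ A, spinVar H k σ) / N) * F k σ ^ 2)) ≤ d ^ 3 * (242 * K ^ 3 *
        (∑ σ, Real.exp (H σ) * F k σ ^ 2) + 10 * K * blockForm H A (F k)) := by
    intro k _
    have h3 := S.sum_abs_mul_le hq ht ih (F k)
    rw [← hH] at h3
    have h4 := mul_le_mul_of_nonneg_left h3 (show 0 ≤ d ^ 4 by positivity)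
    have h5 : 0 ≤ ∑ σ, Real.exp (H σ) * F k σ ^ 2 :=
      Finset.sum_nonneg fun σ _ => mul_nonneg (Real.exp_pos _).le (sq_nonneg _)
    have e1 : ∑ σ, Real.exp (H σ) * (2 * K * d ^ 3 * F k σ ^ 2 + d ^ 4 * (|p q σ / N| *
        ((∑ k ∈ A, spinVar H k σ) / N) * F k σ ^ 2)) = 2 * K * d ^ 3 *
        (∑ σ, Real.exp (H σ) * F k σ ^ 2) + d ^ 4 * ∑ σ, Real.exp (H σ) * (|p q σ / N| *
        ((∑ k ∈ A, spinVar H k σ) / N) * F k σ ^ 2) := by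
      rw [Finset.mul_sum, Finset.mul_sum, ← Finset.sum_add_distrib]
      exact Finset.sum_congr rfl fun σ _ => by ring
    have e2 : d ^ 4 * (240 * K ^ 3 / d * (∑ σ, Real.exp (H σ) * F k σ ^ 2) +
        10 * K / d * blockForm H A (F k)) = d ^ 3 * (240 * K ^ 3 *
        (∑ σ, Real.exp (H σ) * F k σ ^ 2) + 10 * K * blockForm H A (F k)) := by
      field_simp
    rw [e1]
    rw [e2] at h4
    have h6 := mul_le_mul_of_nonneg_right hKK (mul_nonneg (show 0 ≤ d ^ 3 by positivity) h5)
    linarith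
  calc _ ≤ ∑ σ, Real.exp (H σ) * ∑ k ∈ A, (2 * K * d ^ 3 * F k σ ^ 2 + d ^ 4 * (|p q σ / N| *
        ((∑ k ∈ A, spinVar H k σ) / N) * F k σ ^ 2)) :=
        Finset.sum_le_sum fun σ _ => mul_le_mul_of_nonneg_left (h1 σ) (Real.exp_pos _).le
    _ = ∑ k ∈ A, ∑ σ, Real.exp (H σ) * (2 * K * d ^ 3 * F k σ ^ 2 + d ^ 4 * (|p q σ / N| *
        ((∑ k ∈ A, spinVar H k σ) / N) * F k σ ^ 2)) := by
        simp only [Finset.mul_sum]; exact Finset.sum_comm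
    _ ≤ ∑ k ∈ A, d ^ 3 * (242 * K ^ 3 * (∑ σ, Real.exp (H σ) * F k σ ^ 2) +
        10 * K * blockForm H A (F k)) := Finset.sum_le_sum h2
    _ = d ^ 3 * (242 * K ^ 3 * blockForm H A f + 10 * K * ∑ k ∈ A, blockForm H A (F k)) := by
        rw [← Finset.mul_sum, Finset.sum_add_distrib, ← Finset.mul_sum, ← Finset.mul_sum, hFD]

theorem sum_quad_le {A : Finset (Fin N)} {t : ℕ → ℕ} (ht : ∀ q, t q ≤ N) {H : Config N → ℝ}
    (hH : H = energy N Q b p h t) (f : Config N → ℝ) {x : Config N → Fin N → ℝ}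
    (hx : x = fun σ k => if k ∈ A then spinVar H k σ * grad k f σ else 0) {M : ℝ} (hM : 0 ≤ M)
    (hX : ∀ q ∈ Q, ∑ σ, Real.exp (H σ) *
      (∑ j, ∑ k, grad j (grad k (p q)) σ * x σ j * x σ k) ≤ √(q : ℝ) ^ 3 * M) :
    ∑ σ, Real.exp (H σ) * (∑ i ∈ A, ∑ j ∈ A, grad i (grad j H) σ *
      (spinVar H i σ * grad i f σ) * (spinVar H j σ * grad j f σ)) ≤
        (∑ q ∈ Q, √(q : ℝ) ^ 3 * b q) * M := by
  have e1 : ∀ σ, ∑ i ∈ A, ∑ j ∈ A, grad i (grad j H) σ *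
      (spinVar H i σ * grad i f σ) * (spinVar H j σ * grad j f σ) =
      ∑ q ∈ Q, (t q : ℝ) / N * b q * ∑ j, ∑ k, grad j (grad k (p q)) σ * x σ j * x σ k := by
    intro σ
    have e2 : ∑ i ∈ A, ∑ j ∈ A, grad i (grad j H) σ *
      (spinVar H i σ * grad i f σ) * (spinVar H j σ * grad j f σ) =
        ∑ i, ∑ j, grad i (grad j H) σ * x σ i * x σ j := by
      simp only [hx, mul_ite, mul_zero, ite_mul, zero_mul, Finset.sum_ite_mem, Finset.univ_inter,
        Finset.sum_ite_irrel, Finset.sum_const_zero]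
    rw [e2]
    symm
    simp only [Finset.mul_sum]
    rw [Finset.sum_comm]
    refine Finset.sum_congr rfl fun i _ => ?_
    rw [Finset.sum_comm]
    refine Finset.sum_congr rfl fun j _ => ?_
    rw [hH, S.grad_grad_energy, Finset.sum_mul, Finset.sum_mul]
    exact Finset.sum_congr rfl fun q _ => by ring
  simp only [e1, Finset.mul_sum Q]
  rw [Finset.sum_comm, Finset.sum_mul]
  refine Finset.sum_le_sum fun q hq => ?_
  have e3 : ∑ σ, Real.exp (H σ) * ((t q : ℝ) / N * b q *
      ∑ j, ∑ k, grad j (grad k (p q)) σ * x σ j * x σ k) = (t q : ℝ) / N * b q *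
      ∑ σ, Real.exp (H σ) * ∑ j, ∑ k, grad j (grad k (p q)) σ * x σ j * x σ k := by
    rw [Finset.mul_sum]
    exact Finset.sum_congr rfl fun σ _ => by ring
  rw [e3]
  calc _ ≤ (t q : ℝ) / N * b q * (√(q : ℝ) ^ 3 * M) :=
        mul_le_mul_of_nonneg_left (hX q hq) (mul_nonneg (by positivity) (S.b_nonneg q hq))
    _ ≤ b q * (√(q : ℝ) ^ 3 * M) :=
        mul_le_mul_of_nonneg_right (S.coeff_le hq ht) (mul_nonneg (by positivity) hM)
    _ = _ := by ring

/-- The spectral gap of a regular system, uniformly over all blocks of spins. -/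
theorem blockGap (A : Finset (Fin N)) {t : ℕ → ℕ} (ht : ∀ q, t q ≤ N) :
    BlockGap A (energy N Q b p h t) (1 - 303 * K ^ 3 * ∑ q ∈ Q, √(q : ℝ) ^ 3 * b q)⁻¹ := by
  induction hc : A.card using Nat.strong_induction_on generalizing A t with
  | _ c ih =>
  have hN := S.N_pos'
  have hK := S.one_le_K
  have hsm := S.small
  set κ := ∑ q ∈ Q, √(q : ℝ) ^ 3 * b q with hκ
  have hκ0 : 0 ≤ κ := Finset.sum_nonneg fun q hq => mul_nonneg (by positivity) (S.b_nonneg q hq)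
  have hKK : K ≤ K ^ 3 := by nlinarith [sq_nonneg K]
  have hKκ : K * κ ≤ K ^ 3 * κ := mul_le_mul_of_nonneg_right hKK hκ0
  have hKκ0 : 0 ≤ K * κ := by positivity
  have hlam : 2 / 3 ≤ 1 - 303 * K ^ 3 * κ := by linarith
  -- The gap constant depends only on K and κ and is at most 3/2, so it does not deteriorate along
  -- the induction.
  have ih' : ∀ B : Finset (Fin N), B.card < A.card → ∀ t : ℕ → ℕ, (∀ q, t q ≤ N) →
      BlockGap B (energy N Q b p h t) (3 / 2) := by
    intro B hB t ht
    refine (ih B.card (hc ▸ hB) B ht rfl).mono ?_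
    calc _ ≤ ((2 : ℝ) / 3)⁻¹ := inv_anti₀ (by norm_num) hlam
      _ = _ := by norm_num
  set H := energy N Q b p h t with hH
  refine blockGap_of_generator (by linarith) fun f => ?_
  have hrow := fun i σ => S.sum_grad_grad_energy_sq_le ht i σ
  have hr8 : 4 * K * κ ≤ 1 / 8 := by linarith
  have hB := bochner H A (r := 4 * K * κ) (by positivity) hr8 hrow f
  set D := blockForm H A f with hD
  have hD0 : 0 ≤ D := blockForm_nonneg _ _ _
  set Γ := ∑ i ∈ A, ∑ j ∈ A, ∑ σ, Real.exp (H σ) *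
        (spinVar H i σ * spinVar H j σ * grad i (grad j f) σ ^ 2) with hΓ
  have hΓ0 : 0 ≤ Γ := Finset.sum_nonneg fun i _ => Finset.sum_nonneg fun j _ =>
    Finset.sum_nonneg fun σ _ => mul_nonneg (Real.exp_pos _).le (mul_nonneg
      (mul_nonneg (spinVar_pos H i σ).le (spinVar_pos H j σ).le) (sq_nonneg _))
  have hFF := sum_blockForm_scaledGrad_le H A (r := 4 * K * κ) (by positivity) hr8 hrow f
  rw [← hD, ← hΓ] at hFF
  set x : Config N → Fin N → ℝ := fun σ k => if k ∈ A then spinVar H k σ * grad k f σ else 0 with hx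
  have hX : ∀ q ∈ Q, ∑ σ, Real.exp (H σ) * (∑ j, ∑ k, grad j (grad k (p q)) σ * x σ j * x σ k) ≤
      √(q : ℝ) ^ 3 * (242 * K ^ 3 * D + 10 * K * (4 * Γ + D)) := by
    intro q hq
    refine (S.sum_hess_le hq ht ih' hH f hx).trans ?_
    gcongr
  have hM0 : 0 ≤ 242 * K ^ 3 * D + 10 * K * (4 * Γ + D) := by positivity
  have hquad := S.sum_quad_le ht hH f hx hM0 hX
  exact gap_arithmetic hK hκ0 hsm hD0 hΓ0 hB hquad

end RegularSystem

/-! ### Tails of Gaussian quadratic forms -/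

theorem gaussian_exp_sq_aux (a x : ℝ) : gaussianPDFReal 0 1 x • Real.exp (a * x ^ 2) =
    (√(2 * Real.pi))⁻¹ * Real.exp (-(1 / 2 - a) * x ^ 2) := by
  simp only [gaussianPDFReal, NNReal.coe_one, mul_one, sub_zero, smul_eq_mul]
  rw [mul_assoc, ← Real.exp_add]
  congr 2; ring

theorem integrable_exp_sq {a : ℝ} (ha : a < 1 / 2) :
    Integrable (fun x => Real.exp (a * x ^ 2)) (gaussianReal 0 1) := by
  rw [gaussianReal_of_var_ne_zero 0 one_ne_zero, integrable_withDensity_iff_integrable_smul' (measurable_gaussianPDF 0 1)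
      (by simp [gaussianPDF])]
  have : ∀ x, (gaussianPDF 0 1 x).toReal • Real.exp (a * x ^ 2) =
      (√(2 * Real.pi))⁻¹ * Real.exp (-(1 / 2 - a) * x ^ 2) := by
    intro x
    rw [gaussianPDF, ENNReal.toReal_ofReal (gaussianPDFReal_nonneg _ _ _), gaussian_exp_sq_aux]
  simp only [this]
  exact (integrable_exp_neg_mul_sq (by linarith)).const_mul _

/-- The integral is (1 − 2a)^{-1/2}, and (1 − 2a)e^{4a} ≥ (1 − 2a)(1 + 4a) ≥ 1 for 0 ≤ a ≤ 1/4. -/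
theorem integral_exp_sq_le {a : ℝ} (h0 : 0 ≤ a) (ha : a ≤ 1 / 4) :
    ∫ x, Real.exp (a * x ^ 2) ∂(gaussianReal 0 1) ≤ Real.exp (2 * a) := by
  rw [integral_gaussianReal_eq_integral_smul one_ne_zero]
  simp only [gaussian_exp_sq_aux]
  rw [integral_const_mul, integral_gaussian, ← Real.sqrt_inv, ← Real.sqrt_mul (by positivity)]
  have e : (2 * Real.pi)⁻¹ * (Real.pi / (1 / 2 - a)) = 1 / (1 - 2 * a) := by
    have := Real.pi_pos
    have h1 : 1 - 2 * a ≠ 0 := by linarith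
    have h2 : 1 / 2 - a ≠ 0 := by linarith
    field_simp
  rw [e]
  refine Real.sqrt_le_left (Real.exp_pos _).le |>.2 ?_ |> fun h => h
  rw [← Real.exp_nat_mul, div_le_iff₀ (by linarith)]
  have := Real.add_one_le_exp ((2 : ℕ) * (2 * a))
  push_cast at this ⊢
  nlinarith

/-- Chernoff's bound with parameter 1/(4s), for which every exponent is at most 1/4. -/
theorem sum_sq_tail {n : ℕ} {l : Fin n → ℝ} {s t u : ℝ} (hs : 0 < s) (h0 : ∀ i, 0 ≤ l i)
    (h1 : ∀ i, l i ≤ s) (ht : ∑ i, l i ≤ t) :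
    Measure.pi (fun _ : Fin n => gaussianReal 0 1) {z | 2 * t + 4 * u * s ≤ ∑ i, l i * z i ^ 2} ≤
      ENNReal.ofReal (Real.exp (-u)) := by
  set μ := Measure.pi (fun _ : Fin n => gaussianReal 0 1)
  have ha : ∀ i, l i / (4 * s) ≤ 1 / 4 := fun i => by
    rw [div_le_iff₀ (by positivity)]; linarith [h1 i]
  have ha0 : ∀ i, 0 ≤ l i / (4 * s) := fun i => div_nonneg (h0 i) (by positivity)
  have he : ∀ z : Fin n → ℝ, Real.exp (1 / (4 * s) * ∑ i, l i * z i ^ 2) =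
      ∏ i, Real.exp (l i / (4 * s) * z i ^ 2) := by
    intro z
    rw [← Real.exp_sum, Finset.mul_sum]
    congr 1
    exact Finset.sum_congr rfl fun i _ => by ring
  have hint : Integrable (fun z : Fin n → ℝ => Real.exp (1 / (4 * s) * ∑ i, l i * z i ^ 2)) μ := by
    simp only [he]
    exact Integrable.fintype_prod (f := fun i x => Real.exp (l i / (4 * s) * x ^ 2)) fun i =>
      integrable_exp_sq (by linarith [ha i])
  have hmgf : mgf (fun z : Fin n → ℝ => ∑ i, l i * z i ^ 2) μ (1 / (4 * s)) ≤
      Real.exp (t / (2 * s)) := by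
    rw [mgf]
    simp only [he]
    rw [integral_fintype_prod_eq_prod (f := fun i x => Real.exp (l i / (4 * s) * x ^ 2))]
    calc _ ≤ ∏ i, Real.exp (2 * (l i / (4 * s))) :=
          Finset.prod_le_prod (fun i _ => integral_nonneg fun x => (Real.exp_pos _).le)
            fun i _ => integral_exp_sq_le (ha0 i) (ha i)
      _ = Real.exp ((∑ i, l i) / (2 * s)) := by
          rw [← Real.exp_sum, Finset.sum_div]
          congr 1
          exact Finset.sum_congr rfl fun i _ => by ring
      _ ≤ _ := by gcongr
  have hmain := measure_ge_le_exp_mul_mgf (X := fun z : Fin n → ℝ => ∑ i, l i * z i ^ 2)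
    (μ := μ) (2 * t + 4 * u * s) (t := 1 / (4 * s)) (by positivity) hint
  rw [measureReal_def] at hmain
  rw [← ENNReal.ofReal_toReal (measure_ne_top μ _)]
  refine ENNReal.ofReal_le_ofReal (hmain.trans ?_)
  calc _ ≤ Real.exp (-(1 / (4 * s)) * (2 * t + 4 * u * s)) * Real.exp (t / (2 * s)) := by gcongr
    _ = Real.exp (-u) := by
      rw [← Real.exp_add]; congr 1; field_simp; ring

open scoped InnerProductSpace in
/-- An exponential tail bound for a positive quadratic form in independent standard Gaussians. -/
theorem gaussian_quadratic_tail {ι κ : Type*} [Fintype ι] [Fintype κ] (c : κ → ι → ℝ)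
    {s t u : ℝ} (hs : 0 < s) (hdual : ∀ y : κ → ℝ, ∑ i, (∑ a, y a * c a i) ^ 2 ≤ s * ∑ a, y a ^ 2)
    (htr : ∑ a, ∑ i, c a i ^ 2 ≤ t) :
    Measure.pi (fun _ : ι => gaussianReal 0 1)
      {x | 2 * t + 4 * u * s ≤ ∑ a, (∑ i, c a i * x i) ^ 2} ≤ ENNReal.ofReal (Real.exp (-u)) := by
  let C : κ → EuclideanSpace ℝ ι := fun a => WithLp.toLp 2 (c a)
  have hC : ∀ a (x : EuclideanSpace ℝ ι), ⟪C a, x⟫_ℝ = ∑ i, c a i * x i := by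
    intro a x
    rw [PiLp.inner_apply]
    exact Finset.sum_congr rfl fun i _ => by simp [C, mul_comm]
  let T : EuclideanSpace ℝ ι →ₗ[ℝ] EuclideanSpace ℝ ι :=
    ∑ a, ((innerₛₗ ℝ (C a)).smulRight (C a))
  have hTa : ∀ x, T x = ∑ a, ⟪C a, x⟫_ℝ • C a := by
    intro x; simp [T, LinearMap.sum_apply]
  have hTi : ∀ x y, ⟪x, T y⟫_ℝ = ∑ a, ⟪C a, x⟫_ℝ * ⟪C a, y⟫_ℝ := by
    intro x y
    rw [hTa, inner_sum]
    refine Finset.sum_congr rfl fun a _ => ?_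
    rw [real_inner_smul_right, real_inner_comm (C a) x, mul_comm]
  have hT : T.IsSymmetric := by
    intro x y
    rw [real_inner_comm, hTi, hTi]
    exact Finset.sum_congr rfl fun a _ => mul_comm _ _
  -- The hypothesis `hdual` bounds the transpose of the map x ↦ (⟪C a, x⟫)_a; the map itself has the
  -- same norm.
  have hle : ∀ x, ⟪x, T x⟫_ℝ ≤ s * ‖x‖ ^ 2 := by
    intro x
    set y : κ → ℝ := fun a => ⟪C a, x⟫_ℝ
    have hY : ⟪x, T x⟫_ℝ = ∑ a, y a ^ 2 := by
      rw [hTi]; exact Finset.sum_congr rfl fun a _ => (sq _).symm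
    have hn : ‖T x‖ ^ 2 ≤ s * ∑ a, y a ^ 2 := by
      rw [EuclideanSpace.norm_sq_eq]
      refine le_of_eq_of_le ?_ (hdual y)
      refine Finset.sum_congr rfl fun i _ => ?_
      rw [Real.norm_eq_abs, sq_abs, hTa]
      congr 1
      simp [C, y]
    have h1 := real_inner_le_norm x (T x)
    rw [hY] at h1 ⊢
    have h0 : 0 ≤ ∑ a, y a ^ 2 := Finset.sum_nonneg fun a _ => sq_nonneg _
    have h2 : (∑ a, y a ^ 2) ^ 2 ≤ ‖x‖ ^ 2 * (s * ∑ a, y a ^ 2) := by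
      calc _ ≤ (‖x‖ * ‖T x‖) ^ 2 := by gcongr
        _ = ‖x‖ ^ 2 * ‖T x‖ ^ 2 := by ring
        _ ≤ _ := by gcongr
    rcases h0.eq_or_lt with h3 | h3
    · rw [← h3]; positivity
    · refine le_of_mul_le_mul_right ?_ h3
      nlinarith
  set b := hT.eigenvectorBasis rfl
  set l := hT.eigenvalues rfl
  have hl : ∀ i, l i = ∑ a, ⟪C a, b i⟫_ℝ ^ 2 := by
    intro i
    have h1 : ⟪b i, T (b i)⟫_ℝ = l i := by
      rw [hT.apply_eigenvectorBasis rfl i]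
      rw [inner_smul_right, real_inner_self_eq_norm_sq, b.norm_eq_one]
      simp [l]
    rw [← h1, hTi]
    exact Finset.sum_congr rfl fun a _ => (sq _).symm
  have hl0 : ∀ i, 0 ≤ l i := fun i => by
    rw [hl]; exact Finset.sum_nonneg fun a _ => sq_nonneg _
  have hls : ∀ i, l i ≤ s := fun i => by
    have h1 := hle (b i)
    rw [hTi, b.norm_eq_one] at h1
    rw [hl]
    simpa [sq] using h1
  have hlt : ∑ i, l i ≤ t := by
    simp only [hl]
    rw [Finset.sum_comm]
    refine le_of_eq_of_le (Finset.sum_congr rfl fun a _ => ?_) htr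
    have := b.sum_sq_norm_inner_left (C a)
    simp only [Real.norm_eq_abs, sq_abs] at this
    rw [this, EuclideanSpace.norm_sq_eq]
    simp [C]
  have hquad : ∀ z : Fin (Module.finrank ℝ (EuclideanSpace ℝ ι)) → ℝ, ∑ a, (∑ i, c a i * (∑ j, z j • b j : EuclideanSpace ℝ ι) i) ^ 2 =
      ∑ j, l j * z j ^ 2 := by
    intro z
    set x : EuclideanSpace ℝ ι := ∑ j, z j • b j
    have h1 : ∑ a, (∑ i, c a i * x i) ^ 2 = ⟪x, T x⟫_ℝ := by
      rw [hTi]; exact Finset.sum_congr rfl fun a _ => by rw [hC, sq]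
    have h2 : T x = ∑ j, (z j * l j) • b j := by
      simp only [x, map_sum, map_smul]
      refine Finset.sum_congr rfl fun j _ => ?_
      rw [hT.apply_eigenvectorBasis rfl j, smul_smul]
      rfl
    rw [h1, h2, b.orthonormal.inner_sum]
    exact Finset.sum_congr rfl fun j _ => by simp; ring
  have hmeas : MeasurableSet {x : EuclideanSpace ℝ ι | 2 * t + 4 * u * s ≤
      ∑ a, (∑ i, c a i * x i) ^ 2} :=
    measurableSet_le measurable_const (by fun_prop)
  have e1 : Measure.pi (fun _ : ι => gaussianReal 0 1)
      {x | 2 * t + 4 * u * s ≤ ∑ a, (∑ i, c a i * x i) ^ 2} =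
      stdGaussian (EuclideanSpace ℝ ι) {x : EuclideanSpace ℝ ι | 2 * t + 4 * u * s ≤
      ∑ a, (∑ i, c a i * x i) ^ 2} := by
    rw [← map_pi_eq_stdGaussian, Measure.map_apply (by fun_prop) hmeas]
    rfl
  -- By rotation invariance the coordinates in an eigenbasis of T are again independent standard
  -- Gaussians, so the form becomes diagonal.
  rw [e1, stdGaussian_eq_map_pi_orthonormalBasis b, Measure.map_apply (by fun_prop) hmeas]
  refine le_trans (measure_mono ?_) (sum_sq_tail (u := u) hs hl0 hls hlt)
  intro z hz
  simp only [Set.mem_preimage, Set.mem_ofPred_eq] at hz ⊢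
  rwa [hquad] at hz

/-! ### Monomials and spin polynomials -/

/-- The monomial attached to a tuple of sites. -/
def monomial {q : ℕ} (i : Fin q → Fin N) (σ : Config N) : ℝ := ∏ k, spin σ (i k)

theorem monomial_sq {q : ℕ} (i : Fin q → Fin N) (σ : Config N) : monomial i σ ^ 2 = 1 := by
  rw [monomial, ← Finset.prod_pow]
  exact Finset.prod_eq_one fun k _ => spin_sq σ (i k)

/-- The number of times a site occurs in a tuple. -/
def occ {q : ℕ} (i : Fin q → Fin N) (k : Fin N) : ℝ := ∑ a, if i a = k then 1 else 0

theorem sum_mul_occ {q : ℕ} (i : Fin q → Fin N) (x : Fin N → ℝ) :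
    ∑ k, x k * occ i k = ∑ a, x (i a) := by
  simp only [occ, Finset.mul_sum, mul_ite, mul_one, mul_zero]
  rw [Finset.sum_comm]
  simp

theorem occ_eq_or {q : ℕ} {i : Fin q → Fin N} (hi : Function.Injective i) (k : Fin N)
    (σ : Config N) : occ i k = 0 ∧ monomial i (flip k σ) = monomial i σ ∨
      occ i k = 1 ∧ monomial i (flip k σ) = -monomial i σ := by
  by_cases h : ∃ a, i a = k
  · obtain ⟨a, rfl⟩ := h
    right
    constructor
    · simp [occ, hi.eq_iff]
    · simp only [monomial]
      rw [← Finset.mul_prod_erase _ _ (Finset.mem_univ a),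
        ← Finset.mul_prod_erase _ (fun k => spin σ (i k)) (Finset.mem_univ a), spin_flip_self,
        neg_mul]
      congr 2
      exact Finset.prod_congr rfl fun b hb =>
        spin_flip_ne (hi.ne (Finset.ne_of_mem_erase hb)) σ
  · push Not at h
    left
    constructor
    · simp [occ, h]
    · exact Finset.prod_congr rfl fun b _ => spin_flip_ne (h b) σ

theorem occ_sq {q : ℕ} {i : Fin q → Fin N} (hi : Function.Injective i) (k : Fin N) :
    occ i k * occ i k = occ i k := by
  rcases occ_eq_or hi k (1 : Config N) with h | h <;> rw [h.1] <;> norm_num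

theorem grad_monomial {q : ℕ} {i : Fin q → Fin N} (hi : Function.Injective i) (k : Fin N)
    (σ : Config N) : grad k (monomial i) σ = occ i k * (spin σ k * monomial i σ) := by
  rcases occ_eq_or hi k σ with h | h <;> rw [grad, h.1, h.2] <;> ring

theorem grad_grad_monomial {q : ℕ} {i : Fin q → Fin N} (hi : Function.Injective i) (j k : Fin N)
    (σ : Config N) : grad j (grad k (monomial i)) σ =
      if j = k then 0 else occ i j * occ i k * (spin σ j * spin σ k * monomial i σ) := by
  split_ifs with h
  · rw [h, grad_grad_self]
  · have e : grad k (monomial i) = fun σ => (monomial i σ * (occ i k * spin σ k)) := by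
      funext σ; rw [grad_monomial hi]; ring
    rw [e, grad_mul_of_invariant (fun σ => by rw [spin_flip_ne (Ne.symm h)]), grad_monomial hi]
    ring

theorem sum_mul_grad_monomial {q : ℕ} {i : Fin q → Fin N} (hi : Function.Injective i)
    (x : Fin N → ℝ) (σ : Config N) :
    ∑ k, x k * grad k (monomial i) σ = (∑ a, x (i a) * spin σ (i a)) * monomial i σ := by
  rw [← sum_mul_occ i fun k => x k * spin σ k, Finset.sum_mul]
  exact Finset.sum_congr rfl fun k _ => by rw [grad_monomial hi]; ring

/-- A monomial with distinct sites is multilinear, so no site is differentiated twice; hence x at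
the site of a is subtracted from the inner sum. -/
theorem sum_mul_grad_grad_monomial {q : ℕ} {i : Fin q → Fin N} (hi : Function.Injective i)
    (y x : Fin N → ℝ) (σ : Config N) :
    ∑ j, y j * ∑ k, x k * grad j (grad k (monomial i)) σ =
      (∑ a, y (i a) * spin σ (i a) * ((∑ b, x (i b) * spin σ (i b)) -
        x (i a) * spin σ (i a))) * monomial i σ := by
  have h1 : ∀ j, ∑ k, x k * grad j (grad k (monomial i)) σ = occ i j * (spin σ j * monomial i σ *
      ((∑ b, x (i b) * spin σ (i b)) - x j * spin σ j)) := by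
    intro j
    have h2 : ∀ k, x k * grad j (grad k (monomial i)) σ =
        occ i j * (spin σ j * monomial i σ) * (x k * spin σ k * occ i k) -
          if j = k then occ i j * (spin σ j * monomial i σ) * (x k * spin σ k) else 0 := by
      intro k
      rw [grad_grad_monomial hi]
      split_ifs with h
      · subst h
        have := occ_sq hi j
        linear_combination -(spin σ j * monomial i σ * (x j * spin σ j)) * this
      · ring
    simp only [h2, Finset.sum_sub_distrib, ← Finset.mul_sum, Finset.sum_ite_eq, Finset.mem_univ,
      if_true]
    rw [sum_mul_occ i fun k => x k * spin σ k]
    ring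
  rw [← sum_mul_occ i fun k => y k * spin σ k * ((∑ b, x (i b) * spin σ (i b)) - x k * spin σ k),
    Finset.sum_mul]
  exact Finset.sum_congr rfl fun j _ => by rw [h1]; ring

/-- The normalization of the `q`-spin Hamiltonian. -/
def scale (N q : ℕ) : ℝ := ((N : ℝ) ^ (((q : ℝ) - 1) / 2))⁻¹

theorem scale_sq (hN : 0 < N) (q : ℕ) : scale N q ^ 2 * N ^ q = N := by
  have hN' : (0 : ℝ) < N := by exact_mod_cast hN
  have h : ((N : ℝ) ^ (((q : ℝ) - 1) / 2)) ^ 2 * N = N ^ q := by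
    rw [← Real.rpow_natCast, ← Real.rpow_mul hN'.le]
    nth_rewrite 2 [← Real.rpow_one (N : ℝ)]
    rw [← Real.rpow_add hN', ← Real.rpow_natCast]
    congr 1; push_cast; ring
  have h0 : (N : ℝ) ^ (((q : ℝ) - 1) / 2) ≠ 0 := (Real.rpow_pos_of_pos hN' _).ne'
  rw [scale, ← h]
  field_simp

/-- The `q`-spin polynomial with coefficients `u`. -/
def spinPoly (q : ℕ) (u : (Fin q → Fin N) → ℝ) (σ : Config N) : ℝ :=
  scale N q * ∑ i, u i * monomial i σ

section

variable {q : ℕ} {u : (Fin q → Fin N) → ℝ} (hu : ∀ i, ¬ Function.Injective i → u i = 0)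

theorem grad_spinPoly (u : (Fin q → Fin N) → ℝ) (k : Fin N) :
    grad k (spinPoly q u) = fun σ => scale N q * ∑ i, u i * grad k (monomial i) σ := by
  funext σ
  unfold spinPoly
  rw [grad_const_mul, grad_sum]
  simp only [grad_const_mul]

include hu

theorem sum_mul_grad_spinPoly (x : Fin N → ℝ) (σ : Config N) :
    ∑ k, x k * grad k (spinPoly q u) σ =
      ∑ i, scale N q * (∑ a, x (i a) * spin σ (i a)) * monomial i σ * u i := by
  have h : ∀ k, x k * grad k (spinPoly q u) σ =
      ∑ i, scale N q * u i * (x k * grad k (monomial i) σ) := by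
    intro k
    simp only [grad_spinPoly]
    rw [Finset.mul_sum, Finset.mul_sum]
    exact Finset.sum_congr rfl fun i _ => by ring
  simp only [h]
  rw [Finset.sum_comm]
  refine Finset.sum_congr rfl fun i _ => ?_
  rw [← Finset.mul_sum]
  by_cases hi : Function.Injective i
  · rw [sum_mul_grad_monomial hi]; ring
  · rw [hu i hi]; ring

theorem sum_mul_grad_grad_spinPoly (y x : Fin N → ℝ) (σ : Config N) :
    ∑ j, y j * ∑ k, x k * grad j (grad k (spinPoly q u)) σ =
      ∑ i, scale N q * (∑ a, y (i a) * spin σ (i a) * ((∑ b, x (i b) * spin σ (i b)) -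
        x (i a) * spin σ (i a))) * monomial i σ * u i := by
  have h : ∀ j, y j * ∑ k, x k * grad j (grad k (spinPoly q u)) σ =
      ∑ i, scale N q * u i * (y j * ∑ k, x k * grad j (grad k (monomial i)) σ) := by
    intro j
    have h1 : ∀ k, x k * grad j (grad k (spinPoly q u)) σ =
        ∑ i, scale N q * u i * (x k * grad j (grad k (monomial i)) σ) := by
      intro k
      rw [grad_spinPoly, grad_const_mul, grad_sum]
      simp only [grad_const_mul]
      rw [Finset.mul_sum, Finset.mul_sum]
      exact Finset.sum_congr rfl fun i _ => by ring
    simp only [h1]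
    rw [Finset.sum_comm, Finset.mul_sum]
    refine Finset.sum_congr rfl fun i _ => ?_
    rw [← Finset.mul_sum]; ring
  simp only [h]
  rw [Finset.sum_comm]
  refine Finset.sum_congr rfl fun i _ => ?_
  rw [← Finset.mul_sum]
  by_cases hi : Function.Injective i
  · rw [sum_mul_grad_grad_monomial hi]; ring
  · rw [hu i hi]; ring

theorem euler_spinPoly (σ : Config N) :
    ∑ k, spin σ k * grad k (spinPoly q u) σ = q * spinPoly q u σ := by
  rw [sum_mul_grad_spinPoly hu, spinPoly, Finset.mul_sum, Finset.mul_sum]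
  refine Finset.sum_congr rfl fun i _ => ?_
  simp only [spin_mul_self, Finset.sum_const, Finset.card_univ, Fintype.card_fin, nsmul_eq_mul]
  ring

theorem euler_grad_spinPoly (σ : Config N) (j : Fin N) :
    ∑ k, spin σ k * grad j (grad k (spinPoly q u)) σ = (q - 1) * grad j (spinPoly q u) σ := by
  have h1 := sum_mul_grad_grad_spinPoly hu (fun l => if l = j then 1 else 0) (spin σ) σ
  have h2 := sum_mul_grad_spinPoly hu (fun l => if l = j then 1 else 0) σ
  simp only [ite_mul, one_mul, zero_mul, Finset.sum_ite_eq', Finset.mem_univ, if_true] at h1 h2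
  rw [h1, h2, Finset.mul_sum]
  refine Finset.sum_congr rfl fun i _ => ?_
  simp only [spin_mul_self, Finset.sum_const, Finset.card_univ, Fintype.card_fin, nsmul_eq_mul,
    mul_one]
  have e : ∑ a, (if i a = j then spin σ (i a) * ((q : ℝ) - 1) else 0) =
      ((q : ℝ) - 1) * ∑ a, if i a = j then spin σ (i a) else 0 := by
    rw [Finset.mul_sum]
    exact Finset.sum_congr rfl fun a _ => by split_ifs <;> ring
  rw [e]; ring

end

/-- Up to normalization this is the variance of a sum of q independent uniform draws of a centered
X: variances add. -/
theorem sum_sum_sq {X : Fin N → ℝ} (hX : ∑ k, X k = 0) (q : ℕ) :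
    N * ∑ i : Fin q → Fin N, (∑ a, X (i a)) ^ 2 = q * N ^ q * ∑ k, X k ^ 2 := by
  induction q with
  | zero => simp
  | succ q ih =>
    have h : ∑ i : Fin (q + 1) → Fin N, (∑ a, X (i a)) ^ 2 =
        N ^ q * ∑ k, X k ^ 2 + N * ∑ i : Fin q → Fin N, (∑ a, X (i a)) ^ 2 := by
      rw [← (Fin.consEquiv fun _ : Fin (q + 1) => Fin N).sum_comp, Fintype.sum_prod_type]
      simp only [Fin.consEquiv_apply, Fin.sum_univ_succ, Fin.cons_zero, Fin.cons_succ, add_sq,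
        Finset.sum_add_distrib, Finset.sum_const, Finset.card_univ, Fintype.card_pi_const,
        Fintype.card_fin, nsmul_eq_mul, ← Finset.mul_sum, ← Finset.sum_mul, hX]
      push_cast
      ring
    rw [h, mul_add, ih]
    push_cast
    ring

/-- Cauchy–Schwarz over a costs a factor q. For each of the q positions a, Y at that site is
independent of the sum of Z over the other q − 1 sites, whose variance is given by `sum_sum_sq`. The
total q²(q − 1) ≤ q³ is the source of the q³ in the Hessian bound. -/
theorem sum_offdiag_sq_le {Z : Fin N → ℝ} (hZ : ∑ k, Z k = 0) (Y : Fin N → ℝ) (q : ℕ) :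
    N ^ 2 * ∑ i : Fin q → Fin N, (∑ a, Y (i a) * ((∑ b, Z (i b)) - Z (i a))) ^ 2 ≤
      q ^ 3 * N ^ q * ((∑ k, Y k ^ 2) * ∑ k, Z k ^ 2) := by
  rcases q with _ | q
  · simp
  have hYZ : 0 ≤ (∑ k, Y k ^ 2) * ∑ k, Z k ^ 2 :=
    mul_nonneg (Finset.sum_nonneg fun k _ => sq_nonneg _) (Finset.sum_nonneg fun k _ => sq_nonneg _)
  have h1 : ∀ a : Fin (q + 1), N ^ 2 * ∑ i : Fin (q + 1) → Fin N,
      (Y (i a) * ((∑ b, Z (i b)) - Z (i a))) ^ 2 =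
      q * N ^ (q + 1) * ((∑ k, Y k ^ 2) * ∑ k, Z k ^ 2) := by
    intro a
    rw [← (Fin.insertNthEquiv (fun _ : Fin (q + 1) => Fin N) a).sum_comp, Fintype.sum_prod_type]
    have h2 : ∀ (n : Fin N) (i : Fin q → Fin N),
        (Y ((Fin.insertNthEquiv (fun _ => Fin N) a) (n, i) a) *
          ((∑ b, Z ((Fin.insertNthEquiv (fun _ => Fin N) a) (n, i) b)) -
            Z ((Fin.insertNthEquiv (fun _ => Fin N) a) (n, i) a))) ^ 2 =
        Y n ^ 2 * (∑ b, Z (i b)) ^ 2 := by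
      intro n i
      rw [Fin.sum_univ_succAbove _ a]
      simp only [Fin.insertNthEquiv_apply, Fin.insertNth_apply_same, Fin.insertNth_apply_succAbove]
      ring
    simp only [h2, ← Finset.mul_sum, ← Finset.sum_mul]
    have := sum_sum_sq hZ q
    calc _ = N * (∑ k, Y k ^ 2) * (N * ∑ i : Fin q → Fin N, (∑ b, Z (i b)) ^ 2) := by ring
      _ = _ := by rw [this]; ring
  calc _ ≤ N ^ 2 * ∑ i : Fin (q + 1) → Fin N, ((q + 1 : ℕ) : ℝ) *
        ∑ a, (Y (i a) * ((∑ b, Z (i b)) - Z (i a))) ^ 2 := by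
        refine mul_le_mul_of_nonneg_left (Finset.sum_le_sum fun i _ => ?_) (by positivity)
        have := sq_sum_le_card_mul_sum_sq (s := (Finset.univ : Finset (Fin (q + 1))))
          (f := fun a => Y (i a) * ((∑ b, Z (i b)) - Z (i a)))
        simpa using this
    _ = ((q + 1 : ℕ) : ℝ) * ∑ a : Fin (q + 1), N ^ 2 * ∑ i : Fin (q + 1) → Fin N,
        (Y (i a) * ((∑ b, Z (i b)) - Z (i a))) ^ 2 := by
        rw [← Finset.mul_sum, ← Finset.mul_sum, Finset.sum_comm]; ring
    _ = ((q + 1 : ℕ) : ℝ) * ((q + 1 : ℕ) * (q * N ^ (q + 1) *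
        ((∑ k, Y k ^ 2) * ∑ k, Z k ^ 2))) := by
        simp only [h1]; simp
    _ = ((q + 1 : ℕ) : ℝ) ^ 2 * q * (N ^ (q + 1) * ((∑ k, Y k ^ 2) * ∑ k, Z k ^ 2)) := by ring
    _ ≤ ((q + 1 : ℕ) : ℝ) ^ 2 * (q + 1 : ℕ) * (N ^ (q + 1) * ((∑ k, Y k ^ 2) * ∑ k, Z k ^ 2)) := by
        gcongr; linarith
    _ = _ := by ring

/-- The sum over all tuples factorizes into a power of Σ σ_k σ'_k. Tuples with repeated sites are
included on purpose: they give a closed formula and only enlarge the forms used as bounds. -/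
theorem sum_monomial_mul (σ σ' : Config N) (hN : 0 < N) (q : ℕ) :
    ∑ i : Fin q → Fin N, (scale N q * monomial i σ) * (scale N q * monomial i σ') =
      N * overlap σ σ' ^ q := by
  have hN' : (N : ℝ) ≠ 0 := by positivity
  have h : ∑ i : Fin q → Fin N, monomial i σ * monomial i σ' =
      (∑ k, spin σ k * spin σ' k) ^ q := by
    rw [Fintype.sum_pow]
    exact Finset.sum_congr rfl fun i _ => by rw [monomial, monomial, ← Finset.prod_mul_distrib]
  calc _ = scale N q ^ 2 * ∑ i : Fin q → Fin N, monomial i σ * monomial i σ' := by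
        rw [Finset.mul_sum]; exact Finset.sum_congr rfl fun i _ => by ring
    _ = (scale N q ^ 2 * N ^ q) * overlap σ σ' ^ q := by
        rw [h, overlap, div_pow]; field_simp
    _ = _ := by rw [scale_sq hN]

/-! ### Tails for the random polynomials and their derivatives -/

/-- The index set of the independent couplings of a system of size `N`. -/
abbrev CouplingIndex (N : ℕ) : Type :=
  Σ q : Fin (N + 1), {i : Fin (q : ℕ) → Fin N // Function.Injective i}

/-- The law of the couplings. -/
abbrev couplingLaw (N : ℕ) : Measure (CouplingIndex N → ℝ) :=
  Measure.pi fun _ => gaussianReal 0 1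

/-- The `q`-spin coefficients of a family of couplings. -/
def coeff (z : CouplingIndex N → ℝ) (q : ℕ) (i : Fin q → Fin N) : ℝ :=
  if h : q < N + 1 ∧ Function.Injective i then z ⟨⟨q, h.1⟩, ⟨i, h.2⟩⟩ else 0

theorem coeff_eq_zero (z : CouplingIndex N → ℝ) (q : ℕ) (i : Fin q → Fin N)
    (hi : ¬ Function.Injective i) : coeff z q i = 0 := dif_neg fun h => hi h.2

theorem sum_subtype_eq_sum {α : Type*} [Fintype α] {P : α → Prop} [DecidablePred P] (F : α → ℝ)
    (hF : ∀ i, ¬ P i → F i = 0) : ∑ i : {i // P i}, F i = ∑ i, F i := by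
  rw [← Finset.sum_filter_of_ne (p := P) fun i _ h => by_contra fun h' => h (hF i h')]
  exact (Finset.sum_subtype (Finset.univ.filter P) (by simp) F).symm

/-- Only couplings of degree q on injective tuples enter. The hypotheses sum over all tuples and are
therefore stronger than what `gaussian_quadratic_tail` needs. -/
theorem coeff_quadratic_tail {κ : Type*} [Fintype κ] {q : ℕ} (hq : q < N + 1)
    (c : κ → (Fin q → Fin N) → ℝ) {s t u : ℝ} (hs : 0 < s)
    (hdual : ∀ y : κ → ℝ, ∑ i, (∑ a, y a * c a i) ^ 2 ≤ s * ∑ a, y a ^ 2)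
    (htr : ∑ a, ∑ i, c a i ^ 2 ≤ t) :
    couplingLaw N {z | 2 * t + 4 * u * s ≤ ∑ a, (∑ i, c a i * coeff z q i) ^ 2} ≤
      ENNReal.ofReal (Real.exp (-u)) := by
  let C : κ → CouplingIndex N → ℝ := fun a j =>
    if h : (j.1 : ℕ) = q then c a (fun k => j.2.1 (Fin.cast h.symm k)) else 0
  have hsum : ∀ F : CouplingIndex N → ℝ, (∀ j, (j.1 : ℕ) ≠ q → F j = 0) →
      ∑ j, F j = ∑ i, F ⟨⟨q, hq⟩, i⟩ := by
    intro F hF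
    rw [Fintype.sum_sigma]
    refine Fintype.sum_eq_single _ fun q' h => Finset.sum_eq_zero fun i _ => hF _ ?_
    exact fun e => h (Fin.ext e)
  have hC : ∀ a i, C a ⟨⟨q, hq⟩, i⟩ = c a i.1 := fun a i => by simp [C]
  have hC0 : ∀ a j, (j.1 : ℕ) ≠ q → C a j = 0 := fun a j h => by simp [C, h]
  have hle : ∀ F : (Fin q → Fin N) → ℝ, (∀ i, 0 ≤ F i) →
      ∑ i : {i : Fin q → Fin N // Function.Injective i}, F i.1 ≤ ∑ i, F i := by
    intro F hF
    rw [← Finset.sum_subtype (Finset.univ.filter Function.Injective) (by simp) F]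
    exact Finset.sum_le_univ_sum_of_nonneg hF
  have h1 : ∀ z a, ∑ j, C a j * z j = ∑ i, c a i * coeff z q i := by
    intro z a
    rw [hsum _ fun j h => by rw [hC0 a j h, zero_mul],
      ← sum_subtype_eq_sum (P := Function.Injective) _ fun i h => by
        rw [coeff_eq_zero z q i h, mul_zero]]
    refine Finset.sum_congr rfl fun i _ => ?_
    rw [hC, coeff, dif_pos ⟨hq, i.2⟩]
  have := gaussian_quadratic_tail C (t := t) (u := u) hs (fun y => ?_) ?_
  · simpa only [h1] using this
  · rw [hsum _ fun j h => by simp [hC0 _ j h]]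
    simp only [hC]
    exact (hle (fun i => (∑ a, y a * c a i) ^ 2) fun i => sq_nonneg _).trans (hdual y)
  · refine le_trans (Finset.sum_le_sum fun a _ => ?_) htr
    rw [hsum _ fun j h => by simp [hC0 _ j h]]
    simp only [hC]
    exact hle (fun i => c a i ^ 2) fun i => sq_nonneg _

/-- The `q`-spin polynomial of a family of couplings. -/
abbrev randomPoly (z : CouplingIndex N → ℝ) (q : ℕ) : Config N → ℝ := spinPoly q (coeff z q)

theorem overlap_self (hN : 0 < N) (σ : Config N) : overlap σ σ = 1 := by
  have hN' : (N : ℝ) ≠ 0 := by positivity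
  simp [overlap, spin_mul_self, hN']

theorem randomPoly_tail (hN : 0 < N) {q : ℕ} (hq : q < N + 1) (σ : Config N) {u : ℝ} :
    couplingLaw N {z | 2 * N + 4 * u * N ≤ randomPoly z q σ ^ 2} ≤
      ENNReal.ofReal (Real.exp (-u)) := by
  have h := sum_monomial_mul σ σ hN q
  rw [overlap_self hN, one_pow, mul_one] at h
  have hN' : (0 : ℝ) < N := by positivity
  have := coeff_quadratic_tail (κ := Unit) (t := N) (u := u) hq
    (fun _ i => scale N q * monomial i σ) hN' (fun y => ?_) ?_
  · simpa only [Finset.univ_unique, Finset.sum_singleton, randomPoly, spinPoly, Finset.mul_sum,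
      mul_assoc, mul_comm (monomial _ σ)] using this
  · simp only [Finset.univ_unique, Finset.sum_singleton, mul_pow (y _), ← Finset.mul_sum]
    simp only [sq (scale N q * _), h]
    exact (mul_comm _ _).le
  · simp only [Finset.univ_unique, Finset.sum_singleton, sq (scale N q * _), h, le_refl]

theorem sum_proj_basis (σ : Config N) (y : Fin N → ℝ) (l : Fin N) :
    ∑ k, y k * ((if l = k then 1 else 0) - spin σ k / N * spin σ l) =
      y l - (∑ i, y i * spin σ i) / N * spin σ l := by
  simp only [mul_sub, Finset.sum_sub_distrib, mul_ite, mul_one, mul_zero, Finset.sum_ite_eq,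
    Finset.mem_univ, if_true, Finset.sum_div, Finset.sum_mul]
  congr 1
  exact Finset.sum_congr rfl fun k _ => by ring

theorem sum_indicator_sq (k : Fin N) : ∑ l, (if l = k then (1 : ℝ) else 0) ^ 2 = 1 := by
  simp

theorem sum_sq_scale_le (hN : 0 < N) (q : ℕ) (σ : Config N) {x : Fin N → ℝ}
    (hx : ∑ k, x k * spin σ k = 0) :
    ∑ i : Fin q → Fin N, (scale N q * (∑ a, x (i a) * spin σ (i a)) * monomial i σ) ^ 2 =
      q * ∑ k, x k ^ 2 := by
  have hN' : (0 : ℝ) < N := by positivity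
  have h1 := sum_sum_sq hx q
  have h2 := scale_sq hN q
  simp only [mul_pow, monomial_sq, mul_one, ← Finset.mul_sum] at h1 ⊢
  simp only [spin_sq, mul_one] at h1
  refine mul_left_cancel₀ hN'.ne' ?_
  linear_combination scale N q ^ 2 * h1 + (q * ∑ k, x k ^ 2) * h2

/-- The quadratic form is the squared norm of the gradient projected orthogonally to σ. Its dual
form at y is a variance computed with the projected y, hence at most q|y|²; without the projection
the radial direction would give q². -/
theorem randomPoly_grad_tail (hN : 0 < N) {q : ℕ} (hq0 : 0 < q) (hq : q < N + 1) (σ : Config N)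
    {u : ℝ} : couplingLaw N {z | 2 * (q * N) + 4 * u * q ≤ ∑ k, (∑ l, ((if l = k then 1 else 0) -
        spin σ k / N * spin σ l) * grad l (randomPoly z q) σ) ^ 2} ≤
      ENNReal.ofReal (Real.exp (-u)) := by
  have hN' : (0 : ℝ) < N := by positivity
  have hd : ∀ y : Fin N → ℝ, ∑ i : Fin q → Fin N, (∑ k, y k * (scale N q * (∑ a,
      ((if i a = k then 1 else 0) - spin σ k / N * spin σ (i a)) * spin σ (i a)) *
        monomial i σ)) ^ 2 ≤ q * ∑ k, y k ^ 2 := by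
    intro y
    have h1 : ∀ i : Fin q → Fin N, ∑ k, y k * (scale N q * (∑ a,
        ((if i a = k then 1 else 0) - spin σ k / N * spin σ (i a)) * spin σ (i a)) *
          monomial i σ) = scale N q * (∑ a, (y (i a) - (∑ l, y l * spin σ l) / N * spin σ (i a)) *
            spin σ (i a)) * monomial i σ := by
      intro i
      simp only [← sum_proj_basis σ y, Finset.sum_mul, Finset.mul_sum]
      rw [Finset.sum_comm]
      exact Finset.sum_congr rfl fun a _ => Finset.sum_congr rfl fun k _ => by ring
    simp only [h1]
    rw [sum_sq_scale_le hN q σ (x := fun l => y l - (∑ l, y l * spin σ l) / N * spin σ l)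
      (sum_sub_proj_mul_spin hN σ y), sum_sq_sub_proj hN]
    refine mul_le_mul_of_nonneg_left ?_ (Nat.cast_nonneg q)
    have : 0 ≤ (∑ i, y i * spin σ i) ^ 2 / N := by positivity
    linarith
  have := coeff_quadratic_tail (t := q * N) (u := u) hq _ (by positivity) hd ?_
  · simpa only [sum_mul_grad_spinPoly (coeff_eq_zero _ q)] using this
  · calc _ ≤ ∑ k : Fin N, (q : ℝ) := Finset.sum_le_sum fun k _ => by
          have := hd fun l => if l = k then 1 else 0
          rw [sum_indicator_sq, mul_one] at this
          simpa using this
      _ = q * N := by simp [mul_comm]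

/-- For fixed x orthogonal to σ, the Hessian applied to x is linear in the couplings.
`sum_offdiag_sq_le` bounds the dual form, and testing it on basis vectors bounds the trace. -/
theorem randomPoly_hess_tail (hN : 0 < N) {q : ℕ} (hq0 : 0 < q) (hq : q < N + 1) (σ : Config N)
    {x : Fin N → ℝ} (hx : ∑ k, x k * spin σ k = 0) {m : ℝ} (hm0 : 0 < m)
    (hm : ∑ k, x k ^ 2 ≤ m * N) {u : ℝ} :
    couplingLaw N {z | 2 * (m * q ^ 3 * N) + 4 * u * (m * q ^ 3) ≤
      ∑ j, (∑ k, x k * grad j (grad k (randomPoly z q)) σ) ^ 2} ≤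
      ENNReal.ofReal (Real.exp (-u)) := by
  have hN' : (0 : ℝ) < N := by positivity
  have hd : ∀ y : Fin N → ℝ, ∑ i : Fin q → Fin N, (∑ j, y j * (scale N q * (∑ a,
      (if i a = j then 1 else 0) * spin σ (i a) * ((∑ b, x (i b) * spin σ (i b)) -
        x (i a) * spin σ (i a))) * monomial i σ)) ^ 2 ≤ m * q ^ 3 * ∑ k, y k ^ 2 := by
    intro y
    have h1 : ∀ i : Fin q → Fin N, ∑ j, y j * (scale N q * (∑ a,
        (if i a = j then 1 else 0) * spin σ (i a) * ((∑ b, x (i b) * spin σ (i b)) -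
          x (i a) * spin σ (i a))) * monomial i σ) = scale N q * (∑ a, y (i a) * spin σ (i a) *
            ((∑ b, x (i b) * spin σ (i b)) - x (i a) * spin σ (i a))) * monomial i σ := by
      intro i
      simp only [Finset.sum_mul, Finset.mul_sum]
      rw [Finset.sum_comm]
      refine Finset.sum_congr rfl fun a _ => ?_
      rw [Finset.sum_eq_single (i a) (fun j _ h => by simp [Ne.symm h]) (by simp)]
      simp only [if_true]; ring
    simp only [h1, mul_pow, monomial_sq, mul_one, ← Finset.mul_sum]
    have h2 := sum_offdiag_sq_le hx (fun k => y k * spin σ k) q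
    simp only [mul_pow, spin_sq, mul_one] at h2
    have h3 := scale_sq hN q
    set V := ∑ i : Fin q → Fin N, (∑ a, y (i a) * spin σ (i a) *
      ((∑ b, x (i b) * spin σ (i b)) - x (i a) * spin σ (i a))) ^ 2
    have hY : 0 ≤ ∑ k, y k ^ 2 := Finset.sum_nonneg fun k _ => sq_nonneg _
    have h4 : N ^ 2 * (scale N q ^ 2 * V) ≤ N ^ 2 * (m * q ^ 3 * ∑ k, y k ^ 2) := by
      calc _ = scale N q ^ 2 * (N ^ 2 * V) := by ring
        _ ≤ scale N q ^ 2 * (q ^ 3 * N ^ q * ((∑ k, y k ^ 2) * ∑ k, x k ^ 2)) := by gcongr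
        _ = N * (q ^ 3 * (∑ k, y k ^ 2) * ∑ k, x k ^ 2) := by
          linear_combination (q ^ 3 * (∑ k, y k ^ 2) * ∑ k, x k ^ 2) * h3
        _ ≤ N * (q ^ 3 * (∑ k, y k ^ 2) * (m * N)) := by gcongr
        _ = _ := by ring
    exact le_of_mul_le_mul_left h4 (by positivity)
  have := coeff_quadratic_tail (t := m * q ^ 3 * N) (u := u) hq _ (by positivity) hd ?_
  · have e : ∀ z j, ∑ k, x k * grad j (grad k (randomPoly z q)) σ = ∑ i, scale N q * (∑ a,
      (if i a = j then 1 else 0) * spin σ (i a) * ((∑ b, x (i b) * spin σ (i b)) -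
        x (i a) * spin σ (i a))) * monomial i σ * coeff z q i := by
      intro z j
      rw [← sum_mul_grad_grad_spinPoly (coeff_eq_zero z q) (fun l => if l = j then 1 else 0) x σ]
      simp
    simpa only [e] using this
  · calc _ ≤ ∑ k : Fin N, (m * q ^ 3 : ℝ) := Finset.sum_le_sum fun k _ => by
          have := hd fun l => if l = k then 1 else 0
          rw [sum_indicator_sq, mul_one] at this
          simpa using this
      _ = m * q ^ 3 * N := by simp [mul_comm]

/-! ### Independence of the degrees and the second moment on blocks -/

/-- The `q`-spin couplings of `x` together with all other couplings of `y`. -/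
def glue (q : ℕ) (w : (CouplingIndex N → ℝ) × (CouplingIndex N → ℝ)) : CouplingIndex N → ℝ :=
  fun j => if (j.1 : ℕ) = q then w.1 j else w.2 j

theorem measurable_glue (q : ℕ) : Measurable (glue (N := N) q) := by
  refine measurable_pi_lambda _ fun j => ?_
  unfold glue
  split_ifs <;> fun_prop

/-- Degree q from one copy and the rest from an independent copy again form independent Gaussians.
With Fubini this allows freezing all degrees other than q. -/
theorem map_glue (q : ℕ) :
    ((couplingLaw N).prod (couplingLaw N)).map (glue q) = couplingLaw N := by
  refine (Measure.pi_eq fun s hs => ?_).symm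
  rw [Measure.map_apply (measurable_glue q) (MeasurableSet.univ_pi hs)]
  have : glue q ⁻¹' Set.pi Set.univ s =
      (Set.pi Set.univ fun j : CouplingIndex N => if (j.1 : ℕ) = q then s j else Set.univ) ×ˢ
        (Set.pi Set.univ fun j : CouplingIndex N => if (j.1 : ℕ) = q then Set.univ else s j) := by
    ext w
    simp only [Set.mem_preimage, Set.mem_pi, Set.mem_univ, true_implies, Set.mem_prod, glue,
      ← forall_and]
    refine forall_congr' fun j => ?_
    split_ifs <;> simp
  rw [this, Measure.prod_prod, Measure.pi_pi, Measure.pi_pi, ← Finset.prod_mul_distrib]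
  refine Finset.prod_congr rfl fun j _ => ?_
  split_ifs <;> simp

theorem measure_le_of_glue_section {q : ℕ} {B : Set (CouplingIndex N → ℝ)} (hB : MeasurableSet B)
    {r : ℝ≥0∞} (h : ∀ y, couplingLaw N {x | glue q (x, y) ∈ B} ≤ r) : couplingLaw N B ≤ r := by
  rw [← map_glue q, Measure.map_apply (measurable_glue q) hB,
    Measure.prod_apply_symm (measurable_glue q hB)]
  calc _ ≤ ∫⁻ _, r ∂(couplingLaw N) := lintegral_mono fun y => h y
    _ = r := by simp

theorem randomPoly_glue_self (q : ℕ) (x y : CouplingIndex N → ℝ) :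
    randomPoly (glue q (x, y)) q = randomPoly x q := by
  unfold randomPoly
  congr 1
  funext i
  unfold coeff
  split_ifs <;> simp [glue]

theorem randomPoly_glue_ne {q q' : ℕ} (h : q' ≠ q) (x y : CouplingIndex N → ℝ) :
    randomPoly (glue q (x, y)) q' = randomPoly y q' := by
  unfold randomPoly
  congr 1
  funext i
  unfold coeff
  split_ifs <;> simp [glue, h]

theorem measurable_randomPoly (q : ℕ) (σ : Config N) :
    Measurable fun z : CouplingIndex N → ℝ => randomPoly z q σ := by
  unfold randomPoly spinPoly
  refine Measurable.const_mul (Finset.measurable_sum _ fun i _ => Measurable.mul_const ?_ _) _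
  unfold coeff
  split_ifs <;> fun_prop

theorem measurable_condMean {S : Finset (Config N)} {α : Type*} [MeasurableSpace α]
    {H f : α → Config N → ℝ} (hH : ∀ σ, Measurable fun a => H a σ)
    (hf : ∀ σ, Measurable fun a => f a σ) : Measurable fun a => condMean S (H a) (f a) := by
  unfold condMean
  have := fun σ => (hH σ).exp
  fun_prop

/-- At least half of the sites lie outside the block, and there the two configurations agree. -/
theorem overlap_fiber_nonneg {A : Finset (Fin N)} (hA : 2 * A.card ≤ N)
    {σ σ' τ : Config N} (h : σ ∈ fiber A τ) (h' : σ' ∈ fiber A τ) : 0 ≤ overlap σ σ' := by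
  refine div_nonneg ?_ (Nat.cast_nonneg N)
  have h1 : ∀ k, 1 - (if k ∈ A then 2 else 0) ≤ spin σ k * spin σ' k := by
    intro k
    split_ifs with hk
    · rcases spin_eq_or σ k with e | e <;> rcases spin_eq_or σ' k with e' | e' <;>
        rw [e, e'] <;> norm_num
    · have : spin σ k = spin σ' k := by
        rw [spin, spin, mem_fiber.1 h k hk, mem_fiber.1 h' k hk]
      rw [this, spin_mul_self, sub_zero]
  refine le_trans ?_ (Finset.sum_le_sum fun k _ => h1 k)
  have : ((2 * A.card : ℕ) : ℝ) ≤ N := by exact_mod_cast hA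
  simp [Finset.sum_sub_distrib, Finset.sum_ite_mem]
  push_cast at this
  linarith

/-- Schur's test: the kernel √ν(σ) R √ν(σ') is bounded by its weighted row sums, through the
arithmetic–geometric mean inequality and symmetry. -/
theorem schur_sum_le {α : Type*} {S : Finset α} {ν : α → ℝ} (hν : ∀ σ ∈ S, 0 ≤ ν σ)
    {R : α → α → ℝ} (hR : ∀ σ ∈ S, ∀ σ' ∈ S, 0 ≤ R σ σ') (hsymm : ∀ σ σ', R σ σ' = R σ' σ) {r : ℝ}
    (hr : ∀ σ ∈ S, ∑ σ' ∈ S, ν σ' * R σ σ' ≤ r) (y : α → ℝ) :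
    ∑ σ ∈ S, ∑ σ' ∈ S, (y σ * √(ν σ)) * (y σ' * √(ν σ')) * R σ σ' ≤ r * ∑ σ ∈ S, y σ ^ 2 := by
  have h1 : ∀ σ ∈ S, ∀ σ' ∈ S, (y σ * √(ν σ)) * (y σ' * √(ν σ')) * R σ σ' ≤
      1 / 2 * (y σ ^ 2 * (ν σ' * R σ σ')) + 1 / 2 * (y σ' ^ 2 * (ν σ * R σ' σ)) := by
    intro σ h σ' h'
    have e1 := Real.sq_sqrt (hν σ h)
    have e2 := Real.sq_sqrt (hν σ' h')
    rw [hsymm σ' σ]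
    have := mul_nonneg (hR σ h σ' h') (sq_nonneg (y σ * √(ν σ') - y σ' * √(ν σ)))
    have e : (y σ * √(ν σ') - y σ' * √(ν σ)) ^ 2 = y σ ^ 2 * ν σ' + y σ' ^ 2 * ν σ -
      2 * ((y σ * √(ν σ)) * (y σ' * √(ν σ'))) := by
      linear_combination y σ ^ 2 * e2 + y σ' ^ 2 * e1
    rw [e] at this
    linarith
  refine (Finset.sum_le_sum fun σ h => Finset.sum_le_sum fun σ' h' => h1 σ h σ' h').trans ?_
  simp only [Finset.sum_add_distrib]
  rw [Finset.sum_comm (f := fun σ σ' => 1 / 2 * (y σ' ^ 2 * (ν σ * R σ' σ))), ← two_mul]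
  simp only [Finset.mul_sum]
  refine Finset.sum_le_sum fun σ h => ?_
  have := mul_le_mul_of_nonneg_left (hr σ h) (sq_nonneg (y σ))
  rw [Finset.mul_sum] at this
  calc _ = ∑ σ' ∈ S, y σ ^ 2 * (ν σ' * R σ σ') :=
        Finset.sum_congr rfl fun σ' _ => by ring
    _ ≤ _ := this.trans (mul_comm _ _).le

theorem condMean_eq_sum {S : Finset (Config N)} (H f : Config N → ℝ) :
    condMean S H f = ∑ σ ∈ S, Real.exp (H σ) / (∑ σ ∈ S, Real.exp (H σ)) * f σ := by
  rw [condMean, Finset.sum_div]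
  exact Finset.sum_congr rfl fun σ _ => by ring

/-- For a fixed H, ⟨p_q²⟩ is a quadratic form in the couplings. Its trace is at most N, and its dual
matrix is controlled by N √ν(σ) √ν(σ') R(σ, σ')^q, of norm at most N max_σ ⟨R(σ, ·)^q⟩ by Schur's
test. -/
theorem condMean_sq_tail (hN : 0 < N) {q : ℕ} (hq : q < N + 1) {A : Finset (Fin N)}
    (hA : 2 * A.card ≤ N) (τ : Config N) (H : Config N → ℝ) {u r : ℝ} (hr0 : 0 < r)
    (hr : ∀ σ ∈ fiber A τ, condMean (fiber A τ) H (fun σ' => overlap σ σ' ^ q) ≤ r) :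
    couplingLaw N {z | 2 * N + 4 * u * (N * r) ≤
      condMean (fiber A τ) H (fun σ => randomPoly z q σ ^ 2)} ≤ ENNReal.ofReal (Real.exp (-u)) := by
  have hN' : (0 : ℝ) < N := by positivity
  set S := fiber A τ with hS
  set ν : Config N → ℝ := fun σ => Real.exp (H σ) / ∑ σ ∈ S, Real.exp (H σ) with hν
  have hZ : 0 < ∑ σ ∈ S, Real.exp (H σ) :=
    Finset.sum_pos (fun _ _ => Real.exp_pos _) (fiber_nonempty A τ)
  have hν0 : ∀ σ, 0 ≤ ν σ := fun σ => by positivity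
  have hν1 : ∑ σ ∈ S, ν σ = 1 := by rw [hν, ← Finset.sum_div, div_self hZ.ne']
  have hsymm : ∀ σ σ' : Config N, overlap σ σ' ^ q = overlap σ' σ ^ q := fun σ σ' => by
    simp only [overlap, mul_comm]
  let c : S → (Fin q → Fin N) → ℝ := fun σ i => √(ν σ) * (scale N q * monomial i σ.1)
  have := coeff_quadratic_tail (t := N) (u := u) (s := N * r) hq c (by positivity) (fun y => ?_) ?_
  · convert this using 4 with z
    rw [condMean_eq_sum]
    refine iff_of_eq (congrArg (fun v => 2 * (N : ℝ) + 4 * u * (N * r) ≤ v) ?_)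
    refine (Finset.sum_coe_sort S fun σ => ν σ * randomPoly z q σ ^ 2).symm.trans ?_
    refine Finset.sum_congr rfl fun σ _ => ?_
    simp only [c, mul_assoc, ← Finset.mul_sum]
    rw [mul_pow, Real.sq_sqrt (hν0 _), randomPoly, spinPoly]
    simp only [mul_comm (monomial _ _)]
  · obtain ⟨y', hy'⟩ : ∃ y' : Config N → ℝ, ∀ σ : S, y' σ = y σ :=
      ⟨fun σ => if h : σ ∈ S then y ⟨σ, h⟩ else 0, fun σ => by simp⟩
    have h1 := schur_sum_le (S := S) (fun σ _ => hν0 σ)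
      (R := fun σ σ' => overlap σ σ' ^ q)
      (fun σ h σ' h' => pow_nonneg (overlap_fiber_nonneg hA h h') q) hsymm (r := r)
      (fun σ h => by simpa only [condMean_eq_sum] using hr σ h) y'
    have h2 : ∀ i, ∑ σ : S, y σ * c σ i =
        ∑ σ ∈ S, (y' σ * √(ν σ)) * (scale N q * monomial i σ) := by
      intro i
      rw [← Finset.sum_coe_sort S fun σ => (y' σ * √(ν σ)) * (scale N q * monomial i σ)]
      exact Finset.sum_congr rfl fun σ _ => by simp only [c, hy']; ring
    have h3 : ∑ σ : S, y σ ^ 2 = ∑ σ ∈ S, y' σ ^ 2 := by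
      rw [← Finset.sum_coe_sort S fun σ => y' σ ^ 2]; simp only [hy']
    rw [h3]
    simp only [h2]
    calc _ = ∑ σ ∈ S, ∑ σ' ∈ S, (y' σ * √(ν σ)) * (y' σ' * √(ν σ')) *
          ∑ i : Fin q → Fin N, (scale N q * monomial i σ) * (scale N q * monomial i σ') := by
          simp only [sq (∑ _ ∈ S, _), Finset.sum_mul_sum]
          simp only [Finset.mul_sum]
          rw [Finset.sum_comm]
          refine Finset.sum_congr rfl fun σ _ => ?_
          rw [Finset.sum_comm]
          exact Finset.sum_congr rfl fun σ' _ => Finset.sum_congr rfl fun i _ => by ring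
      _ = N * ∑ σ ∈ S, ∑ σ' ∈ S, (y' σ * √(ν σ)) * (y' σ' * √(ν σ')) * overlap σ σ' ^ q := by
          simp only [sum_monomial_mul _ _ hN, Finset.mul_sum]
          exact Finset.sum_congr rfl fun σ _ => Finset.sum_congr rfl fun σ' _ => by ring
      _ ≤ N * (r * ∑ σ ∈ S, y' σ ^ 2) := by gcongr
      _ = _ := by ring
  · have h1 : ∀ σ : S, ∑ i, c σ i ^ 2 = ν σ * N := by
      intro σ
      simp only [c, mul_pow (√_), Real.sq_sqrt (hν0 _), ← Finset.mul_sum]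
      simp only [sq (scale N q * _)]
      rw [sum_monomial_mul _ _ hN, overlap_self hN, one_pow, mul_one]
    simp only [h1]
    rw [Finset.sum_coe_sort S fun σ => ν σ * N, ← Finset.sum_mul, hν1, one_mul]

theorem condMean_overlap_pos (hN : 0 < N) (q : ℕ) {A : Finset (Fin N)} (hA : 2 * A.card ≤ N)
    {σ τ : Config N} (H : Config N → ℝ) (hσ : σ ∈ fiber A τ) :
    0 < condMean (fiber A τ) H (fun σ' => overlap σ σ' ^ q) := by
  refine div_pos (Finset.sum_pos' (fun σ' h' => mul_nonneg (Real.exp_pos _).le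
    (pow_nonneg (overlap_fiber_nonneg hA hσ h') q)) ⟨σ, hσ, ?_⟩)
    (Finset.sum_pos (fun _ _ => Real.exp_pos _) (fiber_nonempty A τ))
  simp only [overlap_self hN, one_pow, mul_one]
  exact Real.exp_pos _

/-- With the other degrees frozen, H is deterministic and `condMean_sq_tail` applies at a σ
maximizing ⟨R(σ, ·)^q⟩. The maximum is expressed by a quantifier over σ, which keeps the event
visibly measurable. -/
theorem second_moment_tail (hN : 0 < N) {q : ℕ} (hq : q < N + 1) {A : Finset (Fin N)}
    (hA : 2 * A.card ≤ N) (τ : Config N) {H : (CouplingIndex N → ℝ) → Config N → ℝ}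
    (hH : ∀ σ, Measurable fun z => H z σ) (hHq : ∀ x y, H (glue q (x, y)) = H y) {u : ℝ} :
    couplingLaw N {z | ∀ σ ∈ fiber A τ, 2 * N + 4 * u * (N * condMean (fiber A τ) (H z)
        (fun σ' => overlap σ σ' ^ q)) < condMean (fiber A τ) (H z) (fun σ => randomPoly z q σ ^ 2)}
      ≤ ENNReal.ofReal (Real.exp (-u)) := by
  have hm : MeasurableSet {z | ∀ σ ∈ fiber A τ, 2 * N + 4 * u * (N * condMean (fiber A τ) (H z)
      (fun σ' => overlap σ σ' ^ q)) <
        condMean (fiber A τ) (H z) (fun σ => randomPoly z q σ ^ 2)} := by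
    have e : ∀ σ, Measurable fun z => condMean (fiber A τ) (H z) (fun σ' => overlap σ σ' ^ q) :=
      fun σ => measurable_condMean hH fun _ => measurable_const
    have e' : Measurable fun z => condMean (fiber A τ) (H z) (fun σ => randomPoly z q σ ^ 2) :=
      measurable_condMean hH fun σ => (measurable_randomPoly q σ).pow_const 2
    simp only [Set.ofPred_forall]
    exact MeasurableSet.iInter fun σ => MeasurableSet.iInter fun _ =>
      measurableSet_lt (((e σ).const_mul _).const_mul _ |>.const_add _) e'
  refine measure_le_of_glue_section (q := q) hm fun y => ?_
  obtain ⟨σ, hσ, hmax⟩ := Finset.exists_max_image (fiber A τ)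
    (fun σ => condMean (fiber A τ) (H y) (fun σ' => overlap σ σ' ^ q)) (fiber_nonempty A τ)
  refine (measure_mono fun x hx => ?_).trans (condMean_sq_tail hN hq hA τ (H y) (u := u)
    (condMean_overlap_pos hN q hA (H y) hσ) hmax)
  have := hx σ hσ
  rw [hHq, randomPoly_glue_self] at this
  exact this.le

/-! ### Lattice nets and union bounds -/

/-- A vector of norm √N, rounded coordinatewise, moves by at most √N/2 and keeps squared norm at
most (9/4)N ≤ 4N. Hence ‖T‖ ≤ a + ‖T‖/2. -/
theorem opNorm_le_of_integer_points (hN : 0 < N)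
    (T : EuclideanSpace ℝ (Fin N) →L[ℝ] EuclideanSpace ℝ (Fin N)) {a : ℝ} (ha : 0 ≤ a)
    (h : ∀ z : Fin N → ℤ, ∑ k, (z k : ℝ) ^ 2 ≤ 4 * N →
      ‖T (WithLp.toLp 2 fun k => (z k : ℝ))‖ ≤ a * √N) : ‖T‖ ≤ 2 * a := by
  have hN' : (0 : ℝ) < N := by positivity
  have hs : 0 < √(N : ℝ) := Real.sqrt_pos.2 hN'
  suffices ‖T‖ ≤ a + ‖T‖ / 2 by linarith
  refine T.opNorm_le_bound (by positivity) fun x => ?_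
  rcases eq_or_ne x 0 with rfl | hx
  · simp
  have hx0 : 0 < ‖x‖ := norm_pos_iff.2 hx
  set c := √(N : ℝ) / ‖x‖ with hc
  have hc0 : 0 < c := by positivity
  have hy : ‖c • x‖ = √N := by
    rw [norm_smul, Real.norm_of_nonneg hc0.le, hc, div_mul_cancel₀ _ hx0.ne']
  set z : Fin N → ℤ := fun k => round ((c • x) k)
  set v : EuclideanSpace ℝ (Fin N) := WithLp.toLp 2 fun k => (z k : ℝ) with hv
  have hw : ‖c • x - v‖ ≤ √N / 2 := by
    refine abs_le_of_sq_le_sq' ?_ (by positivity) |>.2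
    rw [EuclideanSpace.real_norm_sq_eq, div_pow, Real.sq_sqrt hN'.le]
    calc _ ≤ ∑ k : Fin N, (1 / 4 : ℝ) := Finset.sum_le_sum fun k _ => by
          have := abs_sub_round ((c • x) k)
          have h2 : ((c • x - v) k) ^ 2 ≤ (1 / 2) ^ 2 := sq_le_sq' (abs_le.1 this).1 (abs_le.1 this).2
          linarith
      _ = _ := by simp; ring
  have hvn : ‖v‖ ≤ 3 / 2 * √N := by
    have := norm_sub_norm_le v (c • x)
    rw [norm_sub_rev v, hy] at this
    linarith
  have hz : ∑ k, (z k : ℝ) ^ 2 ≤ 4 * N := by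
    have h1 := EuclideanSpace.real_norm_sq_eq v
    have h2 : ‖v‖ ^ 2 ≤ (3 / 2 * √N) ^ 2 := by gcongr
    rw [mul_pow, Real.sq_sqrt hN'.le, h1] at h2
    simp only [hv] at h2
    linarith
  have h1 : ‖T (c • x)‖ ≤ a * √N + ‖T‖ * (√N / 2) := by
    calc _ = ‖T v + T (c • x - v)‖ := by rw [← map_add, add_sub_cancel]
      _ ≤ ‖T v‖ + ‖T (c • x - v)‖ := norm_add_le _ _
      _ ≤ _ := add_le_add (h z hz) ((T.le_opNorm _).trans (by gcongr))
  rw [map_smul, norm_smul, Real.norm_of_nonneg hc0.le] at h1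
  have h2 : c * ‖T x‖ ≤ c * ((a + ‖T‖ / 2) * ‖x‖) := by
    calc _ ≤ _ := h1
      _ = (a + ‖T‖ / 2) * (c * ‖x‖) := by rw [hc, div_mul_cancel₀ _ hx0.ne']; ring
      _ = _ := by ring
  exact le_of_mul_le_mul_left h2 hc0

theorem sum_sq_le_of_integer_points (hN : 0 < N) (L : (Fin N → ℝ) →ₗ[ℝ] (Fin N → ℝ)) {a : ℝ}
    (ha : 0 ≤ a) (h : ∀ z : Fin N → ℤ, ∑ k, (z k : ℝ) ^ 2 ≤ 4 * N →
      ∑ j, L (fun k => (z k : ℝ)) j ^ 2 ≤ a * N) (x : Fin N → ℝ) :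
    ∑ j, L x j ^ 2 ≤ 4 * a * ∑ k, x k ^ 2 := by
  let e := WithLp.linearEquiv 2 ℝ (Fin N → ℝ)
  let T : EuclideanSpace ℝ (Fin N) →L[ℝ] EuclideanSpace ℝ (Fin N) :=
    LinearMap.toContinuousLinearMap (e.symm.toLinearMap ∘ₗ L ∘ₗ e.toLinearMap)
  have hT : ∀ x, ‖T (WithLp.toLp 2 x)‖ ^ 2 = ∑ j, L x j ^ 2 := fun x =>
    EuclideanSpace.real_norm_sq_eq _
  have h1 := opNorm_le_of_integer_points hN T (Real.sqrt_nonneg a) fun z hz => by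
    rw [← Real.sqrt_mul ha]
    refine Real.le_sqrt_of_sq_le ?_
    rw [hT]; exact h z hz
  have h2 := T.le_opNorm (WithLp.toLp 2 x)
  have h3 : ‖T (WithLp.toLp 2 x)‖ ^ 2 ≤ (2 * √a * ‖(WithLp.toLp 2 x : EuclideanSpace ℝ (Fin N))‖) ^ 2 := by
    gcongr
    exact h2.trans (by gcongr)
  rw [hT, mul_pow, mul_pow, Real.sq_sqrt ha, EuclideanSpace.real_norm_sq_eq] at h3
  exact h3.trans_eq (by norm_num)

/-- Only the bound 3 is used later; the geometric correction lets the induction close. -/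
theorem sum_exp_neg_sq_le (n : ℕ) :
    ∑ z ∈ Finset.Icc (-(n : ℤ)) n, Real.exp (-(z : ℝ) ^ 2) ≤ 3 - 2 * (1 / 2) ^ n := by
  induction n with
  | zero => norm_num
  | succ n ih =>
    have h1 : Finset.Icc (-((n + 1 : ℕ) : ℤ)) ((n + 1 : ℕ) : ℤ) =
        insert (-((n + 1 : ℕ) : ℤ)) (insert ((n + 1 : ℕ) : ℤ) (Finset.Icc (-(n : ℤ)) n)) := by
      ext z; simp only [Finset.mem_insert, Finset.mem_Icc]; push_cast; omega
    rw [h1, Finset.sum_insert (by simp only [Finset.mem_insert, Finset.mem_Icc]; push_cast; omega),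
      Finset.sum_insert (by simp only [Finset.mem_Icc]; push_cast; omega)]
    have h2 : Real.exp (-((n + 1 : ℝ)) ^ 2) ≤ (1 / 2) ^ (n + 1) := by
      calc _ ≤ Real.exp (((n + 1 : ℕ) : ℝ) * (-1)) := by
            refine Real.exp_le_exp.2 ?_
            push_cast
            nlinarith [(Nat.cast_nonneg n : (0 : ℝ) ≤ n)]
        _ = Real.exp (-1) ^ (n + 1) := Real.exp_nat_mul _ _
        _ ≤ _ := by
            gcongr
            rw [Real.exp_neg, one_div]
            refine inv_anti₀ (by norm_num) ?_
            linarith [Real.add_one_le_exp (1 : ℝ)]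
    push_cast
    rw [neg_sq]
    have h3 : (1 / 2 : ℝ) ^ (n + 1) = (1 / 2) ^ n / 2 := by ring
    linarith

/-- The integer points in a ball of radius `2 √N`. -/
def integerBall (N : ℕ) : Finset (Fin N → ℤ) :=
  (Fintype.piFinset fun _ => Finset.Icc (-((2 * N : ℕ) : ℤ)) ((2 * N : ℕ) : ℤ)).filter
    fun z => ∑ k, (z k : ℝ) ^ 2 ≤ 4 * N

theorem mem_integerBall {z : Fin N → ℤ} : z ∈ integerBall N ↔ ∑ k, (z k : ℝ) ^ 2 ≤ 4 * N := by
  refine ⟨fun h => (Finset.mem_filter.1 h).2, fun h => Finset.mem_filter.2 ⟨?_, h⟩⟩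
  refine Fintype.mem_piFinset.2 fun k => ?_
  have h1 : (z k : ℝ) ^ 2 ≤ 4 * N :=
    (Finset.single_le_sum (f := fun k => (z k : ℝ) ^ 2) (fun k _ => sq_nonneg _)
      (Finset.mem_univ k)).trans h
  have h2 : z k ^ 2 ≤ 4 * N := by exact_mod_cast h1
  have h3 : (0 : ℤ) < N := by exact_mod_cast k.pos
  rw [Finset.mem_Icc]
  push_cast
  constructor <;> nlinarith

theorem exp_one_ge_two : 2 ≤ Real.exp 1 := by linarith [Real.add_one_le_exp (1 : ℝ)]

/-- Each point of the ball is counted with weight e^{4N − |z|²} ≥ 1. Over a full box the weights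
factorize into N one-dimensional sums, each at most 3 ≤ e². -/
theorem card_integerBall_le (N : ℕ) : ((integerBall N).card : ℝ) ≤ Real.exp (6 * N) := by
  have h3 : (3 : ℝ) ≤ Real.exp 2 := by linarith [Real.add_one_le_exp (2 : ℝ)]
  calc ((integerBall N).card : ℝ) = ∑ z ∈ integerBall N, (1 : ℝ) := by simp
    _ ≤ ∑ z ∈ integerBall N, Real.exp (4 * N) * ∏ k, Real.exp (-(z k : ℝ) ^ 2) := by
        refine Finset.sum_le_sum fun z hz => ?_
        rw [← Real.exp_sum, ← Real.exp_add, Real.one_le_exp_iff, Finset.sum_neg_distrib]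
        linarith [mem_integerBall.1 hz]
    _ ≤ ∑ z ∈ Fintype.piFinset fun _ : Fin N =>
          Finset.Icc (-((2 * N : ℕ) : ℤ)) ((2 * N : ℕ) : ℤ),
          Real.exp (4 * N) * ∏ k, Real.exp (-(z k : ℝ) ^ 2) :=
        Finset.sum_le_sum_of_subset_of_nonneg (Finset.filter_subset _ _) fun z _ _ => by positivity
    _ = Real.exp (4 * N) * (∑ z ∈ Finset.Icc (-((2 * N : ℕ) : ℤ)) ((2 * N : ℕ) : ℤ),
          Real.exp (-(z : ℝ) ^ 2)) ^ N := by
        rw [← Finset.mul_sum, ← Finset.prod_univ_sum (fun _ : Fin N =>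
          Finset.Icc (-((2 * N : ℕ) : ℤ)) ((2 * N : ℕ) : ℤ)) fun _ z => Real.exp (-(z : ℝ) ^ 2)]
        simp
    _ ≤ Real.exp (4 * N) * 3 ^ N := by
        gcongr
        refine (sum_exp_neg_sq_le (2 * N)).trans ?_
        have : (0 : ℝ) ≤ (1 / 2) ^ (2 * N) := by positivity
        linarith
    _ ≤ Real.exp (4 * N) * Real.exp 2 ^ N := by gcongr
    _ = _ := by rw [← Real.exp_nat_mul, ← Real.exp_add]; ring_nf

theorem two_pow_le_exp (N : ℕ) : (2 : ℝ) ^ N ≤ Real.exp N := by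
  calc (2 : ℝ) ^ N ≤ Real.exp 1 ^ N := by gcongr; exact exp_one_ge_two
    _ = _ := by rw [← Real.exp_nat_mul, mul_one]

theorem natCast_le_exp (N : ℕ) : (N : ℝ) ≤ Real.exp N := by linarith [Real.add_one_le_exp (N : ℝ)]

theorem card_config (N : ℕ) : Fintype.card (Config N) = 2 ^ N := by
  rw [Fintype.card_pi_const, Fintype.card_units_int]

/-- With n = N^{1/3}: N + 1 ≤ (n + 1)³ ≤ e^{3n} and m ≤ n². This counts the temperature grid; it is
exponential in N only because the degrees satisfy q³ ≤ N². -/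
theorem succ_pow_le_exp {m : ℕ} (hm : m ^ 3 ≤ N ^ 2) : ((N : ℝ) + 1) ^ m ≤ Real.exp (3 * N) := by
  set n : ℝ := (N : ℝ) ^ (1 / 3 : ℝ) with hn
  have hn0 : 0 ≤ n := by positivity
  have hn3 : n ^ 3 = N := by
    rw [hn, ← Real.rpow_natCast, ← Real.rpow_mul (Nat.cast_nonneg N)]; norm_num
  have hmn : (m : ℝ) ≤ n ^ 2 := by
    refine le_of_pow_le_pow_left₀ (n := 3) (by norm_num) (by positivity) ?_
    have : (m : ℝ) ^ 3 ≤ N ^ 2 := by exact_mod_cast hm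
    rw [← hn3] at this
    linarith [this, (by ring : (n ^ 3) ^ 2 = (n ^ 2) ^ 3)]
  have h1 : (N : ℝ) + 1 ≤ Real.exp (3 * n) := by
    calc (N : ℝ) + 1 ≤ (n + 1) ^ 3 := by rw [← hn3]; nlinarith [pow_nonneg hn0 2]
      _ ≤ Real.exp n ^ 3 := by gcongr; exact Real.add_one_le_exp n
      _ = _ := by rw [← Real.exp_nat_mul]; norm_num
  calc ((N : ℝ) + 1) ^ m ≤ Real.exp (3 * n) ^ m := by gcongr
    _ = Real.exp (m * (3 * n)) := (Real.exp_nat_mul _ _).symm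
    _ ≤ _ := by
        refine Real.exp_le_exp.2 ?_
        rw [← hn3]
        nlinarith [mul_le_mul_of_nonneg_right hmn hn0]

theorem card_pow_three_le {Q : Finset ℕ} (hQ : ∀ q ∈ Q, 2 ≤ q) (hQ3 : ∀ q ∈ Q, q ^ 3 ≤ N ^ 2) :
    Q.card ^ 3 ≤ N ^ 2 := by
  rcases Q.eq_empty_or_nonempty with rfl | hne
  · simp
  have h := Q.max'_mem hne
  have h1 : Q ⊆ Finset.Icc 1 (Q.max' hne) := fun q hq =>
    Finset.mem_Icc.2 ⟨by have := hQ q hq; omega, Q.le_max' q hq⟩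
  have h2 := Finset.card_le_card h1
  rw [Nat.card_Icc, Nat.add_sub_cancel] at h2
  exact (Nat.pow_le_pow_left h2 3).trans (hQ3 _ h)

theorem measure_biUnion_le_exp {Ω α : Type*} [MeasurableSpace Ω] {μ : Measure Ω} (s : Finset α)
    (B : α → Set Ω) {u v w : ℝ} (hs : (s.card : ℝ) ≤ Real.exp v)
    (hB : ∀ a ∈ s, μ (B a) ≤ ENNReal.ofReal (Real.exp (-u))) (hw : w ≤ u - v) :
    μ (⋃ a ∈ s, B a) ≤ ENNReal.ofReal (Real.exp (-w)) := by
  calc _ ≤ ∑ a ∈ s, μ (B a) := measure_biUnion_finset_le s B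
    _ ≤ ∑ _a ∈ s, ENNReal.ofReal (Real.exp (-u)) := Finset.sum_le_sum hB
    _ = ENNReal.ofReal (s.card * Real.exp (-u)) := by
        rw [Finset.sum_const, nsmul_eq_mul, ENNReal.ofReal_mul (Nat.cast_nonneg _),
          ENNReal.ofReal_natCast]
    _ ≤ _ := by
        refine ENNReal.ofReal_le_ofReal ?_
        calc (s.card : ℝ) * Real.exp (-u) ≤ Real.exp v * Real.exp (-u) := by gcongr
          _ = Real.exp (v - u) := by rw [← Real.exp_add]; ring_nf
          _ ≤ _ := Real.exp_le_exp.2 (by linarith)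

/-- The gradient bound is Cauchy–Schwarz with the projected gradient. The Hessian bound passes from
lattice points to all vectors with a loss of 4, which explains the K²/4 in `h3`. -/
theorem polyBound_of_bounds (hN : 0 < N) {q : ℕ} {u : (Fin q → Fin N) → ℝ}
    (hu : ∀ i, ¬ Function.Injective i → u i = 0) {K : ℝ} (hK : 0 ≤ K)
    (h1 : ∀ σ, spinPoly q u σ ^ 2 ≤ K ^ 2 * N ^ 2)
    (h2 : ∀ σ, ∑ k, (∑ l, ((if l = k then 1 else 0) - spin σ k / N * spin σ l) *
      grad l (spinPoly q u) σ) ^ 2 ≤ K ^ 2 * q * N)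
    (h3 : ∀ σ, ∀ z ∈ integerBall N, ∑ j, (∑ k, ((z k : ℝ) - (∑ i, (z i : ℝ) * spin σ i) / N *
      spin σ k) * grad j (grad k (spinPoly q u)) σ) ^ 2 ≤ K ^ 2 / 4 * q ^ 3 * N) :
    PolyBound K q (spinPoly q u) where
  abs_le σ := abs_le_of_sq_le_sq ((h1 σ).trans_eq (mul_pow _ _ _).symm) (by positivity)
  grad_le σ x hx := by
    have e : ∑ k, x k * grad k (spinPoly q u) σ = ∑ k, x k * ∑ l, ((if l = k then 1 else 0) -
        spin σ k / N * spin σ l) * grad l (spinPoly q u) σ := by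
      simp only [Finset.mul_sum]
      rw [Finset.sum_comm]
      refine Finset.sum_congr rfl fun l _ => ?_
      have := sum_proj_basis σ x l
      rw [hx, zero_div, zero_mul, sub_zero] at this
      simp only [← mul_assoc, ← Finset.sum_mul]
      rw [this]
    rw [e]
    calc _ ≤ (∑ k, x k ^ 2) * _ := Finset.sum_mul_sq_le_sq_mul_sq _ _ _
      _ ≤ (∑ k, x k ^ 2) * (K ^ 2 * q * N) :=
        mul_le_mul_of_nonneg_left (h2 σ) (Finset.sum_nonneg fun k _ => sq_nonneg _)
      _ = _ := mul_comm _ _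
  hess_le σ x hx := by
    let L : (Fin N → ℝ) →ₗ[ℝ] (Fin N → ℝ) :=
      { toFun := fun x j => ∑ k, (x k - (∑ i, x i * spin σ i) / N * spin σ k) *
          grad j (grad k (spinPoly q u)) σ
        map_add' := fun x y => by
          funext j
          simp only [Pi.add_apply, ← Finset.sum_add_distrib, add_mul (_ : ℝ) _ (spin _ _)]
          refine Finset.sum_congr rfl fun k _ => ?_
          rw [Finset.sum_add_distrib]; ring
        map_smul' := fun c x => by
          funext j
          simp only [Pi.smul_apply, smul_eq_mul, RingHom.id_apply, Finset.mul_sum, mul_assoc c]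
          refine Finset.sum_congr rfl fun k _ => ?_
          rw [← Finset.mul_sum]; ring }
    have := sum_sq_le_of_integer_points hN L (a := K ^ 2 / 4 * q ^ 3) (by positivity)
      (fun z hz => h3 σ z (mem_integerBall.2 hz)) x
    simp only [L, LinearMap.coe_mk, AddHom.coe_mk, hx, zero_div, zero_mul, sub_zero] at this
    exact this.trans_eq (by ring)
  euler := euler_spinPoly hu
  euler_grad := euler_grad_spinPoly hu

/-- Union bounds over degrees and configurations and, for the Hessian, lattice points: at most
e^{8N} events, each of probability at most e^{-9N}. -/
theorem polyBound_fail_le (hN : 0 < N) : couplingLaw N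
    {z | ¬ ∀ q ∈ Finset.Icc 2 N, PolyBound 36 q (randomPoly z q)} ≤
      ENNReal.ofReal (3 * Real.exp (-(N : ℝ))) := by
  have hN' : (1 : ℝ) ≤ N := by exact_mod_cast hN
  have hc := natCast_le_exp N
  have h2 := two_pow_le_exp N
  have hcard : ((Finset.Icc 2 N).card : ℝ) ≤ Real.exp N := by
    refine le_trans ?_ hc
    exact_mod_cast (by rw [Nat.card_Icc]; omega : (Finset.Icc 2 N).card ≤ N)
  have hconf : ((Finset.univ : Finset (Config N)).card : ℝ) ≤ Real.exp N := by
    rw [Finset.card_univ, card_config]; exact_mod_cast h2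
  set s₁ : Finset (ℕ × Config N) := Finset.Icc 2 N ×ˢ Finset.univ with hs₁
  set s₂ : Finset (ℕ × Config N × (Fin N → ℤ)) :=
    Finset.Icc 2 N ×ˢ Finset.univ ×ˢ integerBall N with hs₂
  have hc₁ : (s₁.card : ℝ) ≤ Real.exp (2 * N) := by
    rw [hs₁, Finset.card_product, two_mul, Real.exp_add]
    push_cast
    gcongr
  have hc₂ : (s₂.card : ℝ) ≤ Real.exp (8 * N) := by
    rw [hs₂, Finset.card_product, Finset.card_product,
      show (8 * N : ℝ) = N + (N + 6 * N) by ring, Real.exp_add, Real.exp_add]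
    push_cast
    gcongr
    exact card_integerBall_le N
  have hlt : ∀ q ∈ Finset.Icc 2 N, 0 < q ∧ q < N + 1 := fun q hq => by
    rw [Finset.mem_Icc] at hq; omega
  have b₁ := measure_biUnion_le_exp (μ := couplingLaw N) s₁ (fun a => {z | 2 * N +
    4 * (9 * N) * N ≤ randomPoly z a.1 a.2 ^ 2}) (u := 9 * N) (w := N) hc₁
    (fun a ha => randomPoly_tail hN (hlt _ (Finset.mem_product.1 ha).1).2 a.2) (by linarith)
  have b₂ := measure_biUnion_le_exp (μ := couplingLaw N) s₁ (fun a => {z | 2 * (a.1 * N) +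
    4 * (9 * N) * a.1 ≤ ∑ k, (∑ l, ((if l = k then 1 else 0) - spin a.2 k / N * spin a.2 l) *
      grad l (randomPoly z a.1) a.2) ^ 2}) (u := 9 * N) (w := N) hc₁
    (fun a ha => randomPoly_grad_tail hN (hlt _ (Finset.mem_product.1 ha).1).1
      (hlt _ (Finset.mem_product.1 ha).1).2 a.2) (by linarith)
  have b₃ := measure_biUnion_le_exp (μ := couplingLaw N) s₂ (fun a => {z | 2 * (4 * a.1 ^ 3 * N) +
    4 * (9 * N) * (4 * a.1 ^ 3) ≤ ∑ j, (∑ k, ((a.2.2 k : ℝ) - (∑ i, (a.2.2 i : ℝ) *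
      spin a.2.1 i) / N * spin a.2.1 k) * grad j (grad k (randomPoly z a.1)) a.2.1) ^ 2})
    (u := 9 * N) (w := N) hc₂ (fun a ha => by
      have ha' := Finset.mem_product.1 ha
      refine randomPoly_hess_tail hN (hlt _ ha'.1).1 (hlt _ ha'.1).2 a.2.1
        (sum_sub_proj_mul_spin hN a.2.1 fun k => (a.2.2 k : ℝ)) (by norm_num) ?_
      rw [sum_sq_sub_proj hN a.2.1 fun k => (a.2.2 k : ℝ)]
      have h1 := mem_integerBall.1 (Finset.mem_product.1 ha'.2).2
      have h2 : 0 ≤ (∑ i, (a.2.2 i : ℝ) * spin a.2.1 i) ^ 2 / N := by positivity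
      linarith) (by linarith)
  rw [show 3 * Real.exp (-(N : ℝ)) = Real.exp (-(N : ℝ)) + Real.exp (-(N : ℝ)) +
    Real.exp (-(N : ℝ)) by ring, ENNReal.ofReal_add (by positivity) (by positivity),
    ENNReal.ofReal_add (by positivity) (by positivity)]
  refine le_trans (measure_mono fun z hz => ?_) ((measure_union_le _ _).trans
    (add_le_add ((measure_union_le _ _).trans (add_le_add b₁ b₂)) b₃))
  by_contra hbad
  simp only [Set.mem_union, Set.mem_iUnion, not_or, not_exists] at hbad
  obtain ⟨⟨e₁, e₂⟩, e₃⟩ := hbad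
  refine hz fun q hq => ?_
  have hq0 : (0 : ℝ) ≤ q := Nat.cast_nonneg q
  refine polyBound_of_bounds hN (coeff_eq_zero z q) (by norm_num) (fun σ => ?_) (fun σ => ?_)
    fun σ v hv => ?_
  · have := e₁ (q, σ) (Finset.mem_product.2 ⟨hq, Finset.mem_univ _⟩)
    refine (not_le.1 this).le.trans ?_
    nlinarith
  · have := e₂ (q, σ) (Finset.mem_product.2 ⟨hq, Finset.mem_univ _⟩)
    refine (not_le.1 this).le.trans ?_
    simp only
    nlinarith [mul_nonneg hq0 (Nat.cast_nonneg N : (0 : ℝ) ≤ N)]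
  · have := e₃ (q, σ, v) (Finset.mem_product.2 ⟨hq, Finset.mem_product.2 ⟨Finset.mem_univ _, hv⟩⟩)
    refine (not_le.1 this).le.trans ?_
    simp only
    nlinarith [mul_nonneg (pow_nonneg hq0 3) (Nat.cast_nonneg N : (0 : ℝ) ≤ N)]

theorem le_of_pow_three_le {q : ℕ} (h : q ^ 3 ≤ N ^ 2) : q ≤ N := by
  by_contra! hlt
  have h1 : N ^ 2 < q ^ 2 := Nat.pow_lt_pow_left hlt (by norm_num)
  have h2 : q ^ 2 ≤ q ^ 3 := Nat.pow_le_pow_right (by omega) (by norm_num)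
  omega

/-- Degrees, blocks and boundary conditions contribute at most e^N each and the temperature grid
e^{3N}, against a tail e^{-9N}. -/
theorem secondMomentBound_fail_le (hN : 0 < N) {Q : Finset ℕ} (hQ2 : ∀ q ∈ Q, 2 ≤ q)
    (hQ3 : ∀ q ∈ Q, q ^ 3 ≤ N ^ 2) (b : ℕ → ℝ) (h : Config N → ℝ) : couplingLaw N
    {z | ¬ SecondMomentBound 36 Q b (randomPoly z) h} ≤ ENNReal.ofReal (Real.exp (-(N : ℝ))) := by
  have hN' : (1 : ℝ) ≤ N := by exact_mod_cast hN
  have hQN : ∀ q ∈ Q, q ≤ N := fun q hq => le_of_pow_three_le (hQ3 q hq)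
  have hc := natCast_le_exp N
  have h2 := two_pow_le_exp N
  have hcardQ : (Q.card : ℝ) ≤ Real.exp N := by
    refine le_trans ?_ hc
    have : Q ⊆ Finset.Icc 1 N := fun q hq => by
      have := hQ2 q hq; have := hQN q hq; rw [Finset.mem_Icc]; omega
    have := Finset.card_le_card this
    rw [Nat.card_Icc, Nat.add_sub_cancel] at this
    exact_mod_cast this
  set 𝒜 : Finset (Finset (Fin N)) := Finset.univ.filter fun A => 2 * A.card ≤ N with h𝒜
  have hcardA : (𝒜.card : ℝ) ≤ Real.exp N := by
    refine le_trans ?_ h2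
    have := Finset.card_filter_le (Finset.univ : Finset (Finset (Fin N)))
      (fun A => 2 * A.card ≤ N)
    rw [Finset.card_univ, Fintype.card_finset, Fintype.card_fin] at this
    exact_mod_cast this
  have hconf : ((Finset.univ : Finset (Config N)).card : ℝ) ≤ Real.exp N := by
    rw [Finset.card_univ, card_config]; exact_mod_cast h2
  have hcardt : ((Finset.univ : Finset (Q → Fin (N + 1))).card : ℝ) ≤ Real.exp (3 * N) := by
    rw [Finset.card_univ, Fintype.card_fun, Fintype.card_fin, Fintype.card_coe]
    have := succ_pow_le_exp (card_pow_three_le hQ2 hQ3)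
    exact_mod_cast this
  set s : Finset (ℕ × Finset (Fin N) × Config N × (Q → Fin (N + 1))) :=
    Q ×ˢ 𝒜 ×ˢ Finset.univ ×ˢ Finset.univ with hs
  have hcs : (s.card : ℝ) ≤ Real.exp (6 * N) := by
    rw [hs, Finset.card_product, Finset.card_product, Finset.card_product,
      show (6 * N : ℝ) = N + (N + (N + 3 * N)) by ring, Real.exp_add, Real.exp_add, Real.exp_add]
    push_cast
    gcongr
  let ext : (Q → Fin (N + 1)) → ℕ → ℕ := fun t q => if hq : q ∈ Q then t ⟨q, hq⟩ else 0
  let H : ℕ → (Q → Fin (N + 1)) → (CouplingIndex N → ℝ) → Config N → ℝ := fun q t z σ =>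
    h σ + ∑ r ∈ Q.erase q, (ext t r : ℝ) / N * (b r * randomPoly z r σ)
  have hb := measure_biUnion_le_exp (μ := couplingLaw N) s (fun a => {z | ∀ σ ∈ fiber a.2.1 a.2.2.1,
      2 * N + 4 * (9 * N) * (N * condMean (fiber a.2.1 a.2.2.1) (H a.1 a.2.2.2 z)
        (fun σ' => overlap σ σ' ^ a.1)) < condMean (fiber a.2.1 a.2.2.1) (H a.1 a.2.2.2 z)
          (fun σ => randomPoly z a.1 σ ^ 2)}) (u := 9 * N) (w := N) hcs (fun a ha => by
    have ha1 := Finset.mem_product.1 ha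
    have ha2 := Finset.mem_product.1 ha1.2
    refine second_moment_tail hN (Nat.lt_succ_of_le (hQN _ ha1.1)) (Finset.mem_filter.1 ha2.1).2
      a.2.2.1 (fun σ => ?_) fun x y => ?_
    · exact (Finset.measurable_sum _ fun r _ =>
        ((measurable_randomPoly r σ).const_mul _).const_mul _).const_add _
    · funext σ
      simp only [H]
      congr 1
      exact Finset.sum_congr rfl fun r hr => by
        rw [randomPoly_glue_ne (Finset.ne_of_mem_erase hr)]) (by linarith)
  refine (measure_mono fun z hz => ?_).trans hb
  by_contra hbad
  simp only [Set.mem_iUnion, not_exists] at hbad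
  refine hz fun q hq A hA τ t ht => ?_
  have hq1 : 1 ≤ √(q : ℝ) := Real.one_le_sqrt.2 (by exact_mod_cast (by have := hQ2 q hq; omega))
  have hA' : 2 * A.card ≤ N := by
    have : (2 : ℝ) * A.card ≤ N := by
      refine le_trans ?_ hA
      have : (0 : ℝ) ≤ A.card := Nat.cast_nonneg _
      nlinarith
    exact_mod_cast this
  have hmem : ((q, A, τ, fun r : Q => (⟨t r, Nat.lt_succ_of_le (ht r)⟩ : Fin (N + 1))) :
      ℕ × Finset (Fin N) × Config N × (Q → Fin (N + 1))) ∈ s := by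
    simp [hs, h𝒜, hq, hA']
  have := hbad _ hmem
  have hHt : (fun σ => h σ + ∑ q ∈ Q.erase q, (t q : ℝ) / N * (b q * randomPoly z q σ)) =
      H q (fun r : Q => (⟨t r, Nat.lt_succ_of_le (ht r)⟩ : Fin (N + 1))) z := by
    funext σ
    simp only [H]
    congr 1
    refine Finset.sum_congr rfl fun r hr => ?_
    simp only [ext, dif_pos (Finset.mem_of_mem_erase hr)]
  rw [hHt]
  change ¬ ∀ σ ∈ fiber A τ, _ at this
  push Not at this
  obtain ⟨σ, hσ, hle⟩ := this
  -- The constant K = 36 is 4 · 9, from the choice u = 9N in the tail bound.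
  exact ⟨σ, hσ, hle.trans (by nlinarith)⟩

/-! ### Conclusion for the mixed p-spin Hamiltonian -/

theorem pderiv_sq (k : Fin N) (f : Config N → ℝ) (σ : Config N) :
    pderiv k f σ ^ 2 = grad k f σ ^ 2 := by
  rw [grad, mul_pow, spin_sq, one_mul, pderiv]

theorem mean_eq (H f : Config N → ℝ) :
    mean H f = (∑ σ, Real.exp (H σ) * f σ) / partitionFunction H := by
  rw [mean, Finset.sum_div]
  exact Finset.sum_congr rfl fun σ _ => by rw [gibbs]; ring

theorem partitionFunction_pos (H : Config N → ℝ) : 0 < partitionFunction H :=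
  Finset.sum_pos (fun _ _ => Real.exp_pos _) ⟨1, Finset.mem_univ _⟩

theorem cov_self_eq (H f : Config N → ℝ) : cov H f f =
    (∑ σ, Real.exp (H σ) * (f σ - condMean Finset.univ H f) ^ 2) / partitionFunction H := by
  have hZ := (partitionFunction_pos H).ne'
  have hm : condMean Finset.univ H f = mean H f := (mean_eq H f).symm
  have h1 : ∑ σ, Real.exp (H σ) * f σ = mean H f * partitionFunction H := by
    rw [mean_eq, div_mul_cancel₀ _ hZ]
  rw [hm, cov, mean_eq H fun σ => f σ * f σ]
  have h2 : ∑ σ, Real.exp (H σ) * (f σ - mean H f) ^ 2 = ∑ σ, Real.exp (H σ) * (f σ * f σ) -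
      mean H f * mean H f * partitionFunction H := by
    have h3 : ∀ σ, Real.exp (H σ) * (f σ - mean H f) ^ 2 = Real.exp (H σ) * (f σ * f σ) -
        2 * mean H f * (Real.exp (H σ) * f σ) + mean H f ^ 2 * Real.exp (H σ) := fun σ => by ring
    simp only [h3, Finset.sum_add_distrib, Finset.sum_sub_distrib, ← Finset.mul_sum, h1]
    rw [← partitionFunction]
    ring
  rw [h2]
  field_simp

theorem dirichlet_eq (H f : Config N → ℝ) : dirichlet H f =
    (∑ k, ∑ σ, Real.exp (H σ) * (spinVar H k σ * grad k f σ ^ 2)) / partitionFunction H := by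
  rw [dirichlet, Finset.sum_div]
  refine Finset.sum_congr rfl fun k _ => ?_
  rw [mean_eq]
  simp only [pderiv_sq]
  rfl

theorem BlockGap.inverseGap_le {H : Config N → ℝ} {a : ℝ} (h : BlockGap Finset.univ H a)
    (ha : 0 ≤ a) : inverseGap H ≤ ENNReal.ofReal a := by
  refine iSup₂_le fun f _ => ENNReal.div_le_of_le_mul ?_
  rw [← ENNReal.ofReal_mul ha]
  refine ENNReal.ofReal_le_ofReal ?_
  have := h 1 f
  rw [fiber_univ] at this
  rw [cov_self_eq, dirichlet_eq, ← mul_div_assoc]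
  exact div_le_div_of_nonneg_right this (partitionFunction_pos H).le

theorem grad_grad_field (η : Fin N → ℝ) (i j : Fin N) (σ : Config N) :
    grad i (grad j fun σ => ∑ k, η k * spin σ k) σ = 0 := by
  have h : (grad j fun σ : Config N => ∑ k, η k * spin σ k) = fun _ => η j := by
    funext σ
    rw [grad_sum]
    simp only [grad_const_mul]
    rw [Finset.sum_eq_single j (fun k _ hk => ?_) (by simp)]
    · rw [grad_spin_self, mul_one]
    · rw [grad_spin_ne hk, mul_zero]
  rw [h, grad]; ring

/-- Degrees with q³ ≤ N² form a regular system, taken at full temperature t = N. For the others N ≤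
q^{3/2}, so their total energy is at most Kκ in sup norm and enters as a Holley–Stroock
perturbation. -/
theorem blockGap_of_bounds (hN : 0 < N) {K : ℝ} (hK : 1 ≤ K) {b : ℕ → ℝ}
    (hb : ∀ q, 2 ≤ q → 0 ≤ b q) {p : ℕ → Config N → ℝ} {h : Config N → ℝ}
    (hp : ∀ q ∈ Finset.Icc 2 N, PolyBound K q (p q)) (hh : ∀ i j σ, grad i (grad j h) σ = 0)
    (hsm : SecondMomentBound K ((Finset.Icc 2 N).filter fun q => q ^ 3 ≤ N ^ 2) b p h)
    {κ : ℝ} (hκ : ∑ q ∈ Finset.Icc 2 N, √(q : ℝ) ^ 3 * b q ≤ κ) (hs : 1000 * K ^ 3 * κ ≤ 1) :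
    BlockGap Finset.univ (fun σ => h σ + ∑ q ∈ Finset.Icc 2 N, b q * p q σ)
      ((1 - 303 * K ^ 3 * κ)⁻¹ * Real.exp (2 * (K * κ))) := by
  have hN' : (0 : ℝ) < N := by exact_mod_cast hN
  set Q := (Finset.Icc 2 N).filter fun q => q ^ 3 ≤ N ^ 2 with hQ
  have hb0 : ∀ q ∈ Finset.Icc 2 N, 0 ≤ √(q : ℝ) ^ 3 * b q := fun q hq =>
    mul_nonneg (by positivity) (hb q (Finset.mem_Icc.1 hq).1)
  have hκQ : ∑ q ∈ Q, √(q : ℝ) ^ 3 * b q ≤ κ :=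
    (Finset.sum_le_sum_of_subset_of_nonneg (Finset.filter_subset _ _)
      fun q hq _ => hb0 q hq).trans hκ
  have hκ0 : 0 ≤ κ := (Finset.sum_nonneg hb0).trans hκ
  have hK3 : 0 < K ^ 3 := by positivity
  have hsmall : 1000 * K ^ 3 * ∑ q ∈ Q, √(q : ℝ) ^ 3 * b q ≤ 1 :=
    (mul_le_mul_of_nonneg_left hκQ (by positivity)).trans hs
  have S : RegularSystem K Q b p h :=
    { N_pos := hN
      one_le_K := hK
      b_nonneg := fun q hq => hb q (Finset.mem_Icc.1 (Finset.mem_filter.1 hq).1).1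
      two_le := fun q hq => (Finset.mem_Icc.1 (Finset.mem_filter.1 hq).1).1
      cube_le := fun q hq => (Finset.mem_filter.1 hq).2
      poly := fun q hq => hp q (Finset.mem_filter.1 hq).1
      hess_field := hh
      second_moment := hsm
      small := hsmall }
  have h1 := S.blockGap Finset.univ (t := fun _ => N) fun _ => le_rfl
  have hle : (1 - 303 * K ^ 3 * ∑ q ∈ Q, √(q : ℝ) ^ 3 * b q)⁻¹ ≤ (1 - 303 * K ^ 3 * κ)⁻¹ := by
    have := mul_le_mul_of_nonneg_left hκQ hK3.le
    have := mul_nonneg hK3.le hκ0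
    refine inv_anti₀ (by linarith) (by linarith)
  have hpos : 0 ≤ (1 - 303 * K ^ 3 * κ)⁻¹ := by
    have := mul_nonneg hK3.le hκ0
    exact inv_nonneg.2 (by linarith)
  refine (h1.mono hle).perturb hpos fun σ => ?_
  have hen : RegularSystem.energy N Q b p h (fun _ => N) σ = h σ + ∑ q ∈ Q, b q * p q σ := by
    simp only [RegularSystem.energy, div_self hN'.ne', one_mul]
  rw [hen, ← Finset.sum_filter_add_sum_filter_not (Finset.Icc 2 N) (fun q => q ^ 3 ≤ N ^ 2),
    add_sub_add_left_eq_sub, add_sub_cancel_left]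
  calc _ ≤ ∑ q ∈ (Finset.Icc 2 N).filter (fun q => ¬ q ^ 3 ≤ N ^ 2), |b q * p q σ| :=
        Finset.abs_sum_le_sum_abs _ _
    _ ≤ ∑ q ∈ (Finset.Icc 2 N).filter (fun q => ¬ q ^ 3 ≤ N ^ 2), K * (√(q : ℝ) ^ 3 * b q) := by
        refine Finset.sum_le_sum fun q hq => ?_
        obtain ⟨hq1, hq2⟩ := Finset.mem_filter.1 hq
        have hbq := hb q (Finset.mem_Icc.1 hq1).1
        have hNq : (N : ℝ) ≤ √(q : ℝ) ^ 3 := by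
          refine le_of_pow_le_pow_left₀ (n := 2) (by norm_num) (by positivity) ?_
          rw [← pow_mul, mul_comm 3 2, pow_mul, Real.sq_sqrt (Nat.cast_nonneg q)]
          exact_mod_cast (not_le.1 hq2).le
        rw [abs_mul, abs_of_nonneg hbq]
        calc b q * |p q σ| ≤ b q * (K * N) :=
              mul_le_mul_of_nonneg_left ((hp q hq1).abs_le σ) hbq
          _ ≤ b q * (K * √(q : ℝ) ^ 3) := by gcongr
          _ = _ := by ring
    _ ≤ ∑ q ∈ Finset.Icc 2 N, K * (√(q : ℝ) ^ 3 * b q) :=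
        Finset.sum_le_sum_of_subset_of_nonneg (Finset.filter_subset _ _) fun q hq _ =>
          mul_nonneg (by linarith) (hb0 q hq)
    _ ≤ K * κ := by
        rw [← Finset.mul_sum]
        exact mul_le_mul_of_nonneg_left hκ (by linarith)

/-- Only Σ p^{3/2} β_p is needed: log p ≥ log 2 ≥ 1/4 removes the logarithm at the cost of a factor
2. -/
theorem sum_sqrt_pow_three_mul_le {b : ℕ → ℝ} (hb : ∀ q, 2 ≤ q → 0 ≤ b q)
    (hs : Summable fun p : {p : ℕ // 2 ≤ p} => √((p : ℝ) ^ 3 * Real.log (p : ℝ)) * b p) (N : ℕ) :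
    ∑ q ∈ Finset.Icc 2 N, √(q : ℝ) ^ 3 * b q ≤
      2 * ∑' p : {p : ℕ // 2 ≤ p}, √((p : ℝ) ^ 3 * Real.log (p : ℝ)) * b p := by
  have h1 := hs.sum_le_tsum ((Finset.Icc 2 N).subtype fun p => 2 ≤ p) fun p _ =>
    mul_nonneg (Real.sqrt_nonneg _) (hb p p.2)
  have h2 := Finset.sum_subtype_of_mem (s := Finset.Icc 2 N) (p := fun p => 2 ≤ p)
    (fun p : ℕ => √((p : ℝ) ^ 3 * Real.log (p : ℝ)) * b p) fun p hp => (Finset.mem_Icc.1 hp).1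
  rw [h2] at h1
  refine le_trans ?_ (mul_le_mul_of_nonneg_left h1 (by norm_num))
  rw [Finset.mul_sum]
  refine Finset.sum_le_sum fun q hq => ?_
  have hq2 := (Finset.mem_Icc.1 hq).1
  have hlog : 1 / 4 ≤ Real.log q := by
    have h3 : Real.log 2 ≤ Real.log q := Real.log_le_log (by norm_num) (by exact_mod_cast hq2)
    linarith [Real.log_two_gt_d9]
  rw [← mul_assoc]
  refine mul_le_mul_of_nonneg_right ?_ (hb q hq2)
  have hq3 : (0 : ℝ) ≤ (q : ℝ) ^ 3 := by positivity
  refine le_of_pow_le_pow_left₀ (n := 2) (by norm_num) (by positivity) ?_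
  rw [mul_pow, Real.sq_sqrt (mul_nonneg hq3 (by linarith)), ← pow_mul, mul_comm 3 2, pow_mul,
    Real.sq_sqrt (Nat.cast_nonneg q)]
  nlinarith

/-- e^{2y} ≤ (1 − 2x)⁻¹ and (1 − 303x)(1 − 2x) ≥ 1 − 305x, while 1000x(1 + ε) ≤ ε. -/
theorem gap_constant_le {ε x y : ℝ} (hε : 0 < ε) (hx0 : 0 ≤ x) (hx : x ≤ ε / (1000 * (1 + ε)))
    (hy : y ≤ x) : (1 - 303 * x)⁻¹ * Real.exp (2 * y) ≤ 1 + ε := by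
  have h1 : 1000 * x * (1 + ε) ≤ ε := by
    rw [le_div_iff₀ (by positivity)] at hx; linarith
  have h2 : 1000 * x ≤ 1 := by nlinarith
  have h3 : Real.exp (2 * y) ≤ (1 - 2 * x)⁻¹ := by
    rw [← neg_neg (2 * y), Real.exp_neg]
    refine inv_anti₀ (by linarith) ?_
    linarith [Real.add_one_le_exp (-(2 * y))]
  have h4 : 0 < 1 - 303 * x := by linarith
  have h5 : 0 < 1 - 2 * x := by linarith
  calc _ ≤ (1 - 303 * x)⁻¹ * (1 - 2 * x)⁻¹ :=
        mul_le_mul_of_nonneg_left h3 (inv_nonneg.2 h4.le)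
    _ = ((1 - 303 * x) * (1 - 2 * x))⁻¹ := (mul_inv _ _).symm
    _ ≤ 1 + ε := by
        rw [inv_le_iff_one_le_mul₀ (mul_pos h4 h5)]
        nlinarith [mul_nonneg hx0 hx0, mul_nonneg (mul_nonneg hx0 hx0) hε.le]

/-- The couplings of a system of size `N`, extracted from an infinite family. -/
def extract (N : ℕ) (g : (p : ℕ) → (Fin p → ℕ) → ℝ) : CouplingIndex N → ℝ :=
  fun j => g j.1 fun k => (j.2.1 k : ℕ)

theorem coeff_extract {g : (p : ℕ) → (Fin p → ℕ) → ℝ}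
    (hg : ∀ p i, ¬ Function.Injective i → g p i = 0) (q : ℕ) (i : Fin q → Fin N) :
    coeff (extract N g) q i = g q fun k => (i k : ℕ) := by
  by_cases hi : Function.Injective i
  · have : q < N + 1 := by
      have := Fintype.card_le_of_injective i hi
      simp only [Fintype.card_fin] at this
      omega
    rw [coeff, dif_pos ⟨this, hi⟩, extract]
  · rw [coeff_eq_zero _ _ _ hi, hg]
    exact fun h => hi (Function.Injective.of_comp (f := Fin.val) h)

theorem hamiltonian_eq (b : ℕ → ℝ) {g : (p : ℕ) → (Fin p → ℕ) → ℝ}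
    (hg : ∀ p i, ¬ Function.Injective i → g p i = 0) (η : Fin N → ℝ) : hamiltonian b g η =
    fun σ => ∑ j, η j * spin σ j + ∑ q ∈ Finset.Icc 2 N, b q * randomPoly (extract N g) q σ := by
  funext σ
  have h1 : ∀ q : ℕ, b q / (N : ℝ) ^ (((q : ℝ) - 1) / 2) *
      ∑ i : Fin q → Fin N, g q (fun k => (i k : ℕ)) * ∏ k, spin σ (i k) =
      b q * randomPoly (extract N g) q σ := by
    intro q
    simp only [randomPoly, spinPoly, coeff_extract hg, scale, monomial]
    ring
  rw [hamiltonian, add_comm]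
  congr 1
  simp only [h1]
  rw [tsum_eq_sum (s := (Finset.Icc 2 N).subtype fun p => 2 ≤ p) fun p hp => ?_]
  · exact Finset.sum_subtype_of_mem
      (fun q : ℕ => b q * randomPoly (extract N g) q σ) fun p hp => (Finset.mem_Icc.1 hp).1
  · have hlt : N < p := by
      have := p.2
      simp only [Finset.mem_subtype, Finset.mem_Icc] at hp
      omega
    rw [randomPoly, spinPoly, Finset.sum_eq_zero fun i _ => ?_, mul_zero, mul_zero]
    rw [coeff_eq_zero _ _ _ fun hi => ?_, zero_mul]
    have := Fintype.card_le_of_injective i hi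
    simp only [Fintype.card_fin] at this
    omega

theorem IsGaussianCoupling.map_extract {Ω : Type*} [MeasurableSpace Ω] {P : Measure Ω}
    [IsProbabilityMeasure P] {g : (p : ℕ) → (Fin p → ℕ) → Ω → ℝ} (hg : IsGaussianCoupling P g)
    (N : ℕ) : AEMeasurable (fun ω => extract N fun p i => g p i ω) P ∧
      P.map (fun ω => extract N fun p i => g p i ω) = couplingLaw N := by
  let e : CouplingIndex N → {t : (p : ℕ) × (Fin p → ℕ) // Function.Injective t.2} := fun j =>
    ⟨⟨j.1, fun k => (j.2.1 k : ℕ)⟩, Fin.val_injective.comp j.2.2⟩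
  have he : Function.Injective e := by
    rintro ⟨⟨q, hq⟩, i, hi⟩ ⟨⟨q', hq'⟩, i', hi'⟩ h
    simp only [e, Subtype.mk.injEq, Sigma.mk.injEq] at h
    obtain ⟨rfl, h⟩ := h
    have : i = i' := by
      funext k
      exact Fin.ext (congrFun (eq_of_heq h) k)
    subst this
    rfl
  have hlaw : ∀ j : CouplingIndex N, HasLaw (g j.1 fun k => (j.2.1 k : ℕ)) (gaussianReal 0 1) P :=
    fun j => hg.hasLaw _ _ (e j).2
  have hi := hg.indep.precomp he
  have hm : ∀ j : CouplingIndex N, AEMeasurable (g j.1 fun k => (j.2.1 k : ℕ)) P :=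
    fun j => (hlaw j).aemeasurable
  refine ⟨aemeasurable_pi_lambda _ hm, ?_⟩
  refine ((iIndepFun_iff_map_fun_eq_pi_map hm).1 hi).trans ?_
  simp only [(hlaw _).map_eq]

end MixedPSpin

end

theorem theorem1 :
    ∀ ε : ℝ, 0 < ε → ∃ β₀ : ℝ, 0 < β₀ ∧
      ∀ b : ℕ → ℝ, (∀ p, 2 ≤ p → 0 ≤ b p) →
        Summable (fun p : {p : ℕ // 2 ≤ p} => √((p : ℝ) ^ 3 * Real.log (p : ℝ)) * b p) →
        ∑' p : {p : ℕ // 2 ≤ p}, √((p : ℝ) ^ 3 * Real.log (p : ℝ)) * b p < β₀ →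
        ∃ c C : ℝ, 0 < c ∧ 0 < C ∧
          ∀ (Ω : Type*) [MeasurableSpace Ω] (P : Measure Ω) [IsProbabilityMeasure P]
            (g : (p : ℕ) → (Fin p → ℕ) → Ω → ℝ), MixedPSpin.IsGaussianCoupling P g →
          ∀ (N : ℕ), 1 ≤ N → ∀ η : Fin N → ℝ,
            P {ω | ENNReal.ofReal (1 + ε) <
                MixedPSpin.inverseGap (MixedPSpin.hamiltonian b (fun p i => g p i ω) η)}
              ≤ ENNReal.ofReal (C * Real.exp (-c * N)) := by
  intro ε hε
  -- This choice gives K³κ ≤ ε/(1000(1 + ε)) for K = 36 and κ = 2β.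
  refine ⟨ε / (1000 * (1 + ε)) / (2 * 36 ^ 3), by positivity, fun b hb hs hlt => ?_⟩
  -- 4 = 3 + 1: three families of polynomial bounds and one second-moment bound, each failing with
  -- probability at most e^{-N}.
  refine ⟨1, 4, one_pos, by norm_num, fun Ω _ P _ g hg N hN η => ?_⟩
  set β := ∑' p : {p : ℕ // 2 ≤ p}, √((p : ℝ) ^ 3 * Real.log (p : ℝ)) * b p with hβ
  have hβ0 : 0 ≤ β := tsum_nonneg fun p => mul_nonneg (Real.sqrt_nonneg _) (hb p p.2)
  rw [lt_div_iff₀ (by norm_num)] at hlt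
  set h : MixedPSpin.Config N → ℝ := fun σ => ∑ j, η j * MixedPSpin.spin σ j
  set Q := (Finset.Icc 2 N).filter fun q => q ^ 3 ≤ N ^ 2
  set B : Set (MixedPSpin.CouplingIndex N → ℝ) :=
    {z | ¬ ∀ q ∈ Finset.Icc 2 N, MixedPSpin.PolyBound 36 q (MixedPSpin.randomPoly z q)} ∪
      {z | ¬ MixedPSpin.SecondMomentBound 36 Q b (MixedPSpin.randomPoly z) h}
  have hB : MixedPSpin.couplingLaw N B ≤ ENNReal.ofReal (4 * Real.exp (-1 * N)) := by
    rw [neg_one_mul, show 4 * Real.exp (-(N : ℝ)) = 3 * Real.exp (-(N : ℝ)) + Real.exp (-(N : ℝ)) by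
      ring, ENNReal.ofReal_add (by positivity) (by positivity)]
    exact (measure_union_le _ _).trans (add_le_add (MixedPSpin.polyBound_fail_le hN)
      (MixedPSpin.secondMomentBound_fail_le hN
        (fun q hq => (Finset.mem_Icc.1 (Finset.mem_filter.1 hq).1).1)
        (fun q hq => (Finset.mem_filter.1 hq).2) b h))
  obtain ⟨hm, hlaw⟩ := hg.map_extract N
  rw [← hlaw] at hB
  -- Outer measures suffice here: `Measure.le_map_apply` needs no measurability of the bad set.
  refine ((measure_mono fun ω hω => ?_).trans (Measure.le_map_apply hm B)).trans hB
  by_contra hgood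
  simp only [B, Set.preimage_union, Set.mem_union, not_or] at hgood
  obtain ⟨hp, hsm⟩ := hgood
  have hx : 36 ^ 3 * (2 * β) ≤ ε / (1000 * (1 + ε)) := by linarith
  have hε1 : ε / (1000 * (1 + ε)) ≤ 1 / 1000 := by
    rw [div_le_div_iff₀ (by positivity) (by norm_num)]; linarith
  have hgap := MixedPSpin.blockGap_of_bounds hN (by norm_num) hb (not_not.1 hp)
    (MixedPSpin.grad_grad_field η) (not_not.1 hsm) (MixedPSpin.sum_sqrt_pow_three_mul_le hb hs N)
    (by linarith)
  rw [Set.mem_ofPred_eq] at hω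
  refine hω.not_ge ?_
  rw [MixedPSpin.hamiltonian_eq b (fun p i hi => hg.eq_zero p i hi ω) η]
  refine (hgap.mono ?_).inverseGap_le (by positivity)
  rw [mul_assoc 303]
  exact MixedPSpin.gap_constant_le hε (by positivity) hx (by linarith)
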